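/- **Setting.** Let $\mathcal R=[x_l,x_r]\times[y_l,y_r]$ with $x_l<x_r$, $y_l<y_r$, and let $a,b,K,\sigma\in\mathbb R$ with $K\le 0$ and $\sigma\ge 0$. Consider $$\Delta u+a u_x+b u_y+Ku=f \ \text{ in } \mathcal R,\qquad u=u_1 \ \text{ on } \partial\mathcal R_1,\qquad \frac{\partial u}{\partial n}+\sigma u=g\ \text{ on } \partial\mathcal R_2 ,$$ where $n$ is the outer unit normal, $\partial\mathcal R_2$ (the flux part: Robin, or Neumann if $\sigma=0$) is empty, one side, or two opposite sides of $\mathcal R$, and $\partial\mathcal R_1$ (the Dirichlet part) is the union of the remaining closed sides. Use a uniform mesh $x_i=x_l+ih$ $(0\le i\le M)$, $y_j=y_l+jh$ $(0\le j\le N)$ with $Mh=x_r-x_l$, $Nh=y_r-y_l$. **The HOC scheme.** At an interior grid point the equation is $$\sum_{p,q=-1}^{1}\alpha_{pq}U_{i+p,j+q}=\sum_{p,q=-1}^{1}\beta_{pq}f(x_{i+p},y_{j+q}),\qquad \sum_{p,q}\beta_{pq}=1 .$$ The coefficients are determined as follows. In $\sum\alpha u-\sum\beta f$ expand $u$ at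 $(x_i,y_j)$ to order $4$ and $f$ to order $2$, express the derivatives of $f$ through those of $u$ by differentiating the PDE, and set the coefficients of all $\partial_x^k\partial_y^l u$, $k+l\le4$, equal to zero. The coefficient vector is the least-squares solution of smallest Euclidean norm of these 15 linear equations subject to $\sum\beta=1$ (hence the pseudo-inverse, or SVD, solution of the whole system whenever that system is solvable). At a flux boundary grid point (a grid point of a flux side that is not a corner) on the side $x=x_l$ the equation is $$\sum_{p=0}^{1}\sum_{q=-1}^{1}\alpha_{pq}U_{p,j+q}=\sum_{p,q=-1}^{1}\beta_{pq}F_{p,j+q}+\sum_{q=-1}^{1}\gamma_q\, g(x_l,y_{j+q}),\qquad \sum_{p,q}\beta_{pq}=1 ,$$ with coefficients determined in the same way from $\sum\alpha u-\sum\beta f-\sum\gamma g$, where also $g=-u_x+\sigma u$ is expanded to order $3$ in $y$. On the other sides the same construction is used in the coordinates (inner normal, tangent). Here $F=f$ at the grid points of $\mathcal R$, and on the grid line just outside a flux side $F$ is any third order accurate extension of $f$: for some $E\ge0$ it differs by at most $Eh^3$ from the quadratic extrapolation $3f_0-3f_1+f_2$ of $f$ along the inner normal. At the grid points of $\partial\mathcal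 R_1$ one sets $U=u_1$. The local truncation error $T_h$ at an interior or flux boundary grid point is the left side minus the right side of the equation with $U$ replaced by the exact solution $u$. **Theorem.** There are $h_0>0$ and constants $C_1,C_2,\bar C$, depending only on $a,b,K,\sigma$, the rectangle and the choice of the flux sides, such that for all meshes as above with $0<h\le h_0$, all solutions $u\in C^6(\mathcal R)$ (with one-sided derivatives at the boundary) and all such $E,F$, the scheme has a unique solution $U$, and $$|T_h|\le C_1\max_{3\le k\le 6}\|D^ku\|_{\infty,\mathcal R}\;h^4\quad\text{at interior grid points},$$ $$|T_h|\le C_2\Bigl(\max_{0\le k\le5}\|D^ku\|_{\infty,\mathcal R}+E\Bigr)h^3\quad\text{at flux boundary grid points},$$ $$\max_{i,j}|u(x_i,y_j)-U_{ij}|\le \bar C\Bigl(\max_{0\le k\le 6}\|D^ku\|_{\infty,\mathcal R}+E\Bigr)h^4 ,$$ where $\|D^ku\|_{\infty,\mathcal R}$ is the maximum over $\mathcal R$ of all partial derivatives of order $k$ in absolute value. -/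

import Mathlib

open Set

/-! ### The closed rectangle, partial derivatives up to the boundary, and the operator -/

/-- The closed rectangle `[xl, xr] × [yl, yr]`. -/
def rect (xl xr yl yr : ℝ) : Set (ℝ × ℝ) := Icc xl xr ×ˢ Icc yl yr

/-- The partial derivative `∂ₓᵏ ∂ᵧˡ u` at `p`, taken within the set `R`
(so one-sided derivatives at boundary points of a closed rectangle). -/
noncomputable def pderiv (R : Set (ℝ × ℝ)) (k l : ℕ) (u : ℝ × ℝ → ℝ) (p : ℝ × ℝ) : ℝ :=
  iteratedFDerivWithin ℝ (k + l) u R p (fun i => if (i : ℕ) < k then (1, 0) else (0, 1))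

/-- `M` bounds on `R` every partial derivative of `u` whose order is between `lo` and `hi`. -/
def DerivBound (R : Set (ℝ × ℝ)) (lo hi : ℕ) (u : ℝ × ℝ → ℝ) (M : ℝ) : Prop :=
  ∀ k l : ℕ, lo ≤ k + l → k + l ≤ hi → ∀ p ∈ R, |pderiv R k l u p| ≤ M

/-- `Δu + a uₓ + b uᵧ + K u`. -/
noncomputable def diffAdv (a b K : ℝ) (R : Set (ℝ × ℝ)) (u : ℝ × ℝ → ℝ) (p : ℝ × ℝ) : ℝ :=
  pderiv R 2 0 u p + pderiv R 0 2 u p + a * pderiv R 1 0 u p + b * pderiv R 0 1 u p + K * u p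

/-! ### The linear systems for the coefficients of the compact stencils -/

/-- The offsets `-1, 0, 1`. -/
def off (i : Fin 3) : ℤ := (i : ℤ) - 1

/-- Coefficient of `∂ₓᵏ ∂ᵧˡ` in the Taylor expansion with increment `(ξ, η)`. -/
noncomputable def taylorCoeff (k l : ℕ) (ξ η : ℝ) : ℝ :=
  ξ ^ k * η ^ l / ((k.factorial : ℝ) * (l.factorial : ℝ))

/-- The same for the Taylor polynomial of degree two. -/
noncomputable def taylorCoeffTwo (k l : ℕ) (ξ η : ℝ) : ℝ :=
  if k + l ≤ 2 then taylorCoeff k l ξ η else 0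

/-- Coefficient of `∂ₓᵏ ∂ᵧˡ u` in the second order Taylor expansion of
`f = Δu + a uₓ + b uᵧ + K u` with increment `(ξ, η)`, all derivatives of `f` being
expressed through `u` by differentiating the equation. -/
noncomputable def sourceCoeff (a b K : ℝ) (k l : ℕ) (ξ η : ℝ) : ℝ :=
  (if 2 ≤ k then taylorCoeffTwo (k - 2) l ξ η else 0)
    + (if 2 ≤ l then taylorCoeffTwo k (l - 2) ξ η else 0)
    + a * (if 1 ≤ k then taylorCoeffTwo (k - 1) l ξ η else 0)
    + b * (if 1 ≤ l then taylorCoeffTwo k (l - 1) ξ η else 0)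
    + K * taylorCoeffTwo k l ξ η

/-- Coefficient of `∂ₓᵏ ∂ᵧˡ u` in the third order Taylor expansion along the side of
`g = -uₓ + σ u` with tangential increment `η`. -/
noncomputable def fluxCoeff (σ : ℝ) (k l : ℕ) (η : ℝ) : ℝ :=
  if l ≤ 3 then
    if k = 1 then -taylorCoeff 0 l 0 η else if k = 0 then σ * taylorCoeff 0 l 0 η else 0
  else 0

/-- The fifteen derivatives `∂ₓᵏ ∂ᵧˡ u` with `k + l ≤ 4`. -/
def matchIdx : Finset (ℕ × ℕ) :=
  (Finset.range 5 ×ˢ Finset.range 5).filter (fun kl => kl.1 + kl.2 ≤ 4)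

/-- Unknowns at an interior grid point: nine `α`, nine `β`. -/
abbrev InteriorIdx := (Fin 3 × Fin 3) ⊕ (Fin 3 × Fin 3)

/-- Unknowns at a flux boundary grid point: six `α` (first index: `0` or `1` steps inwards),
nine `β` (first index: `-1, 0, 1` steps inwards), three `γ` (along the side). -/
abbrev FluxIdx := (Fin 2 × Fin 3) ⊕ ((Fin 3 × Fin 3) ⊕ Fin 3)

/-- Row `(k, l)` of the interior system: the coefficient of `∂ₓᵏ ∂ᵧˡ u` in the expansion of
`∑ α u - ∑ β f`. -/
noncomputable def interiorRow (a b K h : ℝ) (kl : ℕ × ℕ) : InteriorIdx → ℝ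
  | .inl (i, j) => taylorCoeff kl.1 kl.2 (off i * h) (off j * h)
  | .inr (i, j) => -sourceCoeff a b K kl.1 kl.2 (off i * h) (off j * h)

/-- Row `(k, l)` of the flux system: the coefficient of `∂ₓᵏ ∂ᵧˡ u` in the expansion of
`∑ α u - ∑ β f - ∑ γ g`, where `x` points inwards and `y` runs along the side. -/
noncomputable def fluxRow (a b K σ h : ℝ) (kl : ℕ × ℕ) : FluxIdx → ℝ
  | .inl (i, j) => taylorCoeff kl.1 kl.2 (((i : ℕ) : ℝ) * h) (off j * h)
  | .inr (.inl (i, j)) => -sourceCoeff a b K kl.1 kl.2 (off i * h) (off j * h)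
  | .inr (.inr j) => -fluxCoeff σ kl.1 kl.2 (off j * h)

/-- The row of the normalization `∑ β = 1`, interior case. -/
def interiorNorm : InteriorIdx → ℝ
  | .inl _ => 0
  | .inr _ => 1

/-- The row of the normalization `∑ β = 1`, flux case. -/
def fluxNorm : FluxIdx → ℝ
  | .inl _ => 0
  | .inr (.inl _) => 1
  | .inr (.inr _) => 0

/-- Sum of the squared residuals of the fifteen homogeneous equations with rows `A`. -/
noncomputable def sqResidual {ι : Type} [Fintype ι] (A : ℕ × ℕ → ι → ℝ) (x : ι → ℝ) : ℝ :=
  ∑ kl ∈ matchIdx, (∑ i, A kl i * x i) ^ 2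

/-- `x` is the least-squares solution of smallest Euclidean norm of the equations `A x = 0`
under the normalization `w · x = 1`. Whenever the whole system `A x = 0`, `w · x = 1` is
solvable this is its solution of smallest norm, that is, the pseudo-inverse (SVD) solution. -/
def IsSVDSolution {ι : Type} [Fintype ι] (A : ℕ × ℕ → ι → ℝ) (w : ι → ℝ) (x : ι → ℝ) : Prop :=
  ∑ i, w i * x i = 1 ∧
  (∀ y : ι → ℝ, ∑ i, w i * y i = 1 → sqResidual A x ≤ sqResidual A y) ∧
  (∀ y : ι → ℝ, ∑ i, w i * y i = 1 → sqResidual A y ≤ sqResidual A x →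
    ∑ i, x i ^ 2 ≤ ∑ i, y i ^ 2)

theorem exists_min_sq {κ : Type} [Fintype κ] (s : Set (κ → ℝ)) (hs : IsClosed s)
    (hne : s.Nonempty) : ∃ x ∈ s, ∀ y ∈ s, ∑ i, x i ^ 2 ≤ ∑ i, y i ^ 2 := by
  have hc : IsClosed ((WithLp.ofLp : EuclideanSpace ℝ κ → κ → ℝ) ⁻¹' s) :=
    hs.preimage (PiLp.continuous_ofLp 2 _)
  obtain ⟨x0, hx0⟩ := hne
  obtain ⟨x, hx, hxd⟩ := hc.exists_infDist_eq_dist ⟨WithLp.toLp 2 x0, hx0⟩ 0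
  refine ⟨x.ofLp, hx, fun y hy => ?_⟩
  have h1 : dist 0 x ≤ dist 0 (WithLp.toLp 2 y) :=
    hxd ▸ Metric.infDist_le_dist_of_mem (s := (WithLp.ofLp : EuclideanSpace ℝ κ → κ → ℝ) ⁻¹' s) hy
  rw [dist_zero_left, dist_zero_left] at h1
  have h2 := pow_le_pow_left₀ (norm_nonneg _) h1 2
  simpa [EuclideanSpace.norm_sq_eq] using h2

theorem exists_isSVDSolution {ι : Type} [Fintype ι] (A : ℕ × ℕ → ι → ℝ) (w : ι → ℝ)
    (hw : ∃ x : ι → ℝ, ∑ i, w i * x i = 1) : ∃ x : ι → ℝ, IsSVDSolution A w x := by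
  classical
  have hWc : IsClosed {x : ι → ℝ | ∑ i, w i * x i = 1} :=
    isClosed_eq (by fun_prop) continuous_const
  let T : (ι → ℝ) →ₗ[ℝ] (matchIdx → ℝ) :=
    { toFun := fun x kl => ∑ i, A kl i * x i
      map_add' := by
        intro x y; ext kl; simp [mul_add, Finset.sum_add_distrib]
      map_smul' := by
        intro c x; ext kl; simp [Finset.mul_sum, mul_left_comm] }
  have hT : ∀ x, sqResidual A x = ∑ kl, (T x kl) ^ 2 := by
    intro x
    exact (Finset.sum_coe_sort matchIdx (fun kl => (∑ i, A kl i * x i) ^ 2)).symm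
  obtain ⟨x0, hx0⟩ := hw
  let L : (ι → ℝ) →ₗ[ℝ] ℝ :=
    { toFun := fun x => ∑ i, w i * x i
      map_add' := by intro x y; simp [mul_add, Finset.sum_add_distrib]
      map_smul' := by intro c x; simp [Finset.mul_sum, mul_left_comm] }
  let P : AffineSubspace ℝ (ι → ℝ) := AffineSubspace.mk' x0 (LinearMap.ker L)
  have hP : ∀ x, x ∈ P ↔ ∑ i, w i * x i = 1 := by
    intro x
    rw [AffineSubspace.mem_mk', LinearMap.mem_ker, vsub_eq_sub, map_sub, sub_eq_zero]
    change (∑ i, w i * x i = ∑ i, w i * x0 i) ↔ _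
    rw [hx0]
  have hcl : IsClosed ((P.map T.toAffineMap : AffineSubspace ℝ (matchIdx → ℝ)) : Set (matchIdx → ℝ)) :=
    AffineSubspace.closed_of_finiteDimensional _
  obtain ⟨z, hz, hzmin⟩ := exists_min_sq _ hcl
    ⟨T x0, x0, (hP x0).2 hx0, rfl⟩
  obtain ⟨x1, hx1, rfl⟩ := hz
  have hmin1 : ∀ y : ι → ℝ, ∑ i, w i * y i = 1 → sqResidual A x1 ≤ sqResidual A y := by
    intro y hy
    rw [hT, hT]
    exact hzmin (T y) ⟨y, (hP y).2 hy, rfl⟩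
  have hrc : Continuous (sqResidual A) := by unfold sqResidual; fun_prop
  obtain ⟨x, hx, hxm⟩ := exists_min_sq
    ({x : ι → ℝ | ∑ i, w i * x i = 1} ∩ {x | sqResidual A x ≤ sqResidual A x1})
    (hWc.inter (isClosed_le hrc continuous_const)) ⟨x1, (hP x1).1 hx1, le_refl (sqResidual A x1)⟩
  exact ⟨x, hx.1, fun y hy => hx.2.trans (hmin1 y hy),
    fun y hy hyx => hxm y ⟨hy, hyx.trans hx.2⟩⟩

theorem exists_interiorNorm : ∃ x : InteriorIdx → ℝ, ∑ i, interiorNorm i * x i = 1 := by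
  refine ⟨Pi.single (.inr (0, 0)) 1, ?_⟩
  rw [Finset.sum_eq_single (Sum.inr (0, 0))]
  · simp [interiorNorm]
  · intro b _ hb
    simp [Pi.single_eq_of_ne hb]
  · simp

theorem exists_fluxNorm : ∃ x : FluxIdx → ℝ, ∑ i, fluxNorm i * x i = 1 := by
  refine ⟨Pi.single (.inr (.inl (0, 0))) 1, ?_⟩
  rw [Finset.sum_eq_single (Sum.inr (Sum.inl (0, 0)))]
  · simp [fluxNorm]
  · intro b _ hb
    simp [Pi.single_eq_of_ne hb]
  · simp

/-- The coefficients of the scheme at interior grid points. -/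
noncomputable def interiorStencil (a b K h : ℝ) : InteriorIdx → ℝ :=
  Classical.choose (exists_isSVDSolution (interiorRow a b K h) interiorNorm exists_interiorNorm)

/-- The coefficients of the scheme at flux boundary grid points; `a` is the advection
component along the inner normal and `b` the one along the side. -/
noncomputable def fluxStencil (a b K σ h : ℝ) : FluxIdx → ℝ :=
  Classical.choose (exists_isSVDSolution (fluxRow a b K σ h) fluxNorm exists_fluxNorm)

theorem interiorStencil_spec (a b K h : ℝ) :
    IsSVDSolution (interiorRow a b K h) interiorNorm (interiorStencil a b K h) :=
  Classical.choose_spec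
    (exists_isSVDSolution (interiorRow a b K h) interiorNorm exists_interiorNorm)

theorem fluxStencil_spec (a b K σ h : ℝ) :
    IsSVDSolution (fluxRow a b K σ h) fluxNorm (fluxStencil a b K σ h) :=
  Classical.choose_spec (exists_isSVDSolution (fluxRow a b K σ h) fluxNorm exists_fluxNorm)

/-! ### Sides and grid -/

/-- The four sides of the rectangle. -/
inductive Side
  | left
  | right
  | bottom
  | top

/-- The inner unit normal of a side. -/
def Side.inward : Side → ℤ × ℤ
  | .left => (1, 0)
  | .right => (-1, 0)
  | .bottom => (0, 1)
  | .top => (0, -1)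

/-- The unit tangent of a side. -/
def Side.tangent : Side → ℤ × ℤ
  | .left => (0, 1)
  | .right => (0, 1)
  | .bottom => (1, 0)
  | .top => (1, 0)

/-- The closed side of the rectangle. -/
def Side.segment (xl xr yl yr : ℝ) : Side → Set (ℝ × ℝ)
  | .left => {xl} ×ˢ Icc yl yr
  | .right => {xr} ×ˢ Icc yl yr
  | .bottom => Icc xl xr ×ˢ {yl}
  | .top => Icc xl xr ×ˢ {yr}

/-- The outer normal derivative of `u` on the side `s`. -/
noncomputable def normalDeriv (R : Set (ℝ × ℝ)) (s : Side) (u : ℝ × ℝ → ℝ) (p : ℝ × ℝ) : ℝ :=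
  -((s.inward.1 : ℝ) * pderiv R 1 0 u p + (s.inward.2 : ℝ) * pderiv R 0 1 u p)

/-- The grid point with indices `(i, j)`. -/
noncomputable def node (xl yl h : ℝ) (p : ℤ × ℤ) : ℝ × ℝ := (xl + p.1 * h, yl + p.2 * h)

/-- Indices of all grid points of the closed rectangle. -/
def gridPts (M N : ℕ) : Set (ℤ × ℤ) := Icc 0 (M : ℤ) ×ˢ Icc 0 (N : ℤ)

/-- Indices of the interior grid points. -/
def interiorPts (M N : ℕ) : Set (ℤ × ℤ) := Ioo 0 (M : ℤ) ×ˢ Ioo 0 (N : ℤ)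

/-- Indices of the grid points on a closed side. -/
def Side.pts (M N : ℕ) : Side → Set (ℤ × ℤ)
  | .left => {0} ×ˢ Icc 0 (N : ℤ)
  | .right => {(M : ℤ)} ×ˢ Icc 0 (N : ℤ)
  | .bottom => Icc 0 (M : ℤ) ×ˢ {0}
  | .top => Icc 0 (M : ℤ) ×ˢ {(N : ℤ)}

/-- Indices of the grid points on a side without its two end points. -/
def Side.innerPts (M N : ℕ) : Side → Set (ℤ × ℤ)
  | .left => {0} ×ˢ Ioo 0 (N : ℤ)
  | .right => {(M : ℤ)} ×ˢ Ioo 0 (N : ℤ)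
  | .bottom => Ioo 0 (M : ℤ) ×ˢ {0}
  | .top => Ioo 0 (M : ℤ) ×ˢ {(N : ℤ)}

/-! ### The boundary value problem and the scheme -/

/-- `u` is of class `C⁶` up to the boundary and solves `Δu + a uₓ + b uᵧ + K u = f`, with the
Dirichlet condition `u = u₁` on the sides not in `S` and `∂u/∂n + σ u = g` on those in `S`. -/
structure IsBVPSolution (xl xr yl yr a b K σ : ℝ) (S : Set Side) (f u₁ g u : ℝ × ℝ → ℝ) :
    Prop where
  smooth : ContDiffOn ℝ 6 u (rect xl xr yl yr)
  pde : ∀ p ∈ rect xl xr yl yr, diffAdv a b K (rect xl xr yl yr) u p = f p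
  dirichlet : ∀ s ∉ S, ∀ p ∈ s.segment xl xr yl yr, u p = u₁ p
  flux : ∀ s ∈ S, ∀ p ∈ s.segment xl xr yl yr,
    normalDeriv (rect xl xr yl yr) s u p + σ * u p = g p

/-- `F` holds the source values used by the scheme: those of `f` at the grid points and, on the
grid line just outside each flux side, an extension of third order accuracy, namely one that
differs from the quadratic extrapolation of `f` along the normal by at most `E h³`. -/
structure IsSourceExtension (xl yl h : ℝ) (M N : ℕ) (S : Set Side) (f : ℝ × ℝ → ℝ) (E : ℝ)
    (F : ℤ × ℤ → ℝ) : Prop where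
  nonneg : 0 ≤ E
  grid : ∀ p ∈ gridPts M N, F p = f (node xl yl h p)
  ghost : ∀ s ∈ S, ∀ p ∈ s.pts M N,
    |F (p - s.inward)
      - (3 * F p - 3 * F (p + s.inward) + F (p + (2 : ℤ) • s.inward))| ≤ E * h ^ 3

/-- `∑ α V - ∑ β F` at an interior grid point `p`. -/
noncomputable def interiorDefect (a b K h : ℝ) (F V : ℤ × ℤ → ℝ) (p : ℤ × ℤ) : ℝ :=
  (∑ i : Fin 3, ∑ j : Fin 3,
      interiorStencil a b K h (.inl (i, j)) * V (p + (off i, off j)))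
    - ∑ i : Fin 3, ∑ j : Fin 3,
      interiorStencil a b K h (.inr (i, j)) * F (p + (off i, off j))

/-- The coefficients of the scheme at the flux boundary grid points of the side `s`. -/
noncomputable def sideStencil (a b K σ h : ℝ) (s : Side) : FluxIdx → ℝ :=
  fluxStencil (a * s.inward.1 + b * s.inward.2) (a * s.tangent.1 + b * s.tangent.2) K σ h

/-- `∑ α V - ∑ β F - ∑ γ G` at a flux boundary grid point `p` of the side `s`. -/
noncomputable def fluxDefect (a b K σ h : ℝ) (s : Side) (F G V : ℤ × ℤ → ℝ) (p : ℤ × ℤ) : ℝ :=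
  (∑ i : Fin 2, ∑ j : Fin 3, sideStencil a b K σ h s (.inl (i, j))
      * V (p + ((i : ℕ) : ℤ) • s.inward + off j • s.tangent))
    - (∑ i : Fin 3, ∑ j : Fin 3, sideStencil a b K σ h s (.inr (.inl (i, j)))
      * F (p + off i • s.inward + off j • s.tangent))
    - ∑ j : Fin 3, sideStencil a b K σ h s (.inr (.inr j)) * G (p + off j • s.tangent)

/-- The grid function `U` solves the equations of the scheme, with source values `F`. -/
structure IsHOCSolution (xl yl a b K σ h : ℝ) (M N : ℕ) (S : Set Side) (F : ℤ × ℤ → ℝ)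
    (u₁ g : ℝ × ℝ → ℝ) (U : ℤ × ℤ → ℝ) : Prop where
  interior : ∀ p ∈ interiorPts M N, interiorDefect a b K h F U p = 0
  flux : ∀ s ∈ S, ∀ p ∈ s.innerPts M N,
    fluxDefect a b K σ h s F (fun q => g (node xl yl h q)) U p = 0
  dirichlet : ∀ s ∉ S, ∀ p ∈ s.pts M N, U p = u₁ (node xl yl h p)

/-!
The theorem is consistency plus stability, but the coefficients of the scheme are only given
implicitly, as least-squares solutions of smallest norm, so that their size has to be found first.

*Coefficients.* After scaling by powers of `h` the linear systems depend on `a h`, `b h`, `K h²` and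
`σ h` only, that is, they are `O(h)` perturbations of fixed systems. In terms of the moments
`∑ c ξᵏ ηˡ` of the weights they can be solved by hand. In the interior the system is exactly
solvable for `K ≤ 0` (`exists_interior_solution`), so all fifteen equations hold. At a flux point
it is not solvable in general, but there are coefficients that leave residuals `O(h³)`
(`exists_flux_competitor`), hence so does the least-squares solution. Conversely the equations
determine all moments of `α`, those of `γ`, and those of `β` up to order two, with error `O(h)`
(`interior_moment_bounds`, `flux_moment_bounds`). The minimality of the norm determines the other
moments of `β`, because the solution is orthogonal to the kernel (`moment_of_orthogonal`). The
outcome is collected in `interiorStencilBounds` and `fluxStencilBounds`: `h² α` is `O(h)`-close to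
an explicit stencil, all of whose entries but that of the point itself are positive, `β` and `h γ` are
bounded, and in the interior the odd moments are `O(h)`.

*Consistency.* The equations say that the Taylor polynomials of `u` (degree four), of `f` (degree
two) and of `g` (degree three) cancel. At a flux point the remainders are `O(h³)`, as are the
residuals (`abs_flux_truncation_le`). In the interior the first terms of the remainders involve only
odd moments, which gains one power of `h` (`abs_interior_truncation_le`). The four sides are treated
alike by working with families of functions that behave like the derivatives of `u` in the
coordinates (inner normal, tangent); see `IsJet` and `Side.jet`.

*Stability.* Since the flux sides are contained in a pair of opposite sides, there is a smooth
function `φ ≥ 1` with `Δφ + a φₓ + b φᵧ + K φ ≤ -2` and inner normal derivative at most `-1` on the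
flux sides (`exists_isBarrier`). For small `h` the stencils map it below `-1` in the interior and
below `-1 / h` on the flux sides. As all entries of `α` but that of the point itself are nonnegative,
a discrete maximum principle holds (`abs_le_mul_of_supersolution`): residuals `T` in the interior and
`T / h` on the flux sides produce an error of at most `T φ`. This gives unique solvability, and it
turns the truncation errors `O(h⁴)` and `O(h³)` into the fourth order of the scheme.
-/

/-! ### Jets and Taylor expansion -/

/-- The functions `W k l` behave on `R` like the derivatives `∂_νᵏ ∂_τˡ` of `W 0 0`, as long as
`k + l ≤ n`. Working with such a family makes all four sides of the rectangle alike: only the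
directions `ν` and `τ` change. -/
def IsJet (R : Set (ℝ × ℝ)) (ν τ : ℝ × ℝ) (n : ℕ) (W : ℕ → ℕ → ℝ × ℝ → ℝ) : Prop :=
  ∀ k l, k + l < n → ∀ p ∈ R, ∃ L : ℝ × ℝ →L[ℝ] ℝ,
    HasFDerivWithinAt (W k l) L R p ∧ L ν = W (k + 1) l p ∧ L τ = W k (l + 1) p

/-- The derivative along `ξ ν + η τ`, acting on jets. -/
def jetStep (ξ η : ℝ) (W : ℕ → ℕ → ℝ × ℝ → ℝ) : ℕ → ℕ → ℝ × ℝ → ℝ :=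
  fun k l p => ξ * W (k + 1) l p + η * W k (l + 1) p

/-- Taylor's formula on `[0, 1]` for a chain of functions `V n`, each the derivative of the previous
one. The remainder lacks the factor `1 / m!`, which makes the induction short. -/
theorem abs_taylor_sub_le_of_hasDerivWithinAt (m : ℕ) : ∀ (V : ℕ → ℝ → ℝ) (B : ℝ),
    (∀ n < m, ∀ t ∈ Icc (0 : ℝ) 1, HasDerivWithinAt (V n) (V (n + 1) t) (Icc 0 1) t) →
    (∀ t ∈ Icc (0 : ℝ) 1, |V m t| ≤ B) →
    ∀ t ∈ Icc (0 : ℝ) 1, |V 0 t - ∑ n ∈ Finset.range m, t ^ n / n.factorial * V n 0| ≤ B := by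
  induction m with
  | zero => intro V B _ hB t ht; simpa using hB t ht
  | succ m ih =>
    intro V B hV hB t ht
    have ih' := ih (fun n => V (n + 1)) B (fun n hn => hV (n + 1) (by omega)) hB
    have hB0 : 0 ≤ B := (abs_nonneg _).trans (hB t ht)
    set G : ℝ → ℝ := fun t => V 0 t - ∑ n ∈ Finset.range (m + 1), t ^ n / n.factorial * V n 0
      with hG
    have hd : ∀ s ∈ Icc (0 : ℝ) 1, HasDerivWithinAt G
        (V 1 s - ∑ n ∈ Finset.range m, s ^ n / n.factorial * V (n + 1) 0) (Icc 0 1) s := by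
      intro s hs
      refine (hV 0 (by omega) s hs).sub ?_
      have h1 : (fun t : ℝ => ∑ n ∈ Finset.range (m + 1), t ^ n / n.factorial * V n 0) =
          fun t => ∑ n ∈ Finset.range m, t ^ (n + 1) / (n + 1).factorial * V (n + 1) 0
            + V 0 0 := by
        funext t
        rw [Finset.sum_range_succ']
        simp
      rw [h1]
      refine HasDerivWithinAt.add_const _ ?_
      refine HasDerivWithinAt.fun_sum fun n _ => ?_
      have h2 := ((hasDerivAt_pow (n + 1) s).div_const ((n + 1).factorial : ℝ)).mul_const
        (V (n + 1) 0)
      refine h2.hasDerivWithinAt.congr_deriv ?_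
      rw [Nat.factorial_succ]
      have := n.factorial_pos
      have h3 : (n.factorial : ℝ) ≠ 0 := by positivity
      push_cast
      field_simp
    have hG0 : G 0 = 0 := by
      simp [hG, Finset.sum_range_succ']
    have := (convex_Icc (0 : ℝ) 1).norm_image_sub_le_of_norm_hasDerivWithin_le hd
      (fun s hs => ih' s hs) (left_mem_Icc.2 zero_le_one) ht
    rw [hG0, sub_zero, sub_zero, Real.norm_eq_abs, Real.norm_eq_abs, abs_of_nonneg ht.1] at this
    exact this.trans (mul_le_of_le_one_right hB0 ht.2)

theorem IsJet.mono {R : Set (ℝ × ℝ)} {ν τ : ℝ × ℝ} {n m : ℕ} {W : ℕ → ℕ → ℝ × ℝ → ℝ}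
    (hW : IsJet R ν τ n W) (hmn : m ≤ n) : IsJet R ν τ m W :=
  fun k l hkl => hW k l (by omega)

theorem IsJet.shift {R : Set (ℝ × ℝ)} {ν τ : ℝ × ℝ} {n : ℕ} {W : ℕ → ℕ → ℝ × ℝ → ℝ}
    (hW : IsJet R ν τ n W) (i j m : ℕ) (hm : m + i + j ≤ n) :
    IsJet R ν τ m (fun k l => W (k + i) (l + j)) := by
  intro k l hkl p hp
  obtain ⟨L, h1, h2, h3⟩ := hW (k + i) (l + j) (by omega) p hp
  exact ⟨L, h1, by rw [h2]; congr 1; omega, by rw [h3]; congr 1; omega⟩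

theorem IsJet.add {R : Set (ℝ × ℝ)} {ν τ : ℝ × ℝ} {n : ℕ} {V W : ℕ → ℕ → ℝ × ℝ → ℝ}
    (hV : IsJet R ν τ n V) (hW : IsJet R ν τ n W) :
    IsJet R ν τ n (fun k l p => V k l p + W k l p) := by
  intro k l hkl p hp
  obtain ⟨L, h1, h2, h3⟩ := hV k l hkl p hp
  obtain ⟨L', h1', h2', h3'⟩ := hW k l hkl p hp
  exact ⟨L + L', h1.add h1', by simp [h2, h2'], by simp [h3, h3']⟩

theorem IsJet.const_mul {R : Set (ℝ × ℝ)} {ν τ : ℝ × ℝ} {n : ℕ} {W : ℕ → ℕ → ℝ × ℝ → ℝ}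
    (hW : IsJet R ν τ n W) (c : ℝ) : IsJet R ν τ n (fun k l p => c * W k l p) := by
  intro k l hkl p hp
  obtain ⟨L, h1, h2, h3⟩ := hW k l hkl p hp
  exact ⟨c • L, h1.const_mul c, by simp [h2], by simp [h3]⟩

theorem abs_iterate_jetStep_le {ξ η : ℝ} {D : ℝ} {q : ℝ × ℝ} (m : ℕ) :
    ∀ (W : ℕ → ℕ → ℝ × ℝ → ℝ) (k l : ℕ), (∀ i j, i + j = k + l + m → |W i j q| ≤ D) →
    |(jetStep ξ η)^[m] W k l q| ≤ D * (|ξ| + |η|) ^ m := by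
  induction m with
  | zero => intro W k l h; simpa using h k l rfl
  | succ m ih =>
    intro W k l h
    rw [Function.iterate_succ_apply']
    have h1 := ih W (k + 1) l (fun i j hij => h i j (by omega))
    have h2 := ih W k (l + 1) (fun i j hij => h i j (by omega))
    calc |ξ * (jetStep ξ η)^[m] W (k + 1) l q + η * (jetStep ξ η)^[m] W k (l + 1) q|
        ≤ |ξ| * |(jetStep ξ η)^[m] W (k + 1) l q| + |η| * |(jetStep ξ η)^[m] W k (l + 1) q| := by
          rw [← abs_mul, ← abs_mul]; exact abs_add_le _ _
      _ ≤ |ξ| * (D * (|ξ| + |η|) ^ m) + |η| * (D * (|ξ| + |η|) ^ m) := by gcongr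
      _ = D * (|ξ| + |η|) ^ (m + 1) := by ring

theorem IsJet.step {R : Set (ℝ × ℝ)} {ν τ : ℝ × ℝ} {n : ℕ} {W : ℕ → ℕ → ℝ × ℝ → ℝ}
    (hW : IsJet R ν τ (n + 1) W) (ξ η : ℝ) : IsJet R ν τ n (jetStep ξ η W) :=
  ((hW.shift 1 0 n le_rfl).const_mul ξ).add ((hW.shift 0 1 n (by omega)).const_mul η)

theorem IsJet.iterate_jetStep {R : Set (ℝ × ℝ)} {ν τ : ℝ × ℝ} {m : ℕ} (ξ η : ℝ) (n : ℕ) :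
    ∀ {W : ℕ → ℕ → ℝ × ℝ → ℝ}, IsJet R ν τ (m + n) W →
      IsJet R ν τ m ((jetStep ξ η)^[n] W) := by
  induction n with
  | zero => intro W hW; exact hW
  | succ n ih => intro W hW; exact ih (hW.step ξ η)

/-- Taylor's formula along the segment from `p` to `q = p + ξ ν + η τ`. -/
theorem IsJet.abs_sub_taylor_le {R : Set (ℝ × ℝ)} (hR : Convex ℝ R) {ν τ : ℝ × ℝ}
    {W : ℕ → ℕ → ℝ × ℝ → ℝ} (m : ℕ) (hW : IsJet R ν τ m W) {p q : ℝ × ℝ} (hp : p ∈ R)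
    (hq : q ∈ R) {ξ η : ℝ} (hpq : q = p + (ξ • ν + η • τ)) {D : ℝ}
    (hD : ∀ i j, i + j = m → ∀ z ∈ R, |W i j z| ≤ D) :
    |W 0 0 q - ∑ n ∈ Finset.range m, (jetStep ξ η)^[n] W 0 0 p / n.factorial|
      ≤ D * (|ξ| + |η|) ^ m := by
  set γ : ℝ → ℝ × ℝ := fun t => p + t • (ξ • ν + η • τ) with hγ
  have hγR : MapsTo γ (Icc 0 1) R := by
    intro t ht
    have := hR.add_smul_sub_mem hp hq ht
    rwa [hpq, add_sub_cancel_left] at this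
  have hV : ∀ n < m, ∀ t ∈ Icc (0 : ℝ) 1,
      HasDerivWithinAt (fun t => (jetStep ξ η)^[n] W 0 0 (γ t))
        ((jetStep ξ η)^[n + 1] W 0 0 (γ t)) (Icc 0 1) t := by
    intro n hn t ht
    have hJ : IsJet R ν τ 1 ((jetStep ξ η)^[n] W) :=
      IsJet.iterate_jetStep ξ η n (hW.mono (by omega))
    obtain ⟨L, h1, h2, h3⟩ := hJ 0 0 (by omega) (γ t) (hγR ht)
    have hd : HasDerivWithinAt γ (ξ • ν + η • τ) (Icc 0 1) t := by
      have := ((hasDerivAt_id t).smul_const (ξ • ν + η • τ)).const_add p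
      simpa [hγ] using this.hasDerivWithinAt
    refine (h1.comp_hasDerivWithinAt t hd hγR).congr_deriv ?_
    rw [Function.iterate_succ_apply']
    simp [jetStep, h2, h3]
  have h := abs_taylor_sub_le_of_hasDerivWithinAt m
    (fun n t => (jetStep ξ η)^[n] W 0 0 (γ t)) (D * (|ξ| + |η|) ^ m) hV
    (fun t ht => abs_iterate_jetStep_le m W 0 0
      fun i j hij => hD i j (by omega) _ (hγR ht)) 1 (right_mem_Icc.2 zero_le_one)
  have e1 : γ 1 = q := by simp [hγ, hpq]
  have e0 : γ 0 = p := by simp [hγ]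
  simp only [e1, e0, one_pow, Function.iterate_zero, id] at h
  convert h using 4
  · ring

/-! ### The jet of a solution -/

theorem convex_rect (xl xr yl yr : ℝ) : Convex ℝ (rect xl xr yl yr) :=
  (convex_Icc _ _).prod (convex_Icc _ _)

theorem uniqueDiffOn_rect {xl xr yl yr : ℝ} (hx : xl < xr) (hy : yl < yr) :
    UniqueDiffOn ℝ (rect xl xr yl yr) :=
  (uniqueDiffOn_Icc hx).prod (uniqueDiffOn_Icc hy)

theorem rect_subset_closure_interior {xl xr yl yr : ℝ} (hx : xl < xr) (hy : yl < yr) :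
    rect xl xr yl yr ⊆ closure (interior (rect xl xr yl yr)) := by
  rw [rect, interior_prod_eq, closure_prod_eq, closure_interior_Icc hx.ne,
    closure_interior_Icc hy.ne]

theorem pderiv_zero_zero (R : Set (ℝ × ℝ)) (u : ℝ × ℝ → ℝ) (p : ℝ × ℝ) :
    pderiv R 0 0 u p = u p := by
  simp [pderiv]

theorem fderivWithin_iteratedFDerivWithin_apply {R : Set (ℝ × ℝ)} (hR : UniqueDiffOn ℝ R)
    {N : ℕ} {u : ℝ × ℝ → ℝ} (hu : ContDiffOn ℝ N u R) {n : ℕ} (hn : n < N) {p : ℝ × ℝ}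
    (hp : p ∈ R) (v : ℝ × ℝ) (m : Fin n → ℝ × ℝ) :
    fderivWithin ℝ (fun q => iteratedFDerivWithin ℝ n u R q m) R p v =
      iteratedFDerivWithin ℝ (n + 1) u R p (Fin.cons v m) := by
  have hd : DifferentiableWithinAt ℝ (iteratedFDerivWithin ℝ n u R) R p :=
    hu.differentiableOn_iteratedFDerivWithin (by exact_mod_cast hn) hR p hp
  have := (hd.hasFDerivWithinAt.continuousMultilinear_apply_const m).fderivWithin (hR p hp)
  rw [this, iteratedFDerivWithin_succ_apply_left]
  simp [Fin.tail_def]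

theorem iteratedFDerivWithin_congr_card {R : Set (ℝ × ℝ)} {u : ℝ × ℝ → ℝ} {n n' : ℕ}
    (h : n = n') (p : ℝ × ℝ) (m : ℕ → ℝ × ℝ) :
    iteratedFDerivWithin ℝ n u R p (fun i => m i) =
      iteratedFDerivWithin ℝ n' u R p (fun i => m i) := by
  subst h; rfl

theorem fderivWithin_pderiv_fst {R : Set (ℝ × ℝ)} (hR : UniqueDiffOn ℝ R) {N : ℕ}
    {u : ℝ × ℝ → ℝ} (hu : ContDiffOn ℝ N u R) {k l : ℕ} (hkl : k + l < N) {p : ℝ × ℝ}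
    (hp : p ∈ R) : fderivWithin ℝ (pderiv R k l u) R p (1, 0) = pderiv R (k + 1) l u p := by
  have h := fderivWithin_iteratedFDerivWithin_apply hR hu hkl hp (1, 0)
    (fun i => if (i : ℕ) < k then ((1 : ℝ), (0 : ℝ)) else (0, 1))
  refine h.trans ?_
  rw [pderiv, iteratedFDerivWithin_congr_card (show k + 1 + l = k + l + 1 by omega) p
    (fun i => if i < k + 1 then ((1 : ℝ), (0 : ℝ)) else (0, 1))]
  congr 1
  funext i
  refine Fin.cases ?_ (fun i => ?_) i
  · simp
  · simp

theorem fderivWithin_pderiv_zero_snd {R : Set (ℝ × ℝ)} (hR : UniqueDiffOn ℝ R) {N : ℕ}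
    {u : ℝ × ℝ → ℝ} (hu : ContDiffOn ℝ N u R) {l : ℕ} (hl : l < N) {p : ℝ × ℝ}
    (hp : p ∈ R) : fderivWithin ℝ (pderiv R 0 l u) R p (0, 1) = pderiv R 0 (l + 1) u p := by
  have h := fderivWithin_iteratedFDerivWithin_apply hR hu
    (show 0 + l < N by omega) hp (0, 1)
    (fun i => if (i : ℕ) < 0 then ((1 : ℝ), (0 : ℝ)) else (0, 1))
  refine h.trans ?_
  rw [pderiv]
  congr 1
  funext i
  refine Fin.cases ?_ (fun i => ?_) i
  · simp
  · simp

theorem contDiffOn_pderiv {R : Set (ℝ × ℝ)} (hR : UniqueDiffOn ℝ R) {N : ℕ}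
    {u : ℝ × ℝ → ℝ} (hu : ContDiffOn ℝ N u R) (k : ℕ) :
    ∀ l m : ℕ, m + k + l ≤ N → ContDiffOn ℝ m (pderiv R k l u) R := by
  induction k with
  | zero =>
    intro l
    induction l with
    | zero =>
      intro m hm
      exact (hu.of_le (by exact_mod_cast (show m ≤ N by omega))).congr
        fun p _ => pderiv_zero_zero R u p
    | succ l ih =>
      intro m hm
      have h := (ih (m + 1) (by omega)).fderivWithin hR (m := m) (by norm_cast)
      exact (h.clm_apply contDiffOn_const).congr
        fun p hp => (fderivWithin_pderiv_zero_snd hR hu (by omega) hp).symm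
  | succ k ih =>
    intro l m hm
    have h := (ih l (m + 1) (by omega)).fderivWithin hR (m := m) (by norm_cast)
    exact (h.clm_apply contDiffOn_const).congr
      fun p hp => (fderivWithin_pderiv_fst hR hu (by omega) hp).symm

/-- The partial derivative in the second variable also acts on `pderiv` as expected, although
`pderiv` applies the derivatives in a fixed order: this is the symmetry of second derivatives. -/
theorem fderivWithin_pderiv_snd {R : Set (ℝ × ℝ)} (hR : UniqueDiffOn ℝ R)
    (hR' : R ⊆ closure (interior R)) {N : ℕ} {u : ℝ × ℝ → ℝ} (hu : ContDiffOn ℝ N u R) (k : ℕ) :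
    ∀ l : ℕ, k + l < N → ∀ p ∈ R,
      fderivWithin ℝ (pderiv R k l u) R p (0, 1) = pderiv R k (l + 1) u p := by
  induction k with
  | zero => intro l hl p hp; exact fderivWithin_pderiv_zero_snd hR hu (by omega) hp
  | succ k ih =>
    intro l hl p hp
    have hc : ContDiffOn ℝ 2 (pderiv R k l u) R := contDiffOn_pderiv hR hu k l 2 (by omega)
    have hsymm := (hc p hp).isSymmSndFDerivWithinAt (by simp) hR (hR' hp) hp
    have hd : DifferentiableWithinAt ℝ (fderivWithin ℝ (pderiv R k l u) R) R p :=
      (hc.fderivWithin hR (m := 1) (by norm_num)).differentiableOn (by simp) p hp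
    have key : ∀ v w : ℝ × ℝ, ∀ G : ℝ × ℝ → ℝ,
        (∀ q ∈ R, fderivWithin ℝ (pderiv R k l u) R q v = G q) →
        fderivWithin ℝ G R p w = fderivWithin ℝ (fderivWithin ℝ (pderiv R k l u) R) R p w v := by
      intro v w G hG
      rw [← fderivWithin_congr hG (hG p hp)]
      have := (hd.hasFDerivWithinAt.clm_apply (hasFDerivWithinAt_const v p R)).fderivWithin
        (hR p hp)
      rw [this]; simp
    rw [key (1, 0) (0, 1) _ (fun q hq => fderivWithin_pderiv_fst hR hu (by omega) hq),
      hsymm (0, 1) (1, 0),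
      ← key (0, 1) (1, 0) _ (fun q hq => ih l (by omega) q hq),
      fderivWithin_pderiv_fst hR hu (by omega) hp]

theorem isJet_pderiv {R : Set (ℝ × ℝ)} (hR : UniqueDiffOn ℝ R)
    (hR' : R ⊆ closure (interior R)) {N : ℕ} {u : ℝ × ℝ → ℝ} (hu : ContDiffOn ℝ N u R) :
    IsJet R (1, 0) (0, 1) N (fun k l => pderiv R k l u) := by
  intro k l hkl p hp
  refine ⟨fderivWithin ℝ (pderiv R k l u) R p, ?_, fderivWithin_pderiv_fst hR hu hkl hp,
    fderivWithin_pderiv_snd hR hR' hu k l hkl p hp⟩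
  exact ((contDiffOn_pderiv hR hu k l 1 (by omega)).differentiableOn (by simp) p
    hp).hasFDerivWithinAt

/-! ### Least-squares solutions of smallest norm -/

theorem IsSVDSolution.sq_row_le {ι : Type} [Fintype ι] {A : ℕ × ℕ → ι → ℝ} {w x : ι → ℝ}
    (hx : IsSVDSolution A w x) {y : ι → ℝ} (hy : ∑ i, w i * y i = 1) {kl : ℕ × ℕ}
    (hkl : kl ∈ matchIdx) : (∑ i, A kl i * x i) ^ 2 ≤ sqResidual A y :=
  (Finset.single_le_sum (f := fun kl => (∑ i, A kl i * x i) ^ 2)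
    (fun _ _ => sq_nonneg _) hkl).trans (hx.2.1 y hy)

/-- A least-squares solution of smallest norm is orthogonal to the kernel of the equations. -/
theorem IsSVDSolution.sum_mul_eq_zero {ι : Type} [Fintype ι] {A : ℕ × ℕ → ι → ℝ} {w x : ι → ℝ}
    (hx : IsSVDSolution A w x) {z : ι → ℝ} (hw : ∑ i, w i * z i = 0)
    (hz : ∀ kl ∈ matchIdx, ∑ i, A kl i * z i = 0) : ∑ i, x i * z i = 0 := by
  have key : ∀ t : ℝ, 0 ≤ 2 * t * ∑ i, x i * z i + t ^ 2 * ∑ i, z i ^ 2 := by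
    intro t
    have lin : ∀ c : ι → ℝ, ∑ i, c i * (x i + t * z i) = ∑ i, c i * x i + t * ∑ i, c i * z i := by
      intro c
      rw [Finset.mul_sum, ← Finset.sum_add_distrib]
      exact Finset.sum_congr rfl fun i _ => by ring
    have h := hx.2.2 (fun i => x i + t * z i) (by rw [lin, hw, hx.1]; ring)
      (le_of_eq (Finset.sum_congr rfl fun kl hkl => by rw [lin, hz kl hkl]; ring))
    have e : ∑ i, (x i + t * z i) ^ 2 =
        ∑ i, x i ^ 2 + (2 * t * ∑ i, x i * z i + t ^ 2 * ∑ i, z i ^ 2) := by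
      rw [Finset.mul_sum, Finset.mul_sum, ← Finset.sum_add_distrib, ← Finset.sum_add_distrib]
      exact Finset.sum_congr rfl fun i _ => by ring
    linarith
  -- a quadratic in `t` that vanishes at `0` and is nonnegative has no linear part; the
  -- denominator `Q + 1` covers the case `Q = 0`
  set P := ∑ i, x i * z i
  set Q := ∑ i, z i ^ 2
  have hQ : 0 ≤ Q := Finset.sum_nonneg fun i _ => sq_nonneg _
  have h := key (-P / (Q + 1))
  have e : 2 * (-P / (Q + 1)) * P + (-P / (Q + 1)) ^ 2 * Q = -(P ^ 2 * (Q + 2)) / (Q + 1) ^ 2 := by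
    field_simp; ring
  rw [e, le_div_iff₀ (by positivity)] at h
  have : P ^ 2 = 0 := by nlinarith [sq_nonneg P, mul_nonneg (sq_nonneg P) hQ]
  exact pow_eq_zero_iff (two_ne_zero) |>.1 this

/-! ### Moments of coefficient arrays -/

/-- The moment `∑ c ξᵏ ηˡ` of an array of weights `c` on a product grid. -/
def moment {m n : ℕ} (ξ : Fin m → ℝ) (η : Fin n → ℝ) (c : Fin m → Fin n → ℝ) (k l : ℕ) : ℝ :=
  ∑ i, ∑ j, c i j * (ξ i ^ k * η j ^ l)

/-- The positions `-1, 0, 1`. -/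
def pos₃ (i : Fin 3) : ℝ := off i

/-- The positions `0, 1`. -/
def pos₂ (i : Fin 2) : ℝ := (i : ℕ)

@[simp] theorem pos₃_zero : pos₃ 0 = -1 := by simp [pos₃, off]
@[simp] theorem pos₃_one : pos₃ 1 = 0 := by simp [pos₃, off]
@[simp] theorem pos₃_two : pos₃ 2 = 1 := by simp [pos₃, off]
@[simp] theorem pos₂_zero : pos₂ 0 = 0 := by simp [pos₂]
@[simp] theorem pos₂_one : pos₂ 1 = 1 := by simp [pos₂]

/-- Row `i` holds the coefficients of the Lagrange polynomial of the position `pos₃ i`. -/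
noncomputable def lagrange₃ : Fin 3 → Fin 3 → ℝ :=
  ![![0, -1 / 2, 1 / 2], ![1, 0, -1], ![0, 1 / 2, 1 / 2]]

/-- Row `i` holds the coefficients of the Lagrange polynomial of the position `pos₂ i`. -/
noncomputable def lagrange₂ : Fin 2 → Fin 2 → ℝ := ![![1, -1], ![0, 1]]

theorem abs_lagrange₃_le (i j : Fin 3) : |lagrange₃ i j| ≤ 1 := by
  fin_cases i <;> fin_cases j <;> norm_num [lagrange₃, abs_le]

theorem abs_lagrange₂_le (i j : Fin 2) : |lagrange₂ i j| ≤ 1 := by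
  fin_cases i <;> fin_cases j <;> norm_num [lagrange₂, abs_le]

theorem sum_lagrange₃_mul (i i' : Fin 3) :
    ∑ k : Fin 3, lagrange₃ i k * pos₃ i' ^ (k : ℕ) = if i' = i then 1 else 0 := by
  fin_cases i <;> fin_cases i' <;>
    simp [lagrange₃, Fin.sum_univ_three, Matrix.cons_val] <;> norm_num

theorem sum_lagrange₂_mul (i i' : Fin 2) :
    ∑ k : Fin 2, lagrange₂ i k * pos₂ i' ^ (k : ℕ) = if i' = i then 1 else 0 := by
  fin_cases i <;> fin_cases i' <;> norm_num [lagrange₂, Fin.sum_univ_two]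

theorem sum_pos₃_mul_lagrange₃ (k k' : Fin 3) :
    ∑ i, pos₃ i ^ (k : ℕ) * lagrange₃ i k' = if k' = k then 1 else 0 := by
  fin_cases k <;> fin_cases k' <;>
    simp [lagrange₃, Fin.sum_univ_three, Matrix.cons_val] <;> norm_num

theorem sum_pos₂_mul_lagrange₂ (k k' : Fin 2) :
    ∑ i, pos₂ i ^ (k : ℕ) * lagrange₂ i k' = if k' = k then 1 else 0 := by
  fin_cases k <;> fin_cases k' <;> norm_num [lagrange₂, Fin.sum_univ_two]

/-- The array with prescribed moments, by Lagrange interpolation with the coefficients `P`, `Q`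
in the two directions. -/
def ofMoments {m n : ℕ} (P : Fin m → Fin m → ℝ) (Q : Fin n → Fin n → ℝ) (μ : ℕ → ℕ → ℝ)
    (i : Fin m) (j : Fin n) : ℝ :=
  ∑ k : Fin m, ∑ l : Fin n, P i k * Q j l * μ k l

theorem ofMoments_moment {m n : ℕ} {ξ : Fin m → ℝ} {η : Fin n → ℝ} {P : Fin m → Fin m → ℝ}
    {Q : Fin n → Fin n → ℝ}
    (hP : ∀ i i', ∑ k : Fin m, P i k * ξ i' ^ (k : ℕ) = if i' = i then 1 else 0)
    (hQ : ∀ j j', ∑ l : Fin n, Q j l * η j' ^ (l : ℕ) = if j' = j then 1 else 0)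
    (c : Fin m → Fin n → ℝ) : ofMoments P Q (moment ξ η c) = c := by
  funext i j
  calc ofMoments P Q (moment ξ η c) i j
      = ∑ k : Fin m, ∑ l : Fin n, ∑ i', ∑ j',
          c i' j' * ((P i k * ξ i' ^ (k : ℕ)) * (Q j l * η j' ^ (l : ℕ))) := by
        simp only [ofMoments, moment, Finset.mul_sum]
        refine Finset.sum_congr rfl fun k _ => Finset.sum_congr rfl fun l _ =>
          Finset.sum_congr rfl fun i' _ => Finset.sum_congr rfl fun j' _ => by ring
    _ = ∑ i', ∑ j', c i' j' * ((∑ k : Fin m, P i k * ξ i' ^ (k : ℕ))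
          * ∑ l : Fin n, Q j l * η j' ^ (l : ℕ)) := by
        rw [Finset.sum_congr rfl fun k _ => Finset.sum_comm, Finset.sum_comm]
        refine Finset.sum_congr rfl fun i' _ => ?_
        rw [Finset.sum_congr rfl fun k _ => Finset.sum_comm, Finset.sum_comm]
        refine Finset.sum_congr rfl fun j' _ => ?_
        rw [Finset.sum_mul_sum]
        simp only [Finset.mul_sum]
    _ = c i j := by simp [hP, hQ]

theorem moment_ofMoments {m n : ℕ} {ξ : Fin m → ℝ} {η : Fin n → ℝ} {P : Fin m → Fin m → ℝ}
    {Q : Fin n → Fin n → ℝ}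
    (hP : ∀ k k' : Fin m, ∑ i, ξ i ^ (k : ℕ) * P i k' = if k' = k then 1 else 0)
    (hQ : ∀ l l' : Fin n, ∑ j, η j ^ (l : ℕ) * Q j l' = if l' = l then 1 else 0)
    (μ : ℕ → ℕ → ℝ) (k : Fin m) (l : Fin n) : moment ξ η (ofMoments P Q μ) k l = μ k l := by
  calc moment ξ η (ofMoments P Q μ) k l
      = ∑ i, ∑ j, ∑ k' : Fin m, ∑ l' : Fin n,
          μ k' l' * ((ξ i ^ (k : ℕ) * P i k') * (η j ^ (l : ℕ) * Q j l')) := by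
        simp only [ofMoments, moment, Finset.sum_mul]
        refine Finset.sum_congr rfl fun k _ => Finset.sum_congr rfl fun l _ =>
          Finset.sum_congr rfl fun i' _ => Finset.sum_congr rfl fun j' _ => by ring
    _ = ∑ k' : Fin m, ∑ l' : Fin n, μ k' l' * ((∑ i, ξ i ^ (k : ℕ) * P i k')
          * ∑ j, η j ^ (l : ℕ) * Q j l') := by
        rw [Finset.sum_congr rfl fun k _ => Finset.sum_comm, Finset.sum_comm]
        refine Finset.sum_congr rfl fun i' _ => ?_
        rw [Finset.sum_congr rfl fun k _ => Finset.sum_comm, Finset.sum_comm]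
        refine Finset.sum_congr rfl fun j' _ => ?_
        rw [Finset.sum_mul_sum]
        simp only [Finset.mul_sum]
    _ = μ k l := by simp [hP, hQ]

theorem abs_ofMoments_sub_le {m n : ℕ} {P : Fin m → Fin m → ℝ} {Q : Fin n → Fin n → ℝ}
    (hP : ∀ i k, |P i k| ≤ 1) (hQ : ∀ i k, |Q i k| ≤ 1) {μ ν : ℕ → ℕ → ℝ} {ε : ℝ}
    (h : ∀ (k : Fin m) (l : Fin n), |μ k l - ν k l| ≤ ε) (i : Fin m) (j : Fin n) :
    |ofMoments P Q μ i j - ofMoments P Q ν i j| ≤ m * n * ε := by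
  have e : ofMoments P Q μ i j - ofMoments P Q ν i j =
      ∑ k : Fin m, ∑ l : Fin n, P i k * Q j l * (μ k l - ν k l) := by
    simp only [ofMoments, ← Finset.sum_sub_distrib, mul_sub]
  rw [e]
  refine (Finset.abs_sum_le_sum_abs _ _).trans ?_
  refine (Finset.sum_le_sum fun k _ => (Finset.abs_sum_le_sum_abs _ _).trans
    (Finset.sum_le_sum (g := fun _ => ε) fun l _ => ?_)).trans ?_
  · rw [abs_mul, abs_mul]
    have h1 : |P i k| * |Q j l| ≤ 1 := mul_le_one₀ (hP i k) (abs_nonneg _) (hQ j l)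
    calc |P i k| * |Q j l| * |μ k l - ν k l| ≤ 1 * |μ k l - ν k l| := by gcongr
      _ ≤ ε := by rw [one_mul]; exact h k l
  · simp; ring_nf; rfl

/-- On the positions `-1, 0, 1` the powers `ξ³` and `ξ` agree. -/
theorem moment_fst_reduce {n : ℕ} (η : Fin n → ℝ) (c : Fin 3 → Fin n → ℝ) (k l : ℕ) :
    moment pos₃ η c (k + 3) l = moment pos₃ η c (k + 1) l := by
  have : ∀ i, pos₃ i ^ (k + 3) = pos₃ i ^ (k + 1) := by
    intro i; fin_cases i <;> simp [pow_succ]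
  simp only [moment, this]

theorem moment_snd_reduce {m : ℕ} (ξ : Fin m → ℝ) (c : Fin m → Fin 3 → ℝ) (k l : ℕ) :
    moment ξ pos₃ c k (l + 3) = moment ξ pos₃ c k (l + 1) := by
  have : ∀ i, pos₃ i ^ (l + 3) = pos₃ i ^ (l + 1) := by
    intro i; fin_cases i <;> simp [pow_succ]
  simp only [moment, this]

theorem moment_fst_reduce₂ {n : ℕ} (η : Fin n → ℝ) (c : Fin 2 → Fin n → ℝ) (k l : ℕ) :
    moment pos₂ η c (k + 2) l = moment pos₂ η c (k + 1) l := by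
  have : ∀ i, pos₂ i ^ (k + 2) = pos₂ i ^ (k + 1) := by
    intro i; fin_cases i <;> simp [pow_succ]
  simp only [moment, this]

/-! ### Rows in terms of moments -/

/-- The moment counterpart of `taylorCoeffTwo`. -/
noncomputable def taylorMomentTwo (μ : ℕ → ℕ → ℝ) (k l : ℕ) : ℝ :=
  if k + l ≤ 2 then μ k l / (k.factorial * l.factorial) else 0

/-- The moment counterpart of `sourceCoeff`. -/
noncomputable def sourceMoment (a b K : ℝ) (μ : ℕ → ℕ → ℝ) (k l : ℕ) : ℝ :=
  (if 2 ≤ k then taylorMomentTwo μ (k - 2) l else 0)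
    + (if 2 ≤ l then taylorMomentTwo μ k (l - 2) else 0)
    + a * (if 1 ≤ k then taylorMomentTwo μ (k - 1) l else 0)
    + b * (if 1 ≤ l then taylorMomentTwo μ k (l - 1) else 0)
    + K * taylorMomentTwo μ k l

/-- The moment counterpart of `fluxCoeff`. -/
noncomputable def fluxMoment (σ : ℝ) (μ : ℕ → ℝ) (k l : ℕ) : ℝ :=
  if l ≤ 3 then
    if k = 1 then -(μ l / l.factorial) else if k = 0 then σ * (μ l / l.factorial) else 0
  else 0

/-- The moments of weights along a line. -/
def moment₁ {n : ℕ} (η : Fin n → ℝ) (c : Fin n → ℝ) (l : ℕ) : ℝ := ∑ j, c j * η j ^ l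

theorem sum_taylorCoeff {m n : ℕ} (ξ : Fin m → ℝ) (η : Fin n → ℝ) (c : Fin m → Fin n → ℝ)
    (k l : ℕ) : ∑ i, ∑ j, taylorCoeff k l (ξ i) (η j) * c i j =
      moment ξ η c k l / (k.factorial * l.factorial) := by
  simp only [moment, taylorCoeff, Finset.sum_div]
  exact Finset.sum_congr rfl fun i _ => Finset.sum_congr rfl fun j _ => by ring

theorem sum_taylorCoeffTwo {m n : ℕ} (ξ : Fin m → ℝ) (η : Fin n → ℝ) (c : Fin m → Fin n → ℝ)
    (k l : ℕ) : ∑ i, ∑ j, taylorCoeffTwo k l (ξ i) (η j) * c i j =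
      taylorMomentTwo (moment ξ η c) k l := by
  unfold taylorCoeffTwo taylorMomentTwo
  split_ifs
  · exact sum_taylorCoeff ξ η c k l
  · simp

theorem sum_sourceCoeff {m n : ℕ} (a b K : ℝ) (ξ : Fin m → ℝ) (η : Fin n → ℝ)
    (c : Fin m → Fin n → ℝ) (k l : ℕ) :
    ∑ i, ∑ j, sourceCoeff a b K k l (ξ i) (η j) * c i j =
      sourceMoment a b K (moment ξ η c) k l := by
  have ite_sum : ∀ (P : Prop) [Decidable P] (k l : ℕ),
      ∑ i, ∑ j, (if P then taylorCoeffTwo k l (ξ i) (η j) else 0) * c i j =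
        if P then taylorMomentTwo (moment ξ η c) k l else 0 := by
    intro P _ k l
    split_ifs
    · exact sum_taylorCoeffTwo ξ η c k l
    · simp
  simp only [sourceCoeff, sourceMoment, add_mul, Finset.sum_add_distrib, mul_assoc,
    ← Finset.mul_sum, ite_sum, sum_taylorCoeffTwo]

theorem sum_fluxCoeff {n : ℕ} (σ : ℝ) (η : Fin n → ℝ) (c : Fin n → ℝ) (k l : ℕ) :
    ∑ j, fluxCoeff σ k l (η j) * c j = fluxMoment σ (moment₁ η c) k l := by
  unfold fluxCoeff fluxMoment moment₁ taylorCoeff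
  split_ifs <;> simp [Finset.sum_div, Finset.mul_sum] <;>
    exact Finset.sum_congr rfl fun j _ => by ring

theorem sum_interiorRow (a b K : ℝ) (k l : ℕ) (α β : Fin 3 → Fin 3 → ℝ) :
    ∑ i, interiorRow a b K 1 (k, l) i * Sum.elim (Function.uncurry α) (Function.uncurry β) i =
      moment pos₃ pos₃ α k l / (k.factorial * l.factorial)
        - sourceMoment a b K (moment pos₃ pos₃ β) k l := by
  rw [← sum_taylorCoeff, ← sum_sourceCoeff]
  simp [Fintype.sum_sum_type, Fintype.sum_prod_type, interiorRow, pos₃, sub_eq_add_neg]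

theorem sum_fluxRow (a b K σ : ℝ) (k l : ℕ) (α : Fin 2 → Fin 3 → ℝ) (β : Fin 3 → Fin 3 → ℝ)
    (γ : Fin 3 → ℝ) :
    ∑ i, fluxRow a b K σ 1 (k, l) i
        * Sum.elim (Function.uncurry α) (Sum.elim (Function.uncurry β) γ) i =
      moment pos₂ pos₃ α k l / (k.factorial * l.factorial)
        - sourceMoment a b K (moment pos₃ pos₃ β) k l - fluxMoment σ (moment₁ pos₃ γ) k l := by
  rw [← sum_taylorCoeff, ← sum_sourceCoeff, ← sum_fluxCoeff]
  simp [Fintype.sum_sum_type, Fintype.sum_prod_type, fluxRow, pos₃, pos₂, sub_eq_add_neg,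
    add_assoc]

/-! ### Scaling to step size one -/

theorem taylorCoeff_scale (k l : ℕ) (ξ η h : ℝ) :
    taylorCoeff k l (ξ * h) (η * h) = h ^ (k + l) * taylorCoeff k l ξ η := by
  simp only [taylorCoeff, mul_pow, pow_add]; ring

theorem taylorCoeffTwo_scale (k l : ℕ) (ξ η h : ℝ) :
    taylorCoeffTwo k l (ξ * h) (η * h) = h ^ (k + l) * taylorCoeffTwo k l ξ η := by
  unfold taylorCoeffTwo
  split_ifs
  · exact taylorCoeff_scale k l ξ η h
  · simp

theorem sourceCoeff_scale (a b K : ℝ) (k l : ℕ) (ξ η h : ℝ) :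
    h ^ 2 * sourceCoeff a b K k l (ξ * h) (η * h) =
      h ^ (k + l) * sourceCoeff (a * h) (b * h) (K * h ^ 2) k l ξ η := by
  have e1 : ∀ j k l : ℕ, h ^ j * (if j ≤ k then taylorCoeffTwo (k - j) l (ξ * h) (η * h) else 0) =
      h ^ (k + l) * (if j ≤ k then taylorCoeffTwo (k - j) l ξ η else 0) := by
    intro j k l
    split_ifs with hj
    · rw [taylorCoeffTwo_scale, ← mul_assoc, ← pow_add]
      congr 2; omega
    · simp
  have e2 : ∀ j k l : ℕ, h ^ j * (if j ≤ l then taylorCoeffTwo k (l - j) (ξ * h) (η * h) else 0) =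
      h ^ (k + l) * (if j ≤ l then taylorCoeffTwo k (l - j) ξ η else 0) := by
    intro j k l
    split_ifs with hj
    · rw [taylorCoeffTwo_scale, ← mul_assoc, ← pow_add]
      congr 2; omega
    · simp
  have h1 := e1 1 k l
  have h2 := e2 1 k l
  rw [pow_one] at h1 h2
  simp only [sourceCoeff]
  linear_combination e1 2 k l + e2 2 k l + a * h * h1 + b * h * h2
    + K * h ^ 2 * taylorCoeffTwo_scale k l ξ η h

theorem fluxCoeff_scale (σ : ℝ) (k l : ℕ) (η h : ℝ) :
    h * fluxCoeff σ k l (η * h) = h ^ (k + l) * fluxCoeff (σ * h) k l η := by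
  have e : taylorCoeff 0 l 0 (η * h) = h ^ l * taylorCoeff 0 l 0 η := by
    simpa using taylorCoeff_scale 0 l 0 η h
  unfold fluxCoeff
  split_ifs with h1 h2 h3
  · rw [e, h2]; ring
  · rw [e, h3]; ring
  · simp
  · simp

/-- The powers of `h` by which the unknowns of the interior system are scaled. -/
def interiorScale (h : ℝ) : InteriorIdx → ℝ
  | .inl _ => h ^ 2
  | .inr _ => 1

/-- The powers of `h` by which the unknowns of the flux system are scaled. -/
def fluxScale (h : ℝ) : FluxIdx → ℝ
  | .inl _ => h ^ 2
  | .inr (.inl _) => 1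
  | .inr (.inr _) => h

theorem interiorRow_scale (a b K h : ℝ) (kl : ℕ × ℕ) (i : InteriorIdx) :
    h ^ 2 * interiorRow a b K h kl i = h ^ (kl.1 + kl.2)
      * (interiorRow (a * h) (b * h) (K * h ^ 2) 1 kl i * interiorScale h i) := by
  rcases i with ⟨i, j⟩ | ⟨i, j⟩
  · simp only [interiorRow, interiorScale, taylorCoeff_scale]; ring
  · simp only [interiorRow, interiorScale, mul_neg, sourceCoeff_scale, mul_one]

theorem fluxRow_scale (a b K σ h : ℝ) (kl : ℕ × ℕ) (i : FluxIdx) :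
    h ^ 2 * fluxRow a b K σ h kl i = h ^ (kl.1 + kl.2)
      * (fluxRow (a * h) (b * h) (K * h ^ 2) (σ * h) 1 kl i * fluxScale h i) := by
  rcases i with ⟨i, j⟩ | ⟨i, j⟩ | j
  · simp only [fluxRow, fluxScale, taylorCoeff_scale]; ring
  · simp only [fluxRow, fluxScale, mul_neg, sourceCoeff_scale, mul_one]
  · simp only [fluxRow, fluxScale, mul_neg, mul_one]
    linear_combination -h * fluxCoeff_scale σ kl.1 kl.2 (off j) h

theorem sum_interiorRow_scale (a b K h : ℝ) (kl : ℕ × ℕ) (x : InteriorIdx → ℝ) :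
    h ^ 2 * ∑ i, interiorRow a b K h kl i * x i = h ^ (kl.1 + kl.2)
      * ∑ i, interiorRow (a * h) (b * h) (K * h ^ 2) 1 kl i * (interiorScale h i * x i) := by
  rw [Finset.mul_sum, Finset.mul_sum]
  exact Finset.sum_congr rfl fun i _ => by
    linear_combination x i * interiorRow_scale a b K h kl i

theorem sum_fluxRow_scale (a b K σ h : ℝ) (kl : ℕ × ℕ) (x : FluxIdx → ℝ) :
    h ^ 2 * ∑ i, fluxRow a b K σ h kl i * x i = h ^ (kl.1 + kl.2)
      * ∑ i, fluxRow (a * h) (b * h) (K * h ^ 2) (σ * h) 1 kl i * (fluxScale h i * x i) := by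
  rw [Finset.mul_sum, Finset.mul_sum]
  exact Finset.sum_congr rfl fun i _ => by
    linear_combination x i * fluxRow_scale a b K σ h kl i

/-! ### The interior stencil -/

theorem forall_mem_matchIdx {P : ℕ × ℕ → Prop} : (∀ kl ∈ matchIdx, P kl) ↔
    P (0, 0) ∧ P (1, 0) ∧ P (0, 1) ∧ P (2, 0) ∧ P (1, 1) ∧ P (0, 2) ∧ P (3, 0) ∧ P (2, 1) ∧
      P (1, 2) ∧ P (0, 3) ∧ P (4, 0) ∧ P (3, 1) ∧ P (2, 2) ∧ P (1, 3) ∧ P (0, 4) := by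
  have : matchIdx = {(0, 0), (1, 0), (0, 1), (2, 0), (1, 1), (0, 2), (3, 0), (2, 1), (1, 2),
      (0, 3), (4, 0), (3, 1), (2, 2), (1, 3), (0, 4)} := by decide
  rw [this]
  simp

theorem moment_ofMoments₃ (μ : ℕ → ℕ → ℝ) {k l : ℕ} (hk : k < 3) (hl : l < 3) :
    moment pos₃ pos₃ (ofMoments lagrange₃ lagrange₃ μ) k l = μ k l :=
  moment_ofMoments sum_pos₃_mul_lagrange₃ sum_pos₃_mul_lagrange₃ μ ⟨k, hk⟩ ⟨l, hl⟩

theorem moment_ofMoments₂₃ (μ : ℕ → ℕ → ℝ) {k l : ℕ} (hk : k < 2) (hl : l < 3) :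
    moment pos₂ pos₃ (ofMoments lagrange₂ lagrange₃ μ) k l = μ k l :=
  moment_ofMoments sum_pos₂_mul_lagrange₂ sum_pos₃_mul_lagrange₃ μ ⟨k, hk⟩ ⟨l, hl⟩

/-- For `K ≤ 0` the fifteen equations for the interior coefficients can be solved exactly: two of
them coincide, and the others determine all moments of `α` and those of `β` up to order two. -/
theorem exists_interior_solution (a b K : ℝ) (hK : K ≤ 0) :
    ∃ α β : Fin 3 → Fin 3 → ℝ, moment pos₃ pos₃ β 0 0 = 1 ∧ ∀ kl ∈ matchIdx,
      ∑ i, interiorRow a b K 1 kl i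
        * Sum.elim (Function.uncurry α) (Function.uncurry β) i = 0 := by
  -- eliminating the moments of `α`, then `m10` and `m01`, leaves a linear equation for each of
  -- `m20` and `m02`; for `K ≤ 0` its coefficient is positive
  have hden : ∀ a : ℝ, 0 < (12 - K) * (6 - K) + 6 * a ^ 2 := fun a => by
    have : 0 < (12 - K) * (6 - K) := mul_pos (by linarith) (by linarith)
    positivity
  have h6 : (6 - K) ≠ 0 := by linarith
  obtain ⟨m20, e20⟩ : ∃ m : ℝ, m * ((12 - K) * (6 - K) + 6 * a ^ 2) = 2 * (6 - K) + 2 * a ^ 2 :=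
    ⟨_, div_mul_cancel₀ _ (hden a).ne'⟩
  obtain ⟨m02, e02⟩ : ∃ m : ℝ, m * ((12 - K) * (6 - K) + 6 * b ^ 2) = 2 * (6 - K) + 2 * b ^ 2 :=
    ⟨_, div_mul_cancel₀ _ (hden b).ne'⟩
  obtain ⟨m10, e10⟩ : ∃ m : ℝ, m * (6 - K) = a * (1 - 3 * m20) := ⟨_, div_mul_cancel₀ _ h6⟩
  obtain ⟨m01, e01⟩ : ∃ m : ℝ, m * (6 - K) = b * (1 - 3 * m02) := ⟨_, div_mul_cancel₀ _ h6⟩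
  obtain ⟨m11, e11⟩ : ∃ m : ℝ, m * (6 - K) = a * m01 + b * m10 := ⟨_, div_mul_cancel₀ _ h6⟩
  have f20 : (12 - K) * m20 = 2 + 2 * a * m10 := by
    refine mul_right_cancel₀ h6 ?_
    linear_combination e20 - 2 * a * e10
  have f02 : (12 - K) * m02 = 2 + 2 * b * m01 := by
    refine mul_right_cancel₀ h6 ?_
    linear_combination e02 - 2 * b * e01
  -- the moments of `β` and of `α`; those of `β` of order above two do not enter the equations
  let μ : ℕ → ℕ → ℝ
    | 0, 0 => 1
    | 1, 0 => m10
    | 0, 1 => m01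
    | 2, 0 => m20
    | 1, 1 => m11
    | 0, 2 => m02
    | _, _ => 0
  let ν : ℕ → ℕ → ℝ
    | 0, 0 => K
    | 1, 0 => a + K * m10
    | 0, 1 => b + K * m01
    | 2, 0 => 12 * m20
    | 1, 1 => 6 * m11
    | 0, 2 => 12 * m02
    | 2, 1 => 2 * m01 + 2 * a * m11 + b * m20
    | 1, 2 => 2 * m10 + 2 * b * m11 + a * m02
    | 2, 2 => 2 * m20 + 2 * m02
    | _, _ => 0
  have hμ := fun {k l} hk hl => moment_ofMoments₃ μ (k := k) (l := l) hk hl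
  have hν := fun {k l} hk hl => moment_ofMoments₃ ν (k := k) (l := l) hk hl
  refine ⟨ofMoments lagrange₃ lagrange₃ ν, ofMoments lagrange₃ lagrange₃ μ,
    hμ (by norm_num) (by norm_num), ?_⟩
  rw [forall_mem_matchIdx]
  simp only [sum_interiorRow]
  refine ⟨?_, ?_, ?_, ?_, ?_, ?_, ?_, ?_, ?_, ?_, ?_, ?_, ?_, ?_, ?_⟩ <;>
    simp [sourceMoment, taylorMomentTwo, hμ, hν, moment_fst_reduce (k := 0),
      moment_fst_reduce (k := 1), moment_snd_reduce (l := 0), moment_snd_reduce (l := 1),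
      Nat.factorial, μ, ν]
  all_goals linarith

/-- The moment equations at an interior point determine the moments up to `O(ε)`. The hypotheses on
`A` express that `ξ³ = ξ` at the positions of the stencil. -/
theorem interior_moment_bounds {a b K ε : ℝ} {A m : ℕ → ℕ → ℝ} (hε : ε ≤ 1 / 12)
    (ha : |a| ≤ ε) (hb : |b| ≤ ε) (hK : |K| ≤ ε) (hm : m 0 0 = 1)
    (hA3 : ∀ l, A 3 l = A 1 l) (hA3' : ∀ k, A k 3 = A k 1) (hA4 : ∀ l, A 4 l = A 2 l)
    (hA4' : ∀ k, A k 4 = A k 2)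
    (h : ∀ kl ∈ matchIdx, A kl.1 kl.2 / (kl.1.factorial * kl.2.factorial)
      - sourceMoment a b K m kl.1 kl.2 = 0) :
    |A 0 0| ≤ 20 * ε ∧ |A 1 0| ≤ 20 * ε ∧ |A 0 1| ≤ 20 * ε ∧ |A 2 0 - 2| ≤ 20 * ε ∧
    |A 1 1| ≤ 20 * ε ∧ |A 0 2 - 2| ≤ 20 * ε ∧ |A 2 1| ≤ 20 * ε ∧ |A 1 2| ≤ 20 * ε ∧
    |A 2 2 - 2 / 3| ≤ 20 * ε ∧ |m 1 0| ≤ 20 * ε ∧ |m 0 1| ≤ 20 * ε ∧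
    |m 2 0 - 1 / 6| ≤ 20 * ε ∧ |m 1 1| ≤ 20 * ε ∧ |m 0 2 - 1 / 6| ≤ 20 * ε := by
  rw [forall_mem_matchIdx] at h
  obtain ⟨h00, h10, h01, h20, h11, h02, h30, h21, h12, h03, h40, h31, h22, h13, h04⟩ := h
  simp [sourceMoment, taylorMomentTwo, Nat.factorial, hm, hA3, hA3', hA4, hA4']
    at h00 h10 h01 h20 h11 h02 h30 h21 h12 h03 h40 h31 h22 h13 h04
  have hε0 : 0 ≤ ε := (abs_nonneg _).trans ha
  -- `Z` bounds all unknown moments of `β`: every equation holds up to a multiple of `ε Z`, which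
  -- first bounds `Z` itself
  set Z := 1 + |m 1 0| + |m 0 1| + |m 2 0| + |m 1 1| + |m 0 2| with hZ
  have n1 := abs_nonneg (m 1 0)
  have n2 := abs_nonneg (m 0 1)
  have n3 := abs_nonneg (m 2 0)
  have n4 := abs_nonneg (m 1 1)
  have n5 := abs_nonneg (m 0 2)
  have prod : ∀ c z : ℝ, |c| ≤ ε → |z| ≤ Z → -(ε * Z) ≤ c * z ∧ c * z ≤ ε * Z := by
    intro c z hc hz
    rw [← abs_le, abs_mul]
    exact mul_le_mul hc hz (abs_nonneg _) hε0
  have l1 : |m 1 0| ≤ Z := by linarith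
  have l2 : |m 0 1| ≤ Z := by linarith
  have l3 : |m 2 0| ≤ Z := by linarith
  have l4 : |m 1 1| ≤ Z := by linarith
  have l5 : |m 0 2| ≤ Z := by linarith
  have hZ1 : 1 ≤ Z := by linarith
  have hεZ : ε ≤ ε * Z := le_mul_of_one_le_right hε0 hZ1
  obtain ⟨a1, a1'⟩ := prod a _ ha l1
  obtain ⟨a2, a2'⟩ := prod a _ ha l2
  obtain ⟨a3, a3'⟩ := prod a _ ha l3
  obtain ⟨a4, a4'⟩ := prod a _ ha l4
  obtain ⟨a5, a5'⟩ := prod a _ ha l5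
  obtain ⟨b1, b1'⟩ := prod b _ hb l1
  obtain ⟨b2, b2'⟩ := prod b _ hb l2
  obtain ⟨b3, b3'⟩ := prod b _ hb l3
  obtain ⟨b4, b4'⟩ := prod b _ hb l4
  obtain ⟨b5, b5'⟩ := prod b _ hb l5
  obtain ⟨c1, c1'⟩ := prod K _ hK l1
  obtain ⟨c2, c2'⟩ := prod K _ hK l2
  obtain ⟨c3, c3'⟩ := prod K _ hK l3
  obtain ⟨c4, c4'⟩ := prod K _ hK l4
  obtain ⟨c5, c5'⟩ := prod K _ hK l5
  obtain ⟨ha1, ha2⟩ := abs_le.1 ha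
  obtain ⟨hb1, hb2⟩ := abs_le.1 hb
  obtain ⟨hK1, hK2⟩ := abs_le.1 hK
  set δ := ε * Z with hδ
  have g20 : |m 2 0 - 1 / 6| ≤ δ := abs_le.2
    ⟨by linarith only [h20, h40, a1, a1', c3, c3', hεZ, hε0],
      by linarith only [h20, h40, a1, a1', c3, c3', hεZ, hε0]⟩
  have g02 : |m 0 2 - 1 / 6| ≤ δ := abs_le.2
    ⟨by linarith only [h02, h04, b2, b2', c5, c5', hεZ, hε0],
      by linarith only [h02, h04, b2, b2', c5, c5', hεZ, hε0]⟩
  have g10 : |m 1 0| ≤ δ := abs_le.2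
    ⟨by linarith only [h10, h30, a3, a3', c1, c1', ha1, ha2, hεZ],
      by linarith only [h10, h30, a3, a3', c1, c1', ha1, ha2, hεZ]⟩
  have g01 : |m 0 1| ≤ δ := abs_le.2
    ⟨by linarith only [h01, h03, b5, b5', c2, c2', hb1, hb2, hεZ],
      by linarith only [h01, h03, b5, b5', c2, c2', hb1, hb2, hεZ]⟩
  have g11 : |m 1 1| ≤ δ := abs_le.2
    ⟨by linarith only [h11, h31, a2, a2', b1, b1', c4, c4', hεZ],
      by linarith only [h11, h31, a2, a2', b1, b1', c4, c4', hεZ]⟩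
  obtain ⟨p1, p1'⟩ := abs_le.1 g20
  obtain ⟨p2, p2'⟩ := abs_le.1 g02
  obtain ⟨p3, p3'⟩ := abs_le.1 g10
  obtain ⟨p4, p4'⟩ := abs_le.1 g01
  obtain ⟨p5, p5'⟩ := abs_le.1 g11
  have t20 : |m 2 0| ≤ 1 / 6 + δ :=
    abs_le.2 ⟨by linarith only [p1, hεZ, hε0], by linarith only [p1']⟩
  have t02 : |m 0 2| ≤ 1 / 6 + δ :=
    abs_le.2 ⟨by linarith only [p2, hεZ, hε0], by linarith only [p2']⟩
  have hZ4 : Z ≤ 4 := by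
    have : δ ≤ 1 / 12 * Z := mul_le_mul_of_nonneg_right hε (by linarith only [hZ1])
    linarith only [this, hZ, t20, t02, g10, g01, g11]
  have hδε : δ ≤ 4 * ε := by
    rw [hδ, mul_comm]; exact mul_le_mul_of_nonneg_right hZ4 hε0
  refine ⟨?_, ?_, ?_, ?_, ?_, ?_, ?_, ?_, ?_, ?_, ?_, ?_, ?_, ?_⟩
  · exact abs_le.2 ⟨by linarith only [h00, hK1, hε0], by linarith only [h00, hK2, hε0]⟩
  · exact abs_le.2 ⟨by linarith only [h10, ha1, c1, hδε, hε0],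
      by linarith only [h10, ha2, c1', hδε, hε0]⟩
  · exact abs_le.2 ⟨by linarith only [h01, hb1, c2, hδε, hε0],
      by linarith only [h01, hb2, c2', hδε, hε0]⟩
  · exact abs_le.2 ⟨by linarith only [h20, a1, c3, hδε, hε0],
      by linarith only [h20, a1', c3', hδε, hε0]⟩
  · exact abs_le.2 ⟨by linarith only [h11, a2, b1, c4, hδε, hε0],
      by linarith only [h11, a2', b1', c4', hδε, hε0]⟩
  · exact abs_le.2 ⟨by linarith only [h02, b2, c5, hδε, hε0],
      by linarith only [h02, b2', c5', hδε, hε0]⟩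
  · exact abs_le.2 ⟨by linarith only [h21, p4, a4, b3, hδε, hε0],
      by linarith only [h21, p4', a4', b3', hδε, hε0]⟩
  · exact abs_le.2 ⟨by linarith only [h12, p3, b4, a5, hδε, hε0],
      by linarith only [h12, p3', b4', a5', hδε, hε0]⟩
  · exact abs_le.2 ⟨by linarith only [h22, p1, p2, hδε, hε0],
      by linarith only [h22, p1', p2', hδε, hε0]⟩
  · exact g10.trans (by linarith only [hδε, hε0])
  · exact g01.trans (by linarith only [hδε, hε0])
  · exact g20.trans (by linarith only [hδε, hε0])
  · exact g11.trans (by linarith only [hδε, hε0])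
  · exact g02.trans (by linarith only [hδε, hε0])

/-! ### Source weights of smallest norm -/

/-- Source weights of smallest norm are orthogonal to all arrays whose moments up to order two
vanish, which fixes their remaining moments. -/
theorem moment_of_orthogonal {β : Fin 3 → Fin 3 → ℝ}
    (h : ∀ Z : Fin 3 → Fin 3 → ℝ, (∀ k l, k + l ≤ 2 → moment pos₃ pos₃ Z k l = 0) →
      ∑ i, ∑ j, β i j * Z i j = 0) :
    moment pos₃ pos₃ β 2 1 = 2 / 3 * moment pos₃ pos₃ β 0 1 ∧
    moment pos₃ pos₃ β 1 2 = 2 / 3 * moment pos₃ pos₃ β 1 0 ∧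
    moment pos₃ pos₃ β 2 2 = 2 / 3 * moment pos₃ pos₃ β 2 0 + 2 / 3 * moment pos₃ pos₃ β 0 2
      - 4 / 9 * moment pos₃ pos₃ β 0 0 := by
  -- `ξ² - 2 / 3` is orthogonal to `1` and `ξ` on the positions `-1, 0, 1`, so these three products
  -- span the arrays whose moments up to order two vanish
  have h1 := h (fun i j => (pos₃ i ^ 2 - 2 / 3) * pos₃ j) (by
    intro k l hkl
    have hk : k ≤ 2 := by omega
    have hl : l ≤ 2 := by omega
    interval_cases k <;> interval_cases l <;>
      first | omega | (simp [moment, Fin.sum_univ_three] <;> norm_num))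
  have h2 := h (fun i j => pos₃ i * (pos₃ j ^ 2 - 2 / 3)) (by
    intro k l hkl
    have hk : k ≤ 2 := by omega
    have hl : l ≤ 2 := by omega
    interval_cases k <;> interval_cases l <;>
      first | omega | (simp [moment, Fin.sum_univ_three] <;> norm_num))
  have h3 := h (fun i j => (pos₃ i ^ 2 - 2 / 3) * (pos₃ j ^ 2 - 2 / 3)) (by
    intro k l hkl
    have hk : k ≤ 2 := by omega
    have hl : l ≤ 2 := by omega
    interval_cases k <;> interval_cases l <;>
      first | omega | (simp [moment, Fin.sum_univ_three] <;> norm_num))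
  simp only [Fin.sum_univ_three, pos₃_zero, pos₃_one, pos₃_two] at h1 h2 h3
  simp only [moment, Fin.sum_univ_three, pos₃_zero, pos₃_one, pos₃_two]
  refine ⟨?_, ?_, ?_⟩
  · linear_combination h1
  · linear_combination h2
  · linear_combination h3

/-- Source weights of smallest norm are bounded by their moments up to order two. -/
theorem abs_le_of_moment_le {β : Fin 3 → Fin 3 → ℝ}
    (h : ∀ Z : Fin 3 → Fin 3 → ℝ, (∀ k l, k + l ≤ 2 → moment pos₃ pos₃ Z k l = 0) →
      ∑ i, ∑ j, β i j * Z i j = 0) {B : ℝ}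
    (hB : ∀ k l, k + l ≤ 2 → |moment pos₃ pos₃ β k l| ≤ B) (i j : Fin 3) :
    |β i j| ≤ 18 * B := by
  obtain ⟨h21, h12, h22⟩ := moment_of_orthogonal h
  have hB0 : 0 ≤ B := (abs_nonneg _).trans (hB 0 0 (by norm_num))
  have key : ∀ k l : Fin 3, |moment pos₃ pos₃ β k l - (0 : ℕ → ℕ → ℝ) k l| ≤ 2 * B := by
    have b00 := abs_le.1 (hB 0 0 (by norm_num))
    have b10 := abs_le.1 (hB 1 0 (by norm_num))
    have b01 := abs_le.1 (hB 0 1 (by norm_num))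
    have b20 := abs_le.1 (hB 2 0 (by norm_num))
    have b11 := abs_le.1 (hB 1 1 (by norm_num))
    have b02 := abs_le.1 (hB 0 2 (by norm_num))
    intro k l
    fin_cases k <;> fin_cases l <;> simp only [Pi.zero_apply, sub_zero, abs_le]
    · constructor <;> linarith [b00.1, b00.2]
    · constructor <;> linarith [b01.1, b01.2]
    · constructor <;> linarith [b02.1, b02.2]
    · constructor <;> linarith [b10.1, b10.2]
    · constructor <;> linarith [b11.1, b11.2]
    · rw [h12]; constructor <;> linarith [b10.1, b10.2]
    · constructor <;> linarith [b20.1, b20.2]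
    · rw [h21]; constructor <;> linarith [b01.1, b01.2]
    · rw [h22]
      constructor <;> linarith [b20.1, b20.2, b02.1, b02.2, b00.1, b00.2]
  have := abs_ofMoments_sub_le abs_lagrange₃_le abs_lagrange₃_le key i j
  rw [ofMoments_moment sum_lagrange₃_mul sum_lagrange₃_mul] at this
  simp [ofMoments] at this
  linarith

theorem sourceMoment_eq_zero {a b K : ℝ} {μ : ℕ → ℕ → ℝ} (h : ∀ k l, k + l ≤ 2 → μ k l = 0)
    (k l : ℕ) : sourceMoment a b K μ k l = 0 := by
  have : ∀ k l, taylorMomentTwo μ k l = 0 := by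
    intro k l
    unfold taylorMomentTwo
    split_ifs with hkl
    · simp [h k l hkl]
    · rfl
  simp [sourceMoment, this]

/-! ### Bounds for the interior stencil -/

/-- The limit of the scaled interior coefficients `h² α`, the compact fourth order Laplacian. -/
noncomputable def interiorLimit : Fin 3 → Fin 3 → ℝ :=
  ![![1 / 6, 2 / 3, 1 / 6], ![2 / 3, -10 / 3, 2 / 3], ![1 / 6, 2 / 3, 1 / 6]]

theorem moment_interiorLimit (k l : Fin 3) : moment pos₃ pos₃ interiorLimit k l =
    (![![0, 0, 2], ![0, 0, 0], ![2, 0, 2 / 3]] : Fin 3 → Fin 3 → ℝ) k l := by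
  fin_cases k <;> fin_cases l <;>
    simp [moment, Fin.sum_univ_three, interiorLimit, Matrix.cons_val] <;> norm_num

/-- The coefficients `α` of the interior stencil. -/
noncomputable def interiorAlpha (a b K h : ℝ) (i j : Fin 3) : ℝ :=
  interiorStencil a b K h (.inl (i, j))

/-- The coefficients `β` of the interior stencil. -/
noncomputable def interiorBeta (a b K h : ℝ) (i j : Fin 3) : ℝ :=
  interiorStencil a b K h (.inr (i, j))

/-- What the analysis of the scheme uses about the interior stencil: the fifteen equations hold
(`row`), `h² α` is close to its limit (`abs_alpha`), the odd moments of `β` are small (`odd`), and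
`α` is consistent with the differential operator (`low`). -/
structure InteriorStencilBounds (a b K h C : ℝ) : Prop where
  row : ∀ kl ∈ matchIdx, ∑ i, interiorRow a b K h kl i * interiorStencil a b K h i = 0
  abs_beta : ∀ i j, |interiorBeta a b K h i j| ≤ C
  abs_alpha : ∀ i j, |h ^ 2 * interiorAlpha a b K h i j - interiorLimit i j| ≤ C * h
  odd : |moment pos₃ pos₃ (interiorBeta a b K h) 1 0| ≤ C * h ∧
    |moment pos₃ pos₃ (interiorBeta a b K h) 0 1| ≤ C * h ∧
    |moment pos₃ pos₃ (interiorBeta a b K h) 2 1| ≤ C * h ∧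
    |moment pos₃ pos₃ (interiorBeta a b K h) 1 2| ≤ C * h
  low : |moment pos₃ pos₃ (interiorAlpha a b K h) 0 0 - K| ≤ C * h ∧
    |h * moment pos₃ pos₃ (interiorAlpha a b K h) 1 0 - a| ≤ C * h ∧
    |h * moment pos₃ pos₃ (interiorAlpha a b K h) 0 1 - b| ≤ C * h ∧
    |h ^ 2 * moment pos₃ pos₃ (interiorAlpha a b K h) 2 0 - 2| ≤ C * h ∧
    |h ^ 2 * moment pos₃ pos₃ (interiorAlpha a b K h) 1 1| ≤ C * h ∧
    |h ^ 2 * moment pos₃ pos₃ (interiorAlpha a b K h) 0 2 - 2| ≤ C * h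

theorem moment_const_mul {m n : ℕ} (ξ : Fin m → ℝ) (η : Fin n → ℝ) (t : ℝ)
    (c : Fin m → Fin n → ℝ) (k l : ℕ) :
    moment ξ η (fun i j => t * c i j) k l = t * moment ξ η c k l := by
  simp only [moment, Finset.mul_sum, mul_assoc]

theorem interiorScale_mul_eq (a b K h : ℝ) :
    (fun i => interiorScale h i * interiorStencil a b K h i) =
      Sum.elim (Function.uncurry fun i j => h ^ 2 * interiorAlpha a b K h i j)
        (Function.uncurry (interiorBeta a b K h)) := by
  funext i
  rcases i with ⟨i, j⟩ | ⟨i, j⟩ <;> simp [interiorScale, interiorAlpha, interiorBeta]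

/-- A solvable least-squares problem is solved with residual zero. -/
theorem sum_interiorRow_interiorStencil (a b : ℝ) {K h : ℝ} (hK : K ≤ 0) (hh : 0 < h)
    {kl : ℕ × ℕ} (hkl : kl ∈ matchIdx) :
    ∑ i, interiorRow a b K h kl i * interiorStencil a b K h i = 0 := by
  obtain ⟨α, β, hβ, hrow⟩ := exists_interior_solution (a * h) (b * h) (K * h ^ 2)
    (mul_nonpos_of_nonpos_of_nonneg hK (sq_nonneg h))
  set y : InteriorIdx → ℝ := Sum.elim (Function.uncurry fun i j => α i j / h ^ 2)
    (Function.uncurry β) with hy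
  have hs : (fun i => interiorScale h i * y i) =
      Sum.elim (Function.uncurry α) (Function.uncurry β) := by
    funext i
    rcases i with ⟨i, j⟩ | ⟨i, j⟩
    · simp [interiorScale, hy]; field_simp
    · simp [interiorScale, hy]
  have hyrow : ∀ kl ∈ matchIdx, ∑ i, interiorRow a b K h kl i * y i = 0 := by
    intro kl hkl
    have h1 := sum_interiorRow_scale a b K h kl y
    have h2 : ∀ i, interiorScale h i * y i =
        Sum.elim (Function.uncurry α) (Function.uncurry β) i := congrFun hs
    simp only [h2] at h1
    rw [hrow kl hkl, mul_zero] at h1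
    exact (mul_eq_zero.1 h1).resolve_left (by positivity)
  have hynorm : ∑ i, interiorNorm i * y i = 1 := by
    simp only [Fintype.sum_sum_type, Fintype.sum_prod_type, interiorNorm, hy]
    simpa [moment] using hβ
  have h0 : sqResidual (interiorRow a b K h) y = 0 :=
    Finset.sum_eq_zero fun kl hkl => by rw [hyrow kl hkl]; ring
  have := (interiorStencil_spec a b K h).sq_row_le hynorm hkl
  rw [h0] at this
  exact pow_eq_zero_iff two_ne_zero |>.1 (le_antisymm this (sq_nonneg _))

/-- Source weights with vanishing moments up to order two lie in the kernel of the equations. -/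
theorem interiorBeta_orthogonal (a b K : ℝ) {h : ℝ} (hh : 0 < h) (Z : Fin 3 → Fin 3 → ℝ)
    (hZ : ∀ k l, k + l ≤ 2 → moment pos₃ pos₃ Z k l = 0) :
    ∑ i, ∑ j, interiorBeta a b K h i j * Z i j = 0 := by
  set z : InteriorIdx → ℝ := Sum.elim (Function.uncurry fun _ _ => 0) (Function.uncurry Z) with hz
  have hs : ∀ i, interiorScale h i * z i = z i := by
    rintro (⟨i, j⟩ | ⟨i, j⟩) <;> simp [interiorScale, hz]
  have h1 := (interiorStencil_spec a b K h).sum_mul_eq_zero (z := z) (by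
      simp only [Fintype.sum_sum_type, Fintype.sum_prod_type, interiorNorm, hz]
      simpa [moment] using hZ 0 0 (by norm_num)) (by
      rintro ⟨k, l⟩ _
      have h1 := sum_interiorRow_scale a b K h (k, l) z
      simp only [hs] at h1
      rw [hz, sum_interiorRow, sourceMoment_eq_zero hZ] at h1
      simp [moment] at h1
      simpa [hh.ne', hz] using h1)
  simpa [Fintype.sum_sum_type, Fintype.sum_prod_type, hz, interiorBeta] using h1

theorem interiorStencilBounds (a b : ℝ) {K h C₀ : ℝ} (hK : K ≤ 0) (hC₀ : 1 ≤ C₀)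
    (ha : |a| ≤ C₀) (hb : |b| ≤ C₀) (hKC : |K| ≤ C₀) (hh : 0 < h) (hsmall : 240 * C₀ * h ≤ 1) :
    InteriorStencilBounds a b K h (240 * C₀) := by
  have h1 : h ≤ 1 := by nlinarith
  -- all coefficients of the equation scaled to step size one are at most `ε`; the moments are then
  -- known up to `20 ε`, and Lagrange interpolation of the nine weights costs a factor of nine
  set ε := C₀ * h with hε
  have hε0 : 0 ≤ ε := by positivity
  have hε' : ε ≤ 1 / 240 := by linarith
  have hah : |a * h| ≤ ε := by
    rw [abs_mul, abs_of_pos hh]; exact mul_le_mul_of_nonneg_right ha hh.le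
  have hbh : |b * h| ≤ ε := by
    rw [abs_mul, abs_of_pos hh]; exact mul_le_mul_of_nonneg_right hb hh.le
  have hKh' : |K * h| ≤ ε := by
    rw [abs_mul, abs_of_pos hh]; exact mul_le_mul_of_nonneg_right hKC hh.le
  have hKh : |K * h ^ 2| ≤ ε := by
    rw [abs_mul, abs_of_pos (by positivity : 0 < h ^ 2)]
    exact mul_le_mul hKC (by nlinarith) (by positivity) (by positivity)
  have hrow := fun kl hkl => sum_interiorRow_interiorStencil a b hK hh (kl := kl) hkl
  set α := interiorAlpha a b K h with hα
  set β := interiorBeta a b K h with hβ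
  set α' : Fin 3 → Fin 3 → ℝ := fun i j => h ^ 2 * α i j with hα'
  have hnorm : moment pos₃ pos₃ β 0 0 = 1 := by
    have := (interiorStencil_spec a b K h).1
    simpa [Fintype.sum_sum_type, Fintype.sum_prod_type, interiorNorm, moment, hβ, interiorBeta]
      using this
  have hrow' : ∀ kl ∈ matchIdx, moment pos₃ pos₃ α' kl.1 kl.2
      / (kl.1.factorial * kl.2.factorial)
      - sourceMoment (a * h) (b * h) (K * h ^ 2) (moment pos₃ pos₃ β) kl.1 kl.2 = 0 := by
    rintro ⟨k, l⟩ hkl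
    have e := sum_interiorRow_scale a b K h (k, l) (interiorStencil a b K h)
    have h2 : ∀ i, interiorScale h i * interiorStencil a b K h i = _ :=
      congrFun (interiorScale_mul_eq a b K h)
    simp only [h2] at e
    rw [hrow _ hkl, sum_interiorRow, mul_zero] at e
    exact (mul_eq_zero.1 e.symm).resolve_left (by positivity)
  obtain ⟨A00, A10, A01, A20, A11, A02, A21, A12, A22, m10, m01, m20, m11, m02⟩ :=
    interior_moment_bounds (by linarith) hah hbh hKh hnorm
      (fun l => moment_fst_reduce _ _ 0 l) (fun k => moment_snd_reduce _ _ k 0)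
      (fun l => moment_fst_reduce _ _ 1 l) (fun k => moment_snd_reduce _ _ k 1) hrow'
  have orth := interiorBeta_orthogonal a b K hh
  obtain ⟨o21, o12, -⟩ := moment_of_orthogonal orth
  have eε : 240 * C₀ * h = 240 * ε := by rw [hε]; ring
  have bm10 : |moment pos₃ pos₃ β 1 0| ≤ 1 := m10.trans (by linarith)
  have bm01 : |moment pos₃ pos₃ β 0 1| ≤ 1 := m01.trans (by linarith)
  have bm11 : |moment pos₃ pos₃ β 1 1| ≤ 1 := m11.trans (by linarith)
  have bm20 : |moment pos₃ pos₃ β 2 0| ≤ 1 := by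
    rw [abs_le] at m20 ⊢; constructor <;> linarith [m20.1, m20.2]
  have bm02 : |moment pos₃ pos₃ β 0 2| ≤ 1 := by
    rw [abs_le] at m02 ⊢; constructor <;> linarith [m02.1, m02.2]
  refine ⟨hrow, ?_, ?_, ?_, ?_⟩
  · intro i j
    refine (abs_le_of_moment_le orth (B := 1) ?_ i j).trans (by linarith)
    intro k l hkl
    have hk : k ≤ 2 := by omega
    have hl : l ≤ 2 := by omega
    interval_cases k <;> interval_cases l <;> first | omega | assumption | skip
    exact (by rw [← hβ, hnorm]; norm_num)
  · intro i j
    have key : ∀ k l : Fin 3,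
        |moment pos₃ pos₃ α' k l - moment pos₃ pos₃ interiorLimit k l| ≤ 20 * ε := by
      intro k l
      rw [moment_interiorLimit]
      fin_cases k <;> fin_cases l <;> simpa [Matrix.cons_val]
    have := abs_ofMoments_sub_le abs_lagrange₃_le abs_lagrange₃_le key i j
    rw [ofMoments_moment sum_lagrange₃_mul sum_lagrange₃_mul,
      ofMoments_moment sum_lagrange₃_mul sum_lagrange₃_mul] at this
    rw [eε]
    refine this.trans ?_
    push_cast
    linarith
  · rw [eε, o21, o12, abs_mul, abs_mul]
    norm_num
    exact ⟨by linarith, by linarith, by linarith, by linarith⟩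
  · rw [forall_mem_matchIdx] at hrow'
    obtain ⟨h00, h10, h01, h20, h11, h02, -⟩ := hrow'
    simp [sourceMoment, taylorMomentTwo, Nat.factorial, hnorm] at h00 h10 h01 h20 h11 h02
    simp only [hα', moment_const_mul] at h00 h10 h01 h20 h11 h02
    have small : ∀ c z : ℝ, |c| ≤ ε → |z| ≤ 1 → -ε ≤ c * z ∧ c * z ≤ ε := by
      intro c z hc hz
      rw [← abs_le, abs_mul, ← mul_one ε]
      exact mul_le_mul hc hz (abs_nonneg _) hε0
    rw [eε]
    refine ⟨?_, ?_, ?_, ?_, ?_, ?_⟩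
    · have : moment pos₃ pos₃ α 0 0 = K :=
        mul_left_cancel₀ (by positivity : h ^ 2 ≠ 0) (by linarith)
      rw [this, sub_self, abs_zero]; positivity
    · have : h * moment pos₃ pos₃ α 1 0 - a = K * h * moment pos₃ pos₃ β 1 0 :=
        mul_left_cancel₀ hh.ne' (by linear_combination h10)
      obtain ⟨s1, s2⟩ := small _ _ hKh' bm10
      rw [this]; exact abs_le.2 ⟨by linarith, by linarith⟩
    · have : h * moment pos₃ pos₃ α 0 1 - b = K * h * moment pos₃ pos₃ β 0 1 :=
        mul_left_cancel₀ hh.ne' (by linear_combination h01)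
      obtain ⟨s1, s2⟩ := small _ _ hKh' bm01
      rw [this]; exact abs_le.2 ⟨by linarith, by linarith⟩
    · obtain ⟨s1, s2⟩ := small _ _ hah bm10
      obtain ⟨s3, s4⟩ := small _ _ hKh bm20
      exact abs_le.2 ⟨by linarith, by linarith⟩
    · obtain ⟨s1, s2⟩ := small _ _ hah bm01
      obtain ⟨s3, s4⟩ := small _ _ hbh bm10
      obtain ⟨s5, s6⟩ := small _ _ hKh bm11
      exact abs_le.2 ⟨by linarith, by linarith⟩
    · obtain ⟨s1, s2⟩ := small _ _ hbh bm01
      obtain ⟨s3, s4⟩ := small _ _ hKh bm02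
      exact abs_le.2 ⟨by linarith, by linarith⟩

/-! ### The flux stencil -/

theorem moment₁_lagrange₃ (g : ℕ → ℝ) {l : ℕ} (hl : l < 3) :
    moment₁ pos₃ (fun j => ∑ k : Fin 3, lagrange₃ j k * g k) l = g l := by
  interval_cases l <;>
    simp [moment₁, Fin.sum_univ_three, lagrange₃, Matrix.cons_val] <;> ring

theorem moment₁_reduce (c : Fin 3 → ℝ) : moment₁ pos₃ c 3 = moment₁ pos₃ c 1 := by
  simp [moment₁, Fin.sum_univ_three]; ring

/-- The equations for the flux coefficients are in general not solvable, but there are coefficients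
that fulfil the equations of order at most three and leave residuals `O(ε)` in those of order
four. They serve as a competitor in the least-squares problem. -/
theorem exists_flux_competitor {a b K σ ε : ℝ} (hε : ε ≤ 1 / 12) (ha : |a| ≤ ε) (hb : |b| ≤ ε)
    (hK : |K| ≤ ε) (hσ : |σ| ≤ ε) :
    ∃ (α : Fin 2 → Fin 3 → ℝ) (β : Fin 3 → Fin 3 → ℝ) (γ : Fin 3 → ℝ),
      moment pos₃ pos₃ β 0 0 = 1 ∧ ∀ kl ∈ matchIdx,
      |∑ i, fluxRow a b K σ 1 kl i
        * Sum.elim (Function.uncurry α) (Sum.elim (Function.uncurry β) γ) i| ≤ ε ∧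
      (kl.1 + kl.2 < 4 → ∑ i, fluxRow a b K σ 1 kl i
        * Sum.elim (Function.uncurry α) (Sum.elim (Function.uncurry β) γ) i = 0) := by
  have hε0 : 0 ≤ ε := (abs_nonneg _).trans ha
  obtain ⟨ha1, ha2⟩ := abs_le.1 ha
  obtain ⟨hb1, hb2⟩ := abs_le.1 hb
  obtain ⟨hK1, hK2⟩ := abs_le.1 hK
  -- with `m20 = m02 = 1 / 6` and `m11 = 0` imposed, `m10` and `m01` come from the third order
  -- equations `(3, 0)` and `(0, 3)`, and all other moments from the remaining ones
  obtain ⟨m10, e10⟩ : ∃ m : ℝ, m * (6 - 2 * a) = 2 + K / 6 - a / 2 :=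
    ⟨_, div_mul_cancel₀ _ (by linarith)⟩
  obtain ⟨m01, e01⟩ : ∃ m : ℝ, m * (6 - K) = b / 2 := ⟨_, div_mul_cancel₀ _ (by linarith)⟩
  have b10 : |m10| ≤ 1 := abs_le.2 ⟨by nlinarith, by nlinarith⟩
  have b01 : |m01| ≤ ε := abs_le.2 ⟨by nlinarith, by nlinarith⟩
  obtain ⟨g1, hg1⟩ : ∃ g, g = a * m01 + b * m10 - (2 * m01 + b / 6) := ⟨_, rfl⟩
  obtain ⟨g2, hg2⟩ : ∃ g, g = 2 * m10 + a / 6 - 2 / 3 := ⟨_, rfl⟩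
  -- the moments of `β`, `γ` and `α`
  let μ : ℕ → ℕ → ℝ
    | 0, 0 => 1
    | 1, 0 => m10
    | 0, 1 => m01
    | 2, 0 => 1 / 6
    | 0, 2 => 1 / 6
    | _, _ => 0
  let g : ℕ → ℝ
    | 0 => a + K * m10 - (2 + 2 * a * m10 + K / 6)
    | 1 => g1
    | _ => g2
  let ν : ℕ → ℕ → ℝ
    | 0, 0 => K + σ * (a + K * m10 - (2 + 2 * a * m10 + K / 6))
    | 1, 0 => 2 + 2 * a * m10 + K / 6
    | 0, 1 => b + K * m01 + σ * g1
    | 1, 1 => 2 * m01 + b / 6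
    | 0, 2 => 2 + 2 * b * m01 + K / 6 + σ * g2
    | 1, 2 => 2 / 3
    | _, _ => 0
  have hμ := fun {k l} hk hl => moment_ofMoments₃ μ (k := k) (l := l) hk hl
  have hν := fun {k l} hk hl => moment_ofMoments₂₃ ν (k := k) (l := l) hk hl
  have hg := fun {l} hl => moment₁_lagrange₃ g (l := l) hl
  have prod : ∀ c z B : ℝ, |c| ≤ ε → |z| ≤ B → -(ε * B) ≤ c * z ∧ c * z ≤ ε * B := by
    intro c z B hc hz
    rw [← abs_le, abs_mul]
    exact mul_le_mul hc hz (abs_nonneg _) hε0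
  obtain ⟨b10l, b10r⟩ := abs_le.1 b10
  obtain ⟨b01l, b01r⟩ := abs_le.1 b01
  obtain ⟨p1, p1'⟩ := prod a m10 1 ha b10
  obtain ⟨p2, p2'⟩ := prod b m01 1 hb (b01.trans (by linarith))
  obtain ⟨p3, p3'⟩ := prod σ g2 3 hσ
    (by rw [hg2]; exact abs_le.2 ⟨by linarith, by linarith⟩)
  obtain ⟨p4, p4'⟩ := prod a m01 1 ha (b01.trans (by linarith))
  obtain ⟨p5, p5'⟩ := prod b m10 1 hb b10
  refine ⟨ofMoments lagrange₂ lagrange₃ ν, ofMoments lagrange₃ lagrange₃ μ,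
    fun j => ∑ k : Fin 3, lagrange₃ j k * g k, hμ (by norm_num) (by norm_num), ?_⟩
  have low : ∀ x : ℝ, ∀ n : ℕ, x = 0 → |x| ≤ ε ∧ (n < 4 → x = 0) := by
    rintro x n rfl; simpa
  have top : ∀ x : ℝ, |x| ≤ ε → |x| ≤ ε ∧ (4 < 4 → x = 0) := by
    intro x hx; exact ⟨hx, fun h => absurd h (lt_irrefl _)⟩
  rw [forall_mem_matchIdx]
  simp only [sum_fluxRow]
  refine ⟨low _ _ ?_, low _ _ ?_, low _ _ ?_, low _ _ ?_, low _ _ ?_, low _ _ ?_, low _ _ ?_,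
    low _ _ ?_, low _ _ ?_, low _ _ ?_, top _ ?_, top _ ?_, top _ ?_, top _ ?_, top _ ?_⟩ <;>
    simp [sourceMoment, taylorMomentTwo, fluxMoment, hμ, hν, hg, moment_fst_reduce₂ (k := 0),
      moment_fst_reduce₂ (k := 1), moment_fst_reduce₂ (k := 2),
      moment_snd_reduce (l := 0), moment_snd_reduce (l := 1), moment₁_reduce,
      Nat.factorial] <;>
    simp only [μ, ν, g]
  · ring
  · ring
  · ring
  · ring
  · linarith only [hg1]
  · ring
  · linarith only [e10]
  · ring
  · linarith only [hg2]
  · linarith only [e01]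
  · exact abs_le.2 ⟨by linarith, by linarith⟩
  · exact abs_le.2 ⟨by linarith, by linarith⟩
  · norm_num; exact hε0
  · rw [hg1]; exact abs_le.2 ⟨by linarith, by linarith⟩
  · exact abs_le.2 ⟨by linarith, by linarith⟩

/-- Moments that fulfil the flux equations up to `O(ε)` differ by `O(ε)` from the solution of the
limiting equations, because the latter have full column rank. -/
theorem flux_moment_bounds {a b K σ ε : ℝ} {A m : ℕ → ℕ → ℝ} {G : ℕ → ℝ} (hε : ε ≤ 1 / 124)
    (ha : |a| ≤ ε) (hb : |b| ≤ ε) (hK : |K| ≤ ε) (hσ : |σ| ≤ ε) (hm : m 0 0 = 1)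
    (hA2 : ∀ l, A 2 l = A 1 l) (hA3 : ∀ l, A 3 l = A 1 l) (hA4 : ∀ l, A 4 l = A 1 l)
    (hA3' : ∀ k, A k 3 = A k 1) (hA4' : ∀ k, A k 4 = A k 2) (hG : G 3 = G 1)
    (h : ∀ kl ∈ matchIdx, |A kl.1 kl.2 / (kl.1.factorial * kl.2.factorial)
      - sourceMoment a b K m kl.1 kl.2 - fluxMoment σ G kl.1 kl.2| ≤ ε) :
    (|A 0 0| ≤ 240 * ε ∧ |A 1 0 - 2| ≤ 240 * ε ∧ |A 0 1| ≤ 240 * ε ∧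
    |A 1 1| ≤ 240 * ε ∧ |A 0 2 - 2| ≤ 240 * ε ∧ |A 1 2 - 2 / 3| ≤ 240 * ε) ∧
    (|m 1 0 - 1 / 3| ≤ 240 * ε ∧ |m 0 1| ≤ 240 * ε ∧ |m 2 0 - 1 / 6| ≤ 240 * ε ∧
    |m 1 1| ≤ 240 * ε ∧ |m 0 2 - 1 / 6| ≤ 240 * ε) ∧
    |G 0 + 2| ≤ 240 * ε ∧ |G 1| ≤ 240 * ε ∧ |G 2| ≤ 240 * ε := by
  rw [forall_mem_matchIdx] at h
  obtain ⟨h00, h10, h01, h20, h11, h02, h30, h21, h12, h03, h40, h31, h22, h13, h04⟩ := h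
  simp [sourceMoment, taylorMomentTwo, fluxMoment, Nat.factorial, hm, hA2, hA3, hA3', hA4, hA4',
    hG] at h00 h10 h01 h20 h11 h02 h30 h21 h12 h03 h40 h31 h22 h13 h04
  rw [abs_le] at h00 h10 h01 h20 h11 h02 h30 h21 h12 h03 h40 h31 h22 h13 h04
  have hε0 : 0 ≤ ε := (abs_nonneg _).trans ha
  -- `Z` bounds all unknown moments of `β` and `γ`; the equations are solved one after the other
  -- up to multiples of `ε Z`, which in the end bounds `Z` itself
  set Z := 1 + |m 1 0| + |m 0 1| + |m 2 0| + |m 1 1| + |m 0 2| + |G 0| + |G 1| + |G 2| with hZ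
  have n1 := abs_nonneg (m 1 0)
  have n2 := abs_nonneg (m 0 1)
  have n3 := abs_nonneg (m 2 0)
  have n4 := abs_nonneg (m 1 1)
  have n5 := abs_nonneg (m 0 2)
  have n6 := abs_nonneg (G 0)
  have n7 := abs_nonneg (G 1)
  have n8 := abs_nonneg (G 2)
  have prod : ∀ c z : ℝ, |c| ≤ ε → |z| ≤ Z → -(ε * Z) ≤ c * z ∧ c * z ≤ ε * Z := by
    intro c z hc hz
    rw [← abs_le, abs_mul]
    exact mul_le_mul hc hz (abs_nonneg _) hε0
  have l1 : |m 1 0| ≤ Z := by linarith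
  have l2 : |m 0 1| ≤ Z := by linarith
  have l3 : |m 2 0| ≤ Z := by linarith
  have l4 : |m 1 1| ≤ Z := by linarith
  have l5 : |m 0 2| ≤ Z := by linarith
  have l6 : |G 0| ≤ Z := by linarith
  have l7 : |G 1| ≤ Z := by linarith
  have l8 : |G 2| ≤ Z := by linarith
  have hZ1 : 1 ≤ Z := by linarith
  have hεZ : ε ≤ ε * Z := le_mul_of_one_le_right hε0 hZ1
  have a1 := prod a _ ha l1
  have a2 := prod a _ ha l2
  have a3 := prod a _ ha l3
  have a4 := prod a _ ha l4
  have a5 := prod a _ ha l5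
  have b1 := prod b _ hb l1
  have b2 := prod b _ hb l2
  have b3 := prod b _ hb l3
  have b4 := prod b _ hb l4
  have b5 := prod b _ hb l5
  have c1 := prod K _ hK l1
  have c2 := prod K _ hK l2
  have c3 := prod K _ hK l3
  have c4 := prod K _ hK l4
  have c5 := prod K _ hK l5
  have s0 := prod σ _ hσ l6
  have s1 := prod σ _ hσ l7
  have s2 := prod σ _ hσ l8
  have hat := abs_le.1 ha
  have hbt := abs_le.1 hb
  have hKt := abs_le.1 hK
  set δ := ε * Z with hδ
  have A10 : |A 1 0 - 2| ≤ 5 * δ := abs_le.2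
    ⟨by linarith only [h20.1, a1.1, c3.1, hεZ], by linarith only [h20.2, a1.2, c3.2, hεZ]⟩
  have tA10 := abs_le.1 A10
  have g20 : |m 2 0 - 1 / 6| ≤ 3 * δ := abs_le.2
    ⟨by linarith only [h40.2, tA10.1, hεZ, hε0], by linarith only [h40.1, tA10.2, hεZ, hε0]⟩
  have t20 := abs_le.1 g20
  have g10 : |m 1 0 - 1 / 3| ≤ 3 * δ := abs_le.2
    ⟨by linarith only [h30.2, tA10.1, a3.2, hεZ, hε0],
      by linarith only [h30.1, tA10.2, a3.1, hεZ, hε0]⟩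
  have t10 := abs_le.1 g10
  have G1 : |G 1| ≤ 12 * δ := abs_le.2
    ⟨by linarith only [h31.2, h13.1, hεZ, hε0], by linarith only [h31.1, h13.2, hεZ, hε0]⟩
  have A02 : |A 0 2 - 2| ≤ 6 * δ := abs_le.2
    ⟨by linarith only [h02.1, b2.1, c5.1, s2.1, hεZ],
      by linarith only [h02.2, b2.2, c5.2, s2.2, hεZ]⟩
  have tA02 := abs_le.1 A02
  have g02 : |m 0 2 - 1 / 6| ≤ 3 * δ := abs_le.2
    ⟨by linarith only [h04.2, tA02.1, hεZ, hε0], by linarith only [h04.1, tA02.2, hεZ, hε0]⟩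
  have t02 := abs_le.1 g02
  have A01 : |A 0 1| ≤ 4 * δ := abs_le.2
    ⟨by linarith only [h01.1, hbt.1, c2.1, s1.1, hεZ],
      by linarith only [h01.2, hbt.2, c2.2, s1.2, hεZ]⟩
  have tA01 := abs_le.1 A01
  have g01 : |m 0 1| ≤ 3 * δ := abs_le.2
    ⟨by linarith only [h03.2, tA01.1, b5.2, s1.2, hεZ, hε0],
      by linarith only [h03.1, tA01.2, b5.1, s1.1, hεZ, hε0]⟩
  have t01 := abs_le.1 g01
  have A11 : |A 1 1| ≤ 11 * δ := abs_le.2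
    ⟨by linarith only [h21.1, t01.1, a4.1, b3.1, hεZ],
      by linarith only [h21.2, t01.2, a4.2, b3.2, hεZ]⟩
  have tA11 := abs_le.1 A11
  have g11 : |m 1 1| ≤ 3 * δ := abs_le.2
    ⟨by linarith only [h31.2, tA11.1, hεZ, hε0], by linarith only [h31.1, tA11.2, hεZ, hε0]⟩
  have A12 : |A 1 2 - 2 / 3| ≤ 16 * δ := abs_le.2
    ⟨by linarith only [h22.1, t20.1, t02.1, hεZ], by linarith only [h22.2, t20.2, t02.2, hεZ]⟩
  have tA12 := abs_le.1 A12
  have G2 : |G 2| ≤ 27 * δ := abs_le.2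
    ⟨by linarith only [h12.1, tA12.2, t10.1, a5.1, b4.1, hεZ],
      by linarith only [h12.2, tA12.1, t10.2, a5.2, b4.2, hεZ]⟩
  have G0 : |G 0 + 2| ≤ 8 * δ := abs_le.2
    ⟨by linarith only [h10.1, tA10.2, hat.1, c1.1, hεZ],
      by linarith only [h10.2, tA10.1, hat.2, c1.2, hεZ]⟩
  have A00 : |A 0 0| ≤ 3 * δ := abs_le.2
    ⟨by linarith only [h00.1, hKt.1, s0.1, hεZ], by linarith only [h00.2, hKt.2, s0.2, hεZ]⟩
  have shift : ∀ x c B : ℝ, |x - c| ≤ B → 0 ≤ c → |x| ≤ c + B := by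
    intro x c B hx hc
    rw [abs_le] at hx ⊢
    constructor <;> linarith [hx.1, hx.2]
  have hZ8 : Z ≤ 8 := by
    have e1 := shift _ _ _ g20 (by norm_num)
    have e2 := shift _ _ _ g02 (by norm_num)
    have e3 := shift _ _ _ g10 (by norm_num)
    have e4 : |G 0| ≤ 2 + 8 * δ := by
      rw [abs_le] at G0 ⊢
      constructor <;> linarith only [G0.1, G0.2]
    have : δ ≤ 1 / 124 * Z := mul_le_mul_of_nonneg_right hε (by linarith only [hZ1])
    linarith only [this, hZ, e1, e2, e3, e4, g01, g11, G1, G2]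
  have hδε : δ ≤ 8 * ε := by
    rw [hδ, mul_comm]; exact mul_le_mul_of_nonneg_right hZ8 hε0
  refine ⟨⟨A00.trans ?_, A10.trans ?_, A01.trans ?_, A11.trans ?_, A02.trans ?_, A12.trans ?_⟩,
    ⟨g10.trans ?_, g01.trans ?_, g20.trans ?_, g11.trans ?_, g02.trans ?_⟩,
    G0.trans ?_, G1.trans ?_, G2.trans ?_⟩ <;> linarith only [hδε, hε0]

/-! ### Bounds for the flux stencil -/

/-- The limit of the scaled flux coefficients `h² α`. -/
noncomputable def fluxLimit : Fin 2 → Fin 3 → ℝ :=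
  ![![2 / 3, -10 / 3, 2 / 3], ![1 / 3, 4 / 3, 1 / 3]]

theorem moment_fluxLimit (k : Fin 2) (l : Fin 3) : moment pos₂ pos₃ fluxLimit k l =
    (![![0, 0, 2], ![2, 0, 2 / 3]] : Fin 2 → Fin 3 → ℝ) k l := by
  fin_cases k <;> fin_cases l <;>
    simp [moment, Fin.sum_univ_two, Fin.sum_univ_three, fluxLimit, Matrix.cons_val] <;> norm_num

/-- The coefficients `α` of the flux stencil. -/
noncomputable def fluxAlpha (a b K σ h : ℝ) (i : Fin 2) (j : Fin 3) : ℝ :=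
  fluxStencil a b K σ h (.inl (i, j))

/-- The coefficients `β` of the flux stencil. -/
noncomputable def fluxBeta (a b K σ h : ℝ) (i j : Fin 3) : ℝ :=
  fluxStencil a b K σ h (.inr (.inl (i, j)))

/-- The coefficients `γ` of the flux stencil. -/
noncomputable def fluxGamma (a b K σ h : ℝ) (j : Fin 3) : ℝ :=
  fluxStencil a b K σ h (.inr (.inr j))

/-- What the analysis of the scheme uses about the flux stencil: small residuals (`row`), `h² α`
close to its limit (`abs_alpha`), bounded weights `β` and `h γ`, and the leading moments of `α`
(`low`). -/
structure FluxStencilBounds (a b K σ h C : ℝ) : Prop where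
  row : ∀ kl ∈ matchIdx, |∑ i, fluxRow a b K σ h kl i * fluxStencil a b K σ h i| ≤ C * h ^ 3
  abs_beta : ∀ i j, |fluxBeta a b K σ h i j| ≤ C
  abs_alpha : ∀ i j, |h ^ 2 * fluxAlpha a b K σ h i j - fluxLimit i j| ≤ C * h
  abs_gamma : ∀ j, |h * fluxGamma a b K σ h j| ≤ C
  low : moment pos₂ pos₃ (fluxAlpha a b K σ h) 0 0 ≤ C ∧
    |h ^ 2 * moment pos₂ pos₃ (fluxAlpha a b K σ h) 1 0 - 2| ≤ C * h ∧
    |h ^ 2 * moment pos₂ pos₃ (fluxAlpha a b K σ h) 0 1| ≤ C * h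

theorem fluxScale_mul_eq (a b K σ h : ℝ) :
    (fun i => fluxScale h i * fluxStencil a b K σ h i) =
      Sum.elim (Function.uncurry fun i j => h ^ 2 * fluxAlpha a b K σ h i j)
        (Sum.elim (Function.uncurry (fluxBeta a b K σ h))
          fun j => h * fluxGamma a b K σ h j) := by
  funext i
  rcases i with ⟨i, j⟩ | ⟨i, j⟩ | j <;> simp [fluxScale, fluxAlpha, fluxBeta, fluxGamma]

/-- The residuals do not exceed those of the competitor. The rows of order four carry two extra
powers of `h` when scaled back from step size one. -/
theorem abs_sum_fluxRow_fluxStencil_le {a b K σ h C₀ : ℝ} (hh : 0 < h)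
    (hsmall : 12 * C₀ * h ≤ 1) (hah : |a * h| ≤ C₀ * h) (hbh : |b * h| ≤ C₀ * h)
    (hKh : |K * h ^ 2| ≤ C₀ * h) (hσh : |σ * h| ≤ C₀ * h) {kl : ℕ × ℕ} (hkl : kl ∈ matchIdx) :
    |∑ i, fluxRow a b K σ h kl i * fluxStencil a b K σ h i| ≤ 4 * C₀ * h ^ 3 := by
  obtain ⟨α, β, γ, hβ, hrow⟩ := exists_flux_competitor (by linarith) hah hbh hKh hσh
  have hC : 0 ≤ C₀ * h := (abs_nonneg _).trans hah
  set y : FluxIdx → ℝ := Sum.elim (Function.uncurry fun i j => α i j / h ^ 2)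
    (Sum.elim (Function.uncurry β) fun j => γ j / h) with hy
  have hs : ∀ i, fluxScale h i * y i =
      Sum.elim (Function.uncurry α) (Sum.elim (Function.uncurry β) γ) i := by
    rintro (⟨i, j⟩ | ⟨i, j⟩ | j)
    · simp [fluxScale, hy]; field_simp
    · simp [fluxScale, hy]
    · simp [fluxScale, hy]; field_simp
  have hyrow : ∀ kl ∈ matchIdx, |∑ i, fluxRow a b K σ h kl i * y i| ≤ C₀ * h ^ 3 := by
    intro kl hkl
    obtain ⟨r1, r2⟩ := hrow kl hkl
    have h1 := sum_fluxRow_scale a b K σ h kl y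
    simp only [hs] at h1
    rcases lt_or_ge (kl.1 + kl.2) 4 with h4 | h4
    · rw [r2 h4, mul_zero] at h1
      rw [(mul_eq_zero.1 h1).resolve_left (by positivity), abs_zero]
      have : C₀ * h ^ 3 = C₀ * h * h ^ 2 := by ring
      rw [this]; positivity
    · have h5 : kl.1 + kl.2 = 4 := le_antisymm (Finset.mem_filter.1 hkl).2 h4
      rw [h5] at h1
      have h2 : (∑ i, fluxRow a b K σ h kl i * y i) = h ^ 2 *
          ∑ i, fluxRow (a * h) (b * h) (K * h ^ 2) (σ * h) 1 kl i
            * Sum.elim (Function.uncurry α) (Sum.elim (Function.uncurry β) γ) i :=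
        mul_left_cancel₀ (by positivity : h ^ 2 ≠ 0) (by rw [h1]; ring)
      rw [h2, abs_mul, abs_of_pos (by positivity : 0 < h ^ 2)]
      calc h ^ 2 * _ ≤ h ^ 2 * (C₀ * h) := by gcongr
        _ = C₀ * h ^ 3 := by ring
  have hynorm : ∑ i, fluxNorm i * y i = 1 := by
    simp only [Fintype.sum_sum_type, Fintype.sum_prod_type, fluxNorm, hy]
    simpa [moment] using hβ
  have h0 : sqResidual (fluxRow a b K σ h) y ≤ (4 * (C₀ * h ^ 3)) ^ 2 := by
    calc sqResidual (fluxRow a b K σ h) y ≤ ∑ kl ∈ matchIdx, (C₀ * h ^ 3) ^ 2 :=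
          Finset.sum_le_sum fun kl hkl => by
            rw [← sq_abs]; exact pow_le_pow_left₀ (abs_nonneg _) (hyrow kl hkl) 2
      _ = 15 * (C₀ * h ^ 3) ^ 2 := by
          rw [Finset.sum_const, show matchIdx.card = 15 by decide]; simp
      _ ≤ (4 * (C₀ * h ^ 3)) ^ 2 := by nlinarith [sq_nonneg (C₀ * h ^ 3)]
  have h3 : C₀ * h ^ 3 = C₀ * h * h ^ 2 := by ring
  have := abs_le_of_sq_le_sq (((fluxStencil_spec a b K σ h).sq_row_le hynorm hkl).trans h0)
    (by rw [h3]; positivity)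
  calc _ ≤ 4 * (C₀ * h ^ 3) := this
    _ = 4 * C₀ * h ^ 3 := by ring

theorem fluxBeta_orthogonal (a b K σ : ℝ) {h : ℝ} (hh : 0 < h) (Z : Fin 3 → Fin 3 → ℝ)
    (hZ : ∀ k l, k + l ≤ 2 → moment pos₃ pos₃ Z k l = 0) :
    ∑ i, ∑ j, fluxBeta a b K σ h i j * Z i j = 0 := by
  set z : FluxIdx → ℝ := Sum.elim (Function.uncurry fun _ _ => 0)
    (Sum.elim (Function.uncurry Z) fun _ => 0) with hz
  have hs : ∀ i, fluxScale h i * z i = z i := by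
    rintro (⟨i, j⟩ | ⟨i, j⟩ | j) <;> simp [fluxScale, hz]
  have h1 := (fluxStencil_spec a b K σ h).sum_mul_eq_zero (z := z) (by
      simp only [Fintype.sum_sum_type, Fintype.sum_prod_type, fluxNorm, hz]
      simpa [moment] using hZ 0 0 (by norm_num)) (by
      rintro ⟨k, l⟩ _
      have h1 := sum_fluxRow_scale a b K σ h (k, l) z
      simp only [hs] at h1
      rw [hz, sum_fluxRow, sourceMoment_eq_zero hZ] at h1
      simp [moment, fluxMoment, moment₁] at h1
      simpa [hh.ne', hz] using h1)
  simpa [Fintype.sum_sum_type, Fintype.sum_prod_type, hz, fluxBeta] using h1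

/-- Here the signs of `K` and `σ` matter: they give the one-sided bound for the sum of the `α`. -/
theorem fluxStencilBounds {a b K σ h C₀ : ℝ} (hK : K ≤ 0) (hσ : 0 ≤ σ) (hC₀ : 1 ≤ C₀)
    (ha : |a| ≤ C₀) (hb : |b| ≤ C₀) (hKC : |K| ≤ C₀) (hσC : |σ| ≤ C₀) (hh : 0 < h)
    (hsmall : 6000 * C₀ * h ≤ 1) : FluxStencilBounds a b K σ h (6000 * C₀) := by
  have h1 : h ≤ 1 := by nlinarith
  have scale : ∀ c : ℝ, |c| ≤ C₀ → |c * h| ≤ C₀ * h := by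
    intro c hc
    rw [abs_mul, abs_of_pos hh]; exact mul_le_mul_of_nonneg_right hc hh.le
  have hKh : |K * h ^ 2| ≤ C₀ * h := by
    rw [abs_mul, abs_of_pos (by positivity : 0 < h ^ 2)]
    exact mul_le_mul hKC (by nlinarith) (by positivity) (by positivity)
  have hrow := fun kl hkl => abs_sum_fluxRow_fluxStencil_le hh
    (by nlinarith) (scale a ha) (scale b hb) hKh (scale σ hσC) (kl := kl) hkl
  -- the factor `4` comes from the residuals: scaled to step size one they are at most `ε`
  set ε := 4 * C₀ * h with hε
  have hε0 : 0 ≤ ε := by positivity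
  have hε' : ε ≤ 1 / 1500 := by linarith
  have hle : C₀ * h ≤ ε := by rw [hε]; nlinarith
  set α := fluxAlpha a b K σ h with hα
  set β := fluxBeta a b K σ h with hβ
  set γ := fluxGamma a b K σ h with hγ
  set α' : Fin 2 → Fin 3 → ℝ := fun i j => h ^ 2 * α i j with hα'
  set γ' : Fin 3 → ℝ := fun j => h * γ j with hγ'
  have hnorm : moment pos₃ pos₃ β 0 0 = 1 := by
    have := (fluxStencil_spec a b K σ h).1
    simpa [Fintype.sum_sum_type, Fintype.sum_prod_type, fluxNorm, moment, hβ, fluxBeta]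
      using this
  have hscaled : ∀ k l : ℕ, h ^ 2 * ∑ i, fluxRow a b K σ h (k, l) i * fluxStencil a b K σ h i =
      h ^ (k + l) * (moment pos₂ pos₃ α' k l / (k.factorial * l.factorial)
        - sourceMoment (a * h) (b * h) (K * h ^ 2) (moment pos₃ pos₃ β) k l
        - fluxMoment (σ * h) (moment₁ pos₃ γ') k l) := by
    intro k l
    have e := sum_fluxRow_scale a b K σ h (k, l) (fluxStencil a b K σ h)
    have h2 : ∀ i, fluxScale h i * fluxStencil a b K σ h i = _ :=
      congrFun (fluxScale_mul_eq a b K σ h)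
    simp only [h2] at e
    rwa [sum_fluxRow] at e
  have hrow' : ∀ kl ∈ matchIdx, |moment pos₂ pos₃ α' kl.1 kl.2
      / (kl.1.factorial * kl.2.factorial)
      - sourceMoment (a * h) (b * h) (K * h ^ 2) (moment pos₃ pos₃ β) kl.1 kl.2
      - fluxMoment (σ * h) (moment₁ pos₃ γ') kl.1 kl.2| ≤ ε := by
    rintro ⟨k, l⟩ hkl
    have h4 : k + l ≤ 4 := (Finset.mem_filter.1 hkl).2
    have e := congrArg abs (hscaled k l)
    rw [abs_mul, abs_mul, abs_of_pos (by positivity : 0 < h ^ 2),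
      abs_of_pos (by positivity : 0 < h ^ (k + l))] at e
    refine le_of_mul_le_mul_left ?_ (by positivity : 0 < h ^ 4)
    calc h ^ 4 * _ ≤ h ^ (k + l) * _ :=
          mul_le_mul_of_nonneg_right (pow_le_pow_of_le_one hh.le h1 h4) (abs_nonneg _)
      _ = h ^ 2 * |∑ i, fluxRow a b K σ h (k, l) i * fluxStencil a b K σ h i| := e.symm
      _ ≤ h ^ 2 * (4 * C₀ * h ^ 3) := by gcongr; exact hrow _ hkl
      _ = h ^ 4 * ε := by rw [hε]; ring
  obtain ⟨⟨A00, A10, A01, A11, A02, A12⟩, ⟨m10, m01, m20, m11, m02⟩, G0, G1, G2⟩ :=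
    flux_moment_bounds (by linarith) ((scale a ha).trans hle) ((scale b hb).trans hle)
      (hKh.trans hle) ((scale σ hσC).trans hle) hnorm
      (fun l => moment_fst_reduce₂ _ _ 0 l) (fun l => by
        rw [moment_fst_reduce₂ _ _ 1 l, moment_fst_reduce₂ _ _ 0 l]) (fun l => by
        rw [moment_fst_reduce₂ _ _ 2 l, moment_fst_reduce₂ _ _ 1 l, moment_fst_reduce₂ _ _ 0 l])
      (fun k => moment_snd_reduce _ _ k 0) (fun k => moment_snd_reduce _ _ k 1)
      (moment₁_reduce γ') hrow'
  have orth := fluxBeta_orthogonal a b K σ hh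
  have eε : 6000 * C₀ * h = 1500 * ε := by rw [hε]; ring
  refine ⟨?_, ?_, ?_, ?_, ?_⟩
  · intro kl hkl
    exact (hrow kl hkl).trans (mul_le_mul_of_nonneg_right (by linarith) (by positivity))
  · intro i j
    refine (abs_le_of_moment_le orth (B := 1) ?_ i j).trans (by linarith)
    intro k l hkl
    rw [abs_le] at m10 m01 m20 m11 m02
    have hk : k ≤ 2 := by omega
    have hl : l ≤ 2 := by omega
    rw [← hβ]
    interval_cases k <;> interval_cases l <;> first | omega | skip
    · rw [hnorm]; norm_num
    · exact abs_le.2 ⟨by linarith only [m01.1, hε'], by linarith only [m01.2, hε']⟩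
    · exact abs_le.2 ⟨by linarith only [m02.1, hε'], by linarith only [m02.2, hε']⟩
    · exact abs_le.2 ⟨by linarith only [m10.1, hε'], by linarith only [m10.2, hε']⟩
    · exact abs_le.2 ⟨by linarith only [m11.1, hε'], by linarith only [m11.2, hε']⟩
    · exact abs_le.2 ⟨by linarith only [m20.1, hε'], by linarith only [m20.2, hε']⟩
  · intro i j
    have key : ∀ (k : Fin 2) (l : Fin 3),
        |moment pos₂ pos₃ α' k l - moment pos₂ pos₃ fluxLimit k l| ≤ 240 * ε := by
      intro k l
      rw [moment_fluxLimit]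
      fin_cases k <;> fin_cases l <;> simpa [Matrix.cons_val]
    have := abs_ofMoments_sub_le abs_lagrange₂_le abs_lagrange₃_le key i j
    rw [ofMoments_moment sum_lagrange₂_mul sum_lagrange₃_mul,
      ofMoments_moment sum_lagrange₂_mul sum_lagrange₃_mul] at this
    rw [eε]
    refine this.trans ?_
    push_cast
    linarith
  · have e0 : moment₁ pos₃ γ' 0 = γ' 0 + γ' 1 + γ' 2 := by simp [moment₁, Fin.sum_univ_three]
    have e1 : moment₁ pos₃ γ' 1 = -γ' 0 + γ' 2 := by simp [moment₁, Fin.sum_univ_three]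
    have e2 : moment₁ pos₃ γ' 2 = γ' 0 + γ' 2 := by simp [moment₁, Fin.sum_univ_three]
    rw [abs_le, e0] at G0
    rw [abs_le, e1] at G1
    rw [abs_le, e2] at G2
    intro j
    change |γ' j| ≤ _
    fin_cases j
    · exact abs_le.2 ⟨by simp only [Fin.zero_eta]; linarith, by simp only [Fin.zero_eta]; linarith⟩
    · exact abs_le.2 ⟨by simp only [Fin.mk_one]; linarith, by simp only [Fin.mk_one]; linarith⟩
    · exact abs_le.2 ⟨by simp only [Fin.reduceFinMk]; linarith,
        by simp only [Fin.reduceFinMk]; linarith⟩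
  · simp only [hα', moment_const_mul] at A10 A01
    rw [eε]
    refine ⟨?_, A10.trans (by linarith), A01.trans (by linarith)⟩
    -- the equation `(0, 0)` reads `h² A₀₀ = K h² + (σ h) G₀ + O(h⁵)` with `G₀` near `-2`; the signs
    -- of `K` and `σ` make the first two terms nonpositive
    have e := hscaled 0 0
    have r := (abs_le.1 (hrow (0, 0) (by decide))).2
    simp [sourceMoment, taylorMomentTwo, fluxMoment, hnorm] at e
    simp only [hα', moment_const_mul] at e
    have hG : σ * h * moment₁ pos₃ γ' 0 ≤ 0 :=
      mul_nonpos_of_nonneg_of_nonpos (by positivity) (by linarith [(abs_le.1 G0).2])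
    have hK2 : K * h ^ 2 ≤ 0 := mul_nonpos_of_nonpos_of_nonneg hK (by positivity)
    refine le_of_mul_le_mul_left ?_ (by positivity : 0 < h ^ 2)
    have h3 : 4 * C₀ * h ^ 3 ≤ 4 * C₀ := by
      have : h ^ 3 ≤ 1 := pow_le_one₀ hh.le h1
      nlinarith
    have : h ^ 2 * (∑ i, fluxRow a b K σ h (0, 0) i * fluxStencil a b K σ h i) ≤
        h ^ 2 * (6000 * C₀) := by
      refine mul_le_mul_of_nonneg_left (r.trans (h3.trans (by linarith))) (by positivity)
    simp only [Fintype.sum_sum_type] at this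
    linarith

/-! ### Truncation errors -/

theorem abs_sum_sum_mul_le {m n : ℕ} {x y : Fin m → Fin n → ℝ} {X Y : ℝ} (hX : 0 ≤ X)
    (hx : ∀ i j, |x i j| ≤ X) (hy : ∀ i j, |y i j| ≤ Y) :
    |∑ i, ∑ j, x i j * y i j| ≤ m * n * (X * Y) := by
  calc |∑ i, ∑ j, x i j * y i j| ≤ ∑ i, ∑ j, |x i j * y i j| :=
        (Finset.abs_sum_le_sum_abs _ _).trans
          (Finset.sum_le_sum fun i _ => Finset.abs_sum_le_sum_abs _ _)
    _ ≤ ∑ _i : Fin m, ∑ _j : Fin n, X * Y := by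
        refine Finset.sum_le_sum fun i _ => Finset.sum_le_sum fun j _ => ?_
        rw [abs_mul]
        exact mul_le_mul (hx i j) (hy i j) (abs_nonneg _) hX
    _ = m * n * (X * Y) := by simp; ring

/-- The jet of `Δu + a uₓ + b uᵧ + K u` in terms of the jet of `u`. -/
def sourceJet (a b K : ℝ) (W : ℕ → ℕ → ℝ × ℝ → ℝ) (k l : ℕ) (p : ℝ × ℝ) : ℝ :=
  W (k + 2) l p + W k (l + 2) p + a * W (k + 1) l p + b * W k (l + 1) p + K * W k l p

theorem IsJet.sourceJet {R : Set (ℝ × ℝ)} {ν τ : ℝ × ℝ} {n : ℕ} {W : ℕ → ℕ → ℝ × ℝ → ℝ}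
    (hW : IsJet R ν τ (n + 2) W) (a b K : ℝ) : IsJet R ν τ n (sourceJet a b K W) :=
  ((((hW.shift 2 0 n le_rfl).add (hW.shift 0 2 n le_rfl)).add
    ((hW.shift 1 0 n (by omega)).const_mul a)).add
    ((hW.shift 0 1 n (by omega)).const_mul b)).add ((hW.shift 0 0 n (by omega)).const_mul K)

theorem abs_sourceJet_le {a b K D : ℝ} {W : ℕ → ℕ → ℝ × ℝ → ℝ} {k l : ℕ} {z : ℝ × ℝ}
    (h : ∀ i j, k + l ≤ i + j → i + j ≤ k + l + 2 → |W i j z| ≤ D) :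
    |sourceJet a b K W k l z| ≤ (2 + |a| + |b| + |K|) * D := by
  have h1 := h (k + 2) l (by omega) (by omega)
  have h2 := h k (l + 2) (by omega) (by omega)
  have h3 : |a * W (k + 1) l z| ≤ |a| * D := by
    rw [abs_mul]; exact mul_le_mul_of_nonneg_left (h _ _ (by omega) (by omega)) (abs_nonneg _)
  have h4 : |b * W k (l + 1) z| ≤ |b| * D := by
    rw [abs_mul]; exact mul_le_mul_of_nonneg_left (h _ _ (by omega) (by omega)) (abs_nonneg _)
  have h5 : |K * W k l z| ≤ |K| * D := by
    rw [abs_mul]; exact mul_le_mul_of_nonneg_left (h _ _ (by omega) (by omega)) (abs_nonneg _)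
  rw [abs_le] at *
  simp only [_root_.sourceJet]
  constructor <;> linarith [h1.1, h1.2, h2.1, h2.2, h3.1, h3.2, h4.1, h4.2, h5.1, h5.2]

/-- The jet of `-∂_ν u + σ u` in terms of the jet of `u`. -/
def fluxJet (σ : ℝ) (W : ℕ → ℕ → ℝ × ℝ → ℝ) (k l : ℕ) (p : ℝ × ℝ) : ℝ :=
  -1 * W (k + 1) l p + σ * W k l p

theorem IsJet.fluxJet {R : Set (ℝ × ℝ)} {ν τ : ℝ × ℝ} {n : ℕ} {W : ℕ → ℕ → ℝ × ℝ → ℝ}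
    (hW : IsJet R ν τ (n + 1) W) (σ : ℝ) : IsJet R ν τ n (fluxJet σ W) :=
  ((hW.shift 1 0 n le_rfl).const_mul (-1)).add ((hW.shift 0 0 n (by omega)).const_mul σ)

theorem abs_fluxJet_le {σ D : ℝ} {W : ℕ → ℕ → ℝ × ℝ → ℝ} {k l : ℕ} {z : ℝ × ℝ}
    (h : ∀ i j, k + l ≤ i + j → i + j ≤ k + l + 1 → |W i j z| ≤ D) :
    |fluxJet σ W k l z| ≤ (1 + |σ|) * D := by
  have h1 := h (k + 1) l (by omega) (by omega)
  have h5 : |σ * W k l z| ≤ |σ| * D := by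
    rw [abs_mul]; exact mul_le_mul_of_nonneg_left (h _ _ (by omega) (by omega)) (abs_nonneg _)
  rw [abs_le] at *
  simp only [_root_.fluxJet]
  constructor <;> linarith [h1.1, h1.2, h5.1, h5.2]

theorem sum_matchIdx (f : ℕ × ℕ → ℝ) : ∑ kl ∈ matchIdx, f kl =
    f (0, 0) + f (1, 0) + f (0, 1) + f (2, 0) + f (1, 1) + f (0, 2) + f (3, 0) + f (2, 1)
      + f (1, 2) + f (0, 3) + f (4, 0) + f (3, 1) + f (2, 2) + f (1, 3) + f (0, 4) := by
  have : matchIdx = {(0, 0), (1, 0), (0, 1), (2, 0), (1, 1), (0, 2), (3, 0), (2, 1), (1, 2),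
      (0, 3), (4, 0), (3, 1), (2, 2), (1, 3), (0, 4)} := by decide
  rw [this]
  simp [Finset.sum_insert]
  ring

/-- The Taylor polynomial of degree less than `m` of a jet. -/
noncomputable def taylorSum (m : ℕ) (W : ℕ → ℕ → ℝ × ℝ → ℝ) (p : ℝ × ℝ) (ξ η : ℝ) : ℝ :=
  ∑ n ∈ Finset.range m, (jetStep ξ η)^[n] W 0 0 p / n.factorial

theorem sum_taylorCoeff_mul_jet (W : ℕ → ℕ → ℝ × ℝ → ℝ) (p : ℝ × ℝ) (ξ η : ℝ) :
    ∑ kl ∈ matchIdx, taylorCoeff kl.1 kl.2 ξ η * W kl.1 kl.2 p = taylorSum 5 W p ξ η := by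
  rw [sum_matchIdx]
  simp [taylorSum, Finset.sum_range_succ, jetStep, taylorCoeff, Nat.factorial]
  ring

theorem sum_sourceCoeff_mul_jet (a b K : ℝ) (W : ℕ → ℕ → ℝ × ℝ → ℝ) (p : ℝ × ℝ) (ξ η : ℝ) :
    ∑ kl ∈ matchIdx, sourceCoeff a b K kl.1 kl.2 ξ η * W kl.1 kl.2 p =
      taylorSum 3 (sourceJet a b K W) p ξ η := by
  rw [sum_matchIdx]
  simp [taylorSum, Finset.sum_range_succ, jetStep, sourceCoeff, taylorCoeffTwo, taylorCoeff,
    Nat.factorial, sourceJet]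
  ring

theorem sum_fluxCoeff_mul_jet (σ : ℝ) (W : ℕ → ℕ → ℝ × ℝ → ℝ) (p : ℝ × ℝ) (η : ℝ) :
    ∑ kl ∈ matchIdx, fluxCoeff σ kl.1 kl.2 η * W kl.1 kl.2 p =
      taylorSum 4 (fluxJet σ W) p 0 η := by
  rw [sum_matchIdx]
  simp [taylorSum, Finset.sum_range_succ, jetStep, fluxCoeff, taylorCoeff,
    Nat.factorial, fluxJet]
  ring

theorem taylorSum_six (W : ℕ → ℕ → ℝ × ℝ → ℝ) (p : ℝ × ℝ) (ξ η h : ℝ) :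
    taylorSum 6 W p (ξ * h) (η * h) = taylorSum 5 W p (ξ * h) (η * h) + h ^ 5 *
      (W 5 0 p / 120 * (ξ ^ 5 * η ^ 0) + W 4 1 p / 24 * (ξ ^ 4 * η ^ 1)
        + W 3 2 p / 12 * (ξ ^ 3 * η ^ 2) + W 2 3 p / 12 * (ξ ^ 2 * η ^ 3)
        + W 1 4 p / 24 * (ξ ^ 1 * η ^ 4) + W 0 5 p / 120 * (ξ ^ 0 * η ^ 5)) := by
  rw [taylorSum, Finset.sum_range_succ, ← taylorSum]
  simp [jetStep, Nat.factorial]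
  ring

theorem taylorSum_four (W : ℕ → ℕ → ℝ × ℝ → ℝ) (p : ℝ × ℝ) (ξ η h : ℝ) :
    taylorSum 4 W p (ξ * h) (η * h) = taylorSum 3 W p (ξ * h) (η * h) + h ^ 3 *
      (W 3 0 p / 6 * (ξ ^ 3 * η ^ 0) + W 2 1 p / 2 * (ξ ^ 2 * η ^ 1)
        + W 1 2 p / 2 * (ξ ^ 1 * η ^ 2) + W 0 3 p / 6 * (ξ ^ 0 * η ^ 3)) := by
  rw [taylorSum, Finset.sum_range_succ, ← taylorSum]
  simp [jetStep, Nat.factorial]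
  ring

/-- Quadratic extrapolation reproduces quadratic polynomials. -/
theorem taylorSum_three_extrapolate (W : ℕ → ℕ → ℝ × ℝ → ℝ) (p : ℝ × ℝ) (η h : ℝ) :
    taylorSum 3 W p (-1 * h) η =
      3 * taylorSum 3 W p (0 * h) η - 3 * taylorSum 3 W p (1 * h) η
        + taylorSum 3 W p (2 * h) η := by
  simp [taylorSum, Finset.sum_range_succ, jetStep, Nat.factorial]
  ring

theorem sum_mul_sum_row {ι : Type} [Fintype ι] (A : ℕ × ℕ → ι → ℝ) (x : ι → ℝ)
    (w : ℕ × ℕ → ℝ) : ∑ i, x i * ∑ kl ∈ matchIdx, A kl i * w kl =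
      ∑ kl ∈ matchIdx, (∑ i, A kl i * x i) * w kl := by
  simp only [Finset.mul_sum, Finset.sum_mul]
  rw [Finset.sum_comm]
  exact Finset.sum_congr rfl fun kl _ => Finset.sum_congr rfl fun i _ => by ring

theorem abs_pos₃_le (i : Fin 3) : |pos₃ i| ≤ 1 := by
  fin_cases i <;> simp [pos₃, off]

theorem abs_pos₂_le (i : Fin 2) : |pos₂ i| ≤ 1 := by
  fin_cases i <;> simp [pos₂]

theorem abs_moment_sub_le {m n : ℕ} {ξ : Fin m → ℝ} {η : Fin n → ℝ} (hξ : ∀ i, |ξ i| ≤ 1)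
    (hη : ∀ j, |η j| ≤ 1) {c d : Fin m → Fin n → ℝ} {ε : ℝ} (hε : 0 ≤ ε)
    (h : ∀ i j, |c i j - d i j| ≤ ε) (k l : ℕ) :
    |moment ξ η c k l - moment ξ η d k l| ≤ m * n * ε := by
  have e : moment ξ η c k l - moment ξ η d k l =
      ∑ i, ∑ j, (c i j - d i j) * (ξ i ^ k * η j ^ l) := by
    simp only [moment, ← Finset.sum_sub_distrib, sub_mul]
  rw [e]
  refine (abs_sum_sum_mul_le (Y := 1) hε h fun i j => ?_).trans (by rw [mul_one])
  rw [abs_mul, abs_pow, abs_pow]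
  exact mul_le_one₀ (pow_le_one₀ (abs_nonneg _) (hξ i)) (by positivity)
    (pow_le_one₀ (abs_nonneg _) (hη j))

theorem abs_interiorLimit_le (i j : Fin 3) : |interiorLimit i j| ≤ 4 := by
  fin_cases i <;> fin_cases j <;> simp [interiorLimit, Matrix.cons_val, abs_le] <;> norm_num

theorem abs_fluxLimit_le (i : Fin 2) (j : Fin 3) : |fluxLimit i j| ≤ 4 := by
  fin_cases i <;> fin_cases j <;> simp [fluxLimit, Matrix.cons_val, abs_le] <;> norm_num

theorem abs_le_div_sq_of_scaled {h x l C : ℝ} (hh : 0 < h) (hCh : C * h ≤ 1) (hl : |l| ≤ 4)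
    (hx : |h ^ 2 * x - l| ≤ C * h) : |x| ≤ 5 / h ^ 2 := by
  rw [le_div_iff₀ (by positivity), mul_comm]
  calc h ^ 2 * |x| = |(h ^ 2 * x - l) + l| := by
        rw [sub_add_cancel, abs_mul, abs_of_pos (by positivity : 0 < h ^ 2)]
    _ ≤ |h ^ 2 * x - l| + |l| := abs_add_le _ _
    _ ≤ 5 := by linarith

theorem abs_add_abs_pos₃_mul_le (i j : Fin 3) {h : ℝ} (hh : 0 < h) :
    |pos₃ i * h| + |pos₃ j * h| ≤ 2 * h := by
  rw [abs_mul, abs_mul, abs_of_pos hh]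
  nlinarith [abs_pos₃_le i, abs_pos₃_le j]

/-- The rows of the interior system collect the Taylor polynomials of `u` and of the source. -/
theorem sum_interiorStencil_taylor (a b K h : ℝ) (W : ℕ → ℕ → ℝ × ℝ → ℝ) (p : ℝ × ℝ) :
    ∑ i, ∑ j, interiorAlpha a b K h i j * taylorSum 5 W p (pos₃ i * h) (pos₃ j * h)
      - ∑ i, ∑ j, interiorBeta a b K h i j
        * taylorSum 3 (sourceJet a b K W) p (pos₃ i * h) (pos₃ j * h) =
    ∑ kl ∈ matchIdx, (∑ i, interiorRow a b K h kl i * interiorStencil a b K h i)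
      * W kl.1 kl.2 p := by
  rw [← sum_mul_sum_row, Fintype.sum_sum_type, Fintype.sum_prod_type, Fintype.sum_prod_type,
    sub_eq_add_neg, ← Finset.sum_neg_distrib]
  congr 1
  · refine Finset.sum_congr rfl fun i _ => Finset.sum_congr rfl fun j _ => ?_
    rw [← sum_taylorCoeff_mul_jet]; rfl
  · refine Finset.sum_congr rfl fun i _ => ?_
    rw [← Finset.sum_neg_distrib]
    refine Finset.sum_congr rfl fun j _ => ?_
    rw [← sum_sourceCoeff_mul_jet, ← mul_neg, ← Finset.sum_neg_distrib]
    congr 1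
    refine Finset.sum_congr rfl fun kl _ => ?_
    simp only [interiorRow, pos₃]; ring

/-- The truncation error in the interior. The fifteen equations remove the Taylor terms of `u` up
to order four. The terms of order five, and those of order three of the source, meet weights
whose odd moments are smaller by one power of `h`. -/
theorem abs_interior_truncation_le {a b K h C : ℝ} (hS : InteriorStencilBounds a b K h C)
    (hh : 0 < h) (hC : 0 ≤ C) (hCh : C * h ≤ 1) {R : Set (ℝ × ℝ)} (hR : Convex ℝ R)
    {ν τ : ℝ × ℝ} {W : ℕ → ℕ → ℝ × ℝ → ℝ} (hW : IsJet R ν τ 6 W) {D : ℝ}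
    (hD : ∀ k l, 3 ≤ k + l → k + l ≤ 6 → ∀ z ∈ R, |W k l z| ≤ D) {p : ℝ × ℝ} (hp : p ∈ R)
    {q : Fin 3 → Fin 3 → ℝ × ℝ} (hqR : ∀ i j, q i j ∈ R)
    (hq : ∀ i j, q i j = p + ((pos₃ i * h) • ν + (pos₃ j * h) • τ)) :
    |∑ i, ∑ j, interiorAlpha a b K h i j * W 0 0 (q i j)
      - ∑ i, ∑ j, interiorBeta a b K h i j * sourceJet a b K W 0 0 (q i j)|
      ≤ (2880 + 54 * C + 148 * C * (2 + |a| + |b| + |K|)) * D * h ^ 4 := by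
  set c := 2 + |a| + |b| + |K| with hc
  have hc0 : 0 ≤ c := by positivity
  have hD0 : 0 ≤ D := (abs_nonneg _).trans (hD 3 0 (by norm_num) (by norm_num) p hp)
  set F := sourceJet a b K W with hF
  have hFJ : IsJet R ν τ 4 F := hW.sourceJet a b K
  have hFD : ∀ k l, 3 ≤ k + l → k + l ≤ 4 → ∀ z ∈ R, |F k l z| ≤ c * D := fun k l h3 h4 z hz =>
    abs_sourceJet_le fun i j h1 h2 => hD i j (by omega) (by omega) z hz
  set α := interiorAlpha a b K h with hα
  set β := interiorBeta a b K h with hβ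
  set x : Fin 3 → ℝ := fun i => pos₃ i * h with hx
  have small := fun i j => abs_add_abs_pos₃_mul_le i j hh
  have hα5 : ∀ i j, |α i j| ≤ 5 / h ^ 2 := fun i j =>
    abs_le_div_sq_of_scaled hh hCh (abs_interiorLimit_le i j) (hS.abs_alpha i j)
  -- the remainders of the two Taylor expansions
  have ru : ∀ i j, |W 0 0 (q i j) - taylorSum 6 W p (x i) (x j)| ≤ D * (2 * h) ^ 6 := by
    intro i j
    refine (hW.abs_sub_taylor_le hR 6 hp (hqR i j) (hq i j)
      (fun k l hkl => hD k l (by omega) (by omega))).trans ?_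
    exact mul_le_mul_of_nonneg_left (pow_le_pow_left₀ (by positivity) (small i j) 6) hD0
  have rf : ∀ i j, |F 0 0 (q i j) - taylorSum 4 F p (x i) (x j)| ≤ c * D * (2 * h) ^ 4 := by
    intro i j
    refine (hFJ.abs_sub_taylor_le hR 4 hp (hqR i j) (hq i j)
      (fun k l hkl => hFD k l (by omega) (by omega))).trans ?_
    exact mul_le_mul_of_nonneg_left (pow_le_pow_left₀ (by positivity) (small i j) 4)
      (by positivity)
  have e1 := abs_sum_sum_mul_le (by positivity) hα5 ru
  have e2 : |∑ i, ∑ j, β i j * (F 0 0 (q i j) - taylorSum 4 F p (x i) (x j))| ≤ _ :=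
    abs_sum_sum_mul_le hC hS.abs_beta rf
  -- the odd moments of `h² α`: those of the limit vanish
  have oddA : ∀ k l : ℕ, moment pos₃ pos₃ interiorLimit k l = 0 →
      h ^ 2 * |moment pos₃ pos₃ α k l| ≤ 9 * (C * h) := by
    intro k l hkl
    have := abs_moment_sub_le abs_pos₃_le abs_pos₃_le (by positivity) hS.abs_alpha k l
    rw [hkl, sub_zero, moment_const_mul, abs_mul, abs_of_pos (by positivity : 0 < h ^ 2)] at this
    norm_num at this
    exact this
  have A10 := oddA 1 0 (by simpa [Matrix.cons_val] using moment_interiorLimit 1 0)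
  have A01 := oddA 0 1 (by simpa [Matrix.cons_val] using moment_interiorLimit 0 1)
  have A21 := oddA 2 1 (by simpa [Matrix.cons_val] using moment_interiorLimit 2 1)
  have A12 := oddA 1 2 (by simpa [Matrix.cons_val] using moment_interiorLimit 1 2)
  obtain ⟨B10, B01, B21, B12⟩ := hS.odd
  rw [← hβ] at B10 B01 B21 B12
  have term : ∀ w y B Y n : ℝ, |w| ≤ B → |y| ≤ Y → 1 ≤ n → |w / n * y| ≤ B * Y := by
    intro w y B Y n hw hy hn
    rw [abs_mul, abs_div]
    have : |w| / |n| ≤ |w| := div_le_self (abs_nonneg _) (hn.trans (le_abs_self _))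
    exact mul_le_mul (this.trans hw) hy (abs_nonneg _) ((abs_nonneg _).trans hw)
  have e3 : |∑ i, ∑ j, α i j * taylorSum 6 W p (x i) (x j)
      - ∑ i, ∑ j, α i j * taylorSum 5 W p (x i) (x j)| ≤ 54 * C * D * h ^ 4 := by
    have eq : ∑ i, ∑ j, α i j * taylorSum 6 W p (x i) (x j)
        - ∑ i, ∑ j, α i j * taylorSum 5 W p (x i) (x j) = h ^ 5 *
        (W 5 0 p / 120 * moment pos₃ pos₃ α 1 0 + W 4 1 p / 24 * moment pos₃ pos₃ α 2 1
        + W 3 2 p / 12 * moment pos₃ pos₃ α 1 2 + W 2 3 p / 12 * moment pos₃ pos₃ α 2 1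
        + W 1 4 p / 24 * moment pos₃ pos₃ α 1 2 + W 0 5 p / 120 * moment pos₃ pos₃ α 0 1) := by
      have e50 : moment pos₃ pos₃ α 5 0 = moment pos₃ pos₃ α 1 0 :=
        (moment_fst_reduce _ _ 2 0).trans (moment_fst_reduce _ _ 0 0)
      have e41 : moment pos₃ pos₃ α 4 1 = moment pos₃ pos₃ α 2 1 := moment_fst_reduce _ _ 1 1
      have e32 : moment pos₃ pos₃ α 3 2 = moment pos₃ pos₃ α 1 2 := moment_fst_reduce _ _ 0 2
      have e23 : moment pos₃ pos₃ α 2 3 = moment pos₃ pos₃ α 2 1 := moment_snd_reduce _ _ 2 0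
      have e14 : moment pos₃ pos₃ α 1 4 = moment pos₃ pos₃ α 1 2 := moment_snd_reduce _ _ 1 1
      have e05 : moment pos₃ pos₃ α 0 5 = moment pos₃ pos₃ α 0 1 :=
        (moment_snd_reduce _ _ 0 2).trans (moment_snd_reduce _ _ 0 0)
      have eq' : W 5 0 p / 120 * moment pos₃ pos₃ α 5 0 + W 4 1 p / 24 * moment pos₃ pos₃ α 4 1
          + W 3 2 p / 12 * moment pos₃ pos₃ α 3 2 + W 2 3 p / 12 * moment pos₃ pos₃ α 2 3
          + W 1 4 p / 24 * moment pos₃ pos₃ α 1 4 + W 0 5 p / 120 * moment pos₃ pos₃ α 0 5 =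
        ∑ i, ∑ j, α i j * (W 5 0 p / 120 * (pos₃ i ^ 5 * pos₃ j ^ 0)
        + W 4 1 p / 24 * (pos₃ i ^ 4 * pos₃ j ^ 1)
        + W 3 2 p / 12 * (pos₃ i ^ 3 * pos₃ j ^ 2) + W 2 3 p / 12 * (pos₃ i ^ 2 * pos₃ j ^ 3)
        + W 1 4 p / 24 * (pos₃ i ^ 1 * pos₃ j ^ 4)
        + W 0 5 p / 120 * (pos₃ i ^ 0 * pos₃ j ^ 5)) := by
        simp only [moment, Finset.mul_sum, ← Finset.sum_add_distrib]
        exact Finset.sum_congr rfl fun i _ => Finset.sum_congr rfl fun j _ => by ring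
      rw [e50, e41, e32, e23, e14, e05] at eq'
      rw [eq', ← Finset.sum_sub_distrib, Finset.mul_sum]
      refine Finset.sum_congr rfl fun i _ => ?_
      rw [← Finset.sum_sub_distrib, Finset.mul_sum]
      refine Finset.sum_congr rfl fun j _ => ?_
      rw [hx, taylorSum_six]; ring
    have hm : ∀ y : ℝ, h ^ 2 * |y| ≤ 9 * (C * h) → |h ^ 2 * y| ≤ 9 * (C * h) := by
      intro y hy; rwa [abs_mul, abs_of_pos (by positivity : 0 < h ^ 2)]
    have hw := fun k l (hkl : k + l = 5) => hD k l (by omega) (by omega) p hp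
    have t1 := abs_le.1 (term _ _ _ _ 120 (hw 5 0 rfl) (hm _ A10) (by norm_num))
    have t2 := abs_le.1 (term _ _ _ _ 24 (hw 4 1 rfl) (hm _ A21) (by norm_num))
    have t3 := abs_le.1 (term _ _ _ _ 12 (hw 3 2 rfl) (hm _ A12) (by norm_num))
    have t4 := abs_le.1 (term _ _ _ _ 12 (hw 2 3 rfl) (hm _ A21) (by norm_num))
    have t5 := abs_le.1 (term _ _ _ _ 24 (hw 1 4 rfl) (hm _ A12) (by norm_num))
    have t6 := abs_le.1 (term _ _ _ _ 120 (hw 0 5 rfl) (hm _ A01) (by norm_num))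
    have hs : |W 5 0 p / 120 * (h ^ 2 * moment pos₃ pos₃ α 1 0)
        + W 4 1 p / 24 * (h ^ 2 * moment pos₃ pos₃ α 2 1)
        + W 3 2 p / 12 * (h ^ 2 * moment pos₃ pos₃ α 1 2)
        + W 2 3 p / 12 * (h ^ 2 * moment pos₃ pos₃ α 2 1)
        + W 1 4 p / 24 * (h ^ 2 * moment pos₃ pos₃ α 1 2)
        + W 0 5 p / 120 * (h ^ 2 * moment pos₃ pos₃ α 0 1)| ≤ 6 * (D * (9 * (C * h))) :=
      abs_le.2 ⟨by linarith only [t1.1, t2.1, t3.1, t4.1, t5.1, t6.1],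
        by linarith only [t1.2, t2.2, t3.2, t4.2, t5.2, t6.2]⟩
    rw [eq]
    calc _ = |h ^ 3 * (W 5 0 p / 120 * (h ^ 2 * moment pos₃ pos₃ α 1 0)
        + W 4 1 p / 24 * (h ^ 2 * moment pos₃ pos₃ α 2 1)
        + W 3 2 p / 12 * (h ^ 2 * moment pos₃ pos₃ α 1 2)
        + W 2 3 p / 12 * (h ^ 2 * moment pos₃ pos₃ α 2 1)
        + W 1 4 p / 24 * (h ^ 2 * moment pos₃ pos₃ α 1 2)
        + W 0 5 p / 120 * (h ^ 2 * moment pos₃ pos₃ α 0 1))| := by congr 1; ring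
      _ ≤ h ^ 3 * (6 * (D * (9 * (C * h)))) := by
          rw [abs_mul, abs_of_pos (by positivity : 0 < h ^ 3)]; gcongr
      _ = 54 * C * D * h ^ 4 := by ring
  have e4 : |∑ i, ∑ j, β i j * taylorSum 4 F p (x i) (x j)
      - ∑ i, ∑ j, β i j * taylorSum 3 F p (x i) (x j)| ≤ 4 * C * c * D * h ^ 4 := by
    have eq : ∑ i, ∑ j, β i j * taylorSum 4 F p (x i) (x j)
        - ∑ i, ∑ j, β i j * taylorSum 3 F p (x i) (x j) = h ^ 3 *
        (F 3 0 p / 6 * moment pos₃ pos₃ β 1 0 + F 2 1 p / 2 * moment pos₃ pos₃ β 2 1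
        + F 1 2 p / 2 * moment pos₃ pos₃ β 1 2 + F 0 3 p / 6 * moment pos₃ pos₃ β 0 1) := by
      rw [← moment_fst_reduce _ _ 0 0, ← moment_snd_reduce _ _ 0 0]
      simp only [zero_add]
      have eq' : F 3 0 p / 6 * moment pos₃ pos₃ β 3 0 + F 2 1 p / 2 * moment pos₃ pos₃ β 2 1
          + F 1 2 p / 2 * moment pos₃ pos₃ β 1 2 + F 0 3 p / 6 * moment pos₃ pos₃ β 0 3 =
        ∑ i, ∑ j, β i j * (F 3 0 p / 6 * (pos₃ i ^ 3 * pos₃ j ^ 0)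
        + F 2 1 p / 2 * (pos₃ i ^ 2 * pos₃ j ^ 1)
        + F 1 2 p / 2 * (pos₃ i ^ 1 * pos₃ j ^ 2)
        + F 0 3 p / 6 * (pos₃ i ^ 0 * pos₃ j ^ 3)) := by
        simp only [moment, Finset.mul_sum, ← Finset.sum_add_distrib]
        exact Finset.sum_congr rfl fun i _ => Finset.sum_congr rfl fun j _ => by ring
      rw [eq', ← Finset.sum_sub_distrib, Finset.mul_sum]
      refine Finset.sum_congr rfl fun i _ => ?_
      rw [← Finset.sum_sub_distrib, Finset.mul_sum]
      refine Finset.sum_congr rfl fun j _ => ?_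
      rw [hx, taylorSum_four]; ring
    have hw := fun k l (hkl : k + l = 3) => hFD k l (by omega) (by omega) p hp
    have t1 := abs_le.1 (term _ _ _ _ 6 (hw 3 0 rfl) B10 (by norm_num))
    have t2 := abs_le.1 (term _ _ _ _ 2 (hw 2 1 rfl) B21 (by norm_num))
    have t3 := abs_le.1 (term _ _ _ _ 2 (hw 1 2 rfl) B12 (by norm_num))
    have t4 := abs_le.1 (term _ _ _ _ 6 (hw 0 3 rfl) B01 (by norm_num))
    rw [eq, abs_mul, abs_of_pos (by positivity : 0 < h ^ 3)]
    calc _ ≤ h ^ 3 * (4 * (c * D * (C * h))) := by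
          refine mul_le_mul_of_nonneg_left (abs_le.2 ⟨?_, ?_⟩) (by positivity)
          · linarith only [t1.1, t2.1, t3.1, t4.1]
          · linarith only [t1.2, t2.2, t3.2, t4.2]
      _ = _ := by ring
  have e5 : ∑ i, ∑ j, α i j * taylorSum 5 W p (x i) (x j)
      - ∑ i, ∑ j, β i j * taylorSum 3 F p (x i) (x j) = 0 :=
    (sum_interiorStencil_taylor a b K h W p).trans
      (Finset.sum_eq_zero fun kl hkl => by rw [hS.row kl hkl, zero_mul])
  simp only [mul_sub, Finset.sum_sub_distrib] at e1 e2
  have e1' : ((3 : ℕ) : ℝ) * (3 : ℕ) * (5 / h ^ 2 * (D * (2 * h) ^ 6)) = 2880 * D * h ^ 4 := by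
    field_simp; push_cast; ring
  have e2' : ((3 : ℕ) : ℝ) * (3 : ℕ) * (C * (c * D * (2 * h) ^ 4)) = 144 * C * c * D * h ^ 4 := by
    push_cast; ring
  rw [e1'] at e1
  rw [e2'] at e2
  rw [abs_le] at e1 e2 e3 e4 ⊢
  constructor
  · linarith only [e1.1, e2.2, e3.1, e4.2, e5]
  · linarith only [e1.2, e2.1, e3.2, e4.1, e5]

/-- The rows of the flux system collect the Taylor polynomials of `u`, of the source and of the
boundary flux. -/
theorem sum_fluxStencil_taylor (a b K σ h : ℝ) (W : ℕ → ℕ → ℝ × ℝ → ℝ) (p : ℝ × ℝ) :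
    ∑ i, ∑ j, fluxAlpha a b K σ h i j * taylorSum 5 W p (pos₂ i * h) (pos₃ j * h)
      - ∑ i, ∑ j, fluxBeta a b K σ h i j
        * taylorSum 3 (sourceJet a b K W) p (pos₃ i * h) (pos₃ j * h)
      - ∑ j, fluxGamma a b K σ h j * taylorSum 4 (fluxJet σ W) p 0 (pos₃ j * h) =
    ∑ kl ∈ matchIdx, (∑ i, fluxRow a b K σ h kl i * fluxStencil a b K σ h i)
      * W kl.1 kl.2 p := by
  rw [← sum_mul_sum_row, Fintype.sum_sum_type, Fintype.sum_sum_type, Fintype.sum_prod_type,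
    Fintype.sum_prod_type, sub_sub, sub_eq_add_neg, neg_add, ← Finset.sum_neg_distrib,
    ← Finset.sum_neg_distrib]
  congr 1
  · refine Finset.sum_congr rfl fun i _ => Finset.sum_congr rfl fun j _ => ?_
    rw [← sum_taylorCoeff_mul_jet]; rfl
  congr 1
  · refine Finset.sum_congr rfl fun i _ => ?_
    rw [← Finset.sum_neg_distrib]
    refine Finset.sum_congr rfl fun j _ => ?_
    rw [← sum_sourceCoeff_mul_jet, ← mul_neg, ← Finset.sum_neg_distrib]
    congr 1
    refine Finset.sum_congr rfl fun kl _ => ?_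
    simp only [fluxRow, pos₃]; ring
  · refine Finset.sum_congr rfl fun j _ => ?_
    rw [← sum_fluxCoeff_mul_jet, ← mul_neg, ← Finset.sum_neg_distrib]
    congr 1
    refine Finset.sum_congr rfl fun kl _ => ?_
    simp only [fluxRow, pos₃]; ring

/-- The truncation error at a flux boundary point. The Taylor terms up to order four only meet
the small residuals of the least-squares problem. -/
theorem abs_flux_truncation_le {a b K σ h C : ℝ} (hS : FluxStencilBounds a b K σ h C)
    (hh : 0 < h) (hC : 0 ≤ C) (hCh : C * h ≤ 1) {R : Set (ℝ × ℝ)} (hR : Convex ℝ R)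
    {ν τ : ℝ × ℝ} {W : ℕ → ℕ → ℝ × ℝ → ℝ} (hW : IsJet R ν τ 5 W) {D E : ℝ}
    (hD : ∀ k l, k + l ≤ 5 → ∀ z ∈ R, |W k l z| ≤ D) (hE : 0 ≤ E) {p : ℝ × ℝ} (hp : p ∈ R)
    {q : ℕ → Fin 3 → ℝ × ℝ} (hqR : ∀ n ≤ 2, ∀ j, q n j ∈ R)
    (hq : ∀ n j, q n j = p + ((n * h) • ν + (pos₃ j * h) • τ)) {F : Fin 3 → Fin 3 → ℝ}
    (hF1 : ∀ j, F 1 j = sourceJet a b K W 0 0 (q 0 j))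
    (hF2 : ∀ j, F 2 j = sourceJet a b K W 0 0 (q 1 j))
    (hF0 : ∀ j, |F 0 j - (3 * F 1 j - 3 * F 2 j + sourceJet a b K W 0 0 (q 2 j))| ≤ E * h ^ 3) :
    |∑ i : Fin 2, ∑ j, fluxAlpha a b K σ h i j * W 0 0 (q i j)
      - ∑ i, ∑ j, fluxBeta a b K σ h i j * F i j
      - ∑ j, fluxGamma a b K σ h j * fluxJet σ W 0 0 (q 0 j)|
      ≤ (960 + 9 * C * (1 + 189 * (2 + |a| + |b| + |K|)) + 3 * C * (1 + |σ|) + 15 * C)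
        * (D + E) * h ^ 3 := by
  set c := 2 + |a| + |b| + |K| with hc
  have hc0 : 0 ≤ c := by positivity
  have hD0 : 0 ≤ D := (abs_nonneg _).trans (hD 0 0 (by norm_num) p hp)
  set S := sourceJet a b K W with hSd
  set G := fluxJet σ W with hG
  have hSJ : IsJet R ν τ 3 S := hW.sourceJet a b K
  have hGJ : IsJet R ν τ 4 G := hW.fluxJet σ
  have hSD : ∀ k l, k + l = 3 → ∀ z ∈ R, |S k l z| ≤ c * D := fun k l hkl z hz =>
    abs_sourceJet_le fun i j h1 h2 => hD i j (by omega) z hz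
  have hGD : ∀ k l, k + l = 4 → ∀ z ∈ R, |G k l z| ≤ (1 + |σ|) * D := fun k l hkl z hz =>
    abs_fluxJet_le fun i j h1 h2 => hD i j (by omega) z hz
  set α := fluxAlpha a b K σ h with hα
  set β := fluxBeta a b K σ h with hβ
  set γ := fluxGamma a b K σ h with hγ
  have hα5 : ∀ i j, |α i j| ≤ 5 / h ^ 2 := fun i j =>
    abs_le_div_sq_of_scaled hh hCh (abs_fluxLimit_le i j) (hS.abs_alpha i j)
  have hγC : ∀ j, |γ j| ≤ C / h := by
    intro j
    have := hS.abs_gamma j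
    rw [abs_mul, abs_of_pos hh] at this
    rw [le_div_iff₀ hh, mul_comm]
    exact this
  have hposj : ∀ j, |pos₃ j * h| ≤ h := by
    intro j
    rw [abs_mul, abs_of_pos hh]
    exact mul_le_of_le_one_left hh.le (abs_pos₃_le j)
  have hnj : ∀ n : ℕ, n ≤ 2 → |(n : ℝ) * h| ≤ n * h := by
    intro n _; rw [abs_of_nonneg (by positivity)]
  -- the remainders of the Taylor expansions
  have ru : ∀ (i : Fin 2) j,
      |W 0 0 (q i j) - taylorSum 5 W p (pos₂ i * h) (pos₃ j * h)| ≤ D * (2 * h) ^ 5 := by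
    intro i j
    refine (hW.abs_sub_taylor_le hR 5 hp (hqR i (by omega) j) (hq i j)
      (fun k l hkl => hD k l (by omega))).trans ?_
    refine mul_le_mul_of_nonneg_left (pow_le_pow_left₀ (by positivity) ?_ 5) hD0
    have h1 := hnj i (by omega)
    have h2 := hposj j
    have h3 : ((i : ℕ) : ℝ) * h ≤ 1 * h :=
      mul_le_mul_of_nonneg_right (by exact_mod_cast (by omega : (i : ℕ) ≤ 1)) hh.le
    linarith
  have rs : ∀ n ≤ 2, ∀ j,
      |S 0 0 (q n j) - taylorSum 3 S p (n * h) (pos₃ j * h)| ≤ 27 * (c * D) * h ^ 3 := by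
    intro n hn j
    refine (hSJ.abs_sub_taylor_le hR 3 hp (hqR n hn j) (hq n j) hSD).trans ?_
    have h1 := hnj n hn
    have h2 := hposj j
    have h3 : (n : ℝ) * h ≤ 2 * h :=
      mul_le_mul_of_nonneg_right (by exact_mod_cast hn) hh.le
    calc c * D * (|(n : ℝ) * h| + |pos₃ j * h|) ^ 3 ≤ c * D * (3 * h) ^ 3 := by
          refine mul_le_mul_of_nonneg_left (pow_le_pow_left₀ (by positivity) ?_ 3) (by positivity)
          linarith
      _ = 27 * (c * D) * h ^ 3 := by ring
  have rF : ∀ i j, |F i j - taylorSum 3 S p (pos₃ i * h) (pos₃ j * h)|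
      ≤ (E + 189 * (c * D)) * h ^ 3 := by
    intro i j
    have r0 := abs_le.1 (rs 0 (by norm_num) j)
    have r1 := abs_le.1 (rs 1 (by norm_num) j)
    have r2 := abs_le.1 (rs 2 (by norm_num) j)
    have ext := taylorSum_three_extrapolate S p (pos₃ j * h) h
    have hE3 : 0 ≤ E * h ^ 3 := by positivity
    have hcD : 0 ≤ (c * D) * h ^ 3 := by positivity
    push_cast at r0 r1 r2
    fin_cases i
    · have r := abs_le.1 (hF0 j)
      rw [hF1, hF2] at r
      simp only [Fin.zero_eta, pos₃_zero]
      rw [ext]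
      exact abs_le.2 ⟨by linarith only [r.1, r0.1, r1.2, r2.1], by
        linarith only [r.2, r0.2, r1.1, r2.2]⟩
    · simp only [Fin.mk_one, pos₃_one]
      rw [hF1]
      exact abs_le.2 ⟨by linarith only [r0.1, hE3, hcD], by linarith only [r0.2, hE3, hcD]⟩
    · simp only [Fin.reduceFinMk, pos₃_two]
      rw [hF2]
      exact abs_le.2 ⟨by linarith only [r1.1, hE3, hcD], by linarith only [r1.2, hE3, hcD]⟩
  have rg : ∀ j, |G 0 0 (q 0 j) - taylorSum 4 G p 0 (pos₃ j * h)| ≤ (1 + |σ|) * D * h ^ 4 := by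
    intro j
    have e : q 0 j = p + ((0 : ℝ) • ν + (pos₃ j * h) • τ) := by rw [hq]; simp
    refine (hGJ.abs_sub_taylor_le hR 4 hp (hqR 0 (by norm_num) j) e hGD).trans ?_
    refine mul_le_mul_of_nonneg_left (pow_le_pow_left₀ (by positivity) ?_ 4) (by positivity)
    simpa using hposj j
  have e1 := abs_sum_sum_mul_le (by positivity) hα5 ru
  have e2 : |∑ i, ∑ j, β i j * (F i j - taylorSum 3 S p (pos₃ i * h) (pos₃ j * h))| ≤ _ :=
    abs_sum_sum_mul_le hC hS.abs_beta rF
  have e3 : |∑ j, γ j * (G 0 0 (q 0 j) - taylorSum 4 G p 0 (pos₃ j * h))|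
      ≤ 3 * (C / h * ((1 + |σ|) * D * h ^ 4)) := by
    refine (Finset.abs_sum_le_sum_abs _ _).trans ?_
    refine (Finset.sum_le_sum (g := fun _ => C / h * ((1 + |σ|) * D * h ^ 4))
      fun j _ => ?_).trans (by simp)
    rw [abs_mul]
    exact mul_le_mul (hγC j) (rg j) (abs_nonneg _) (by positivity)
  have e4 : |∑ i, ∑ j, α i j * taylorSum 5 W p (pos₂ i * h) (pos₃ j * h)
      - ∑ i, ∑ j, β i j * taylorSum 3 S p (pos₃ i * h) (pos₃ j * h)
      - ∑ j, γ j * taylorSum 4 G p 0 (pos₃ j * h)| ≤ 15 * (C * h ^ 3 * D) := by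
    rw [hα, hβ, hγ, hSd, hG, sum_fluxStencil_taylor]
    refine (Finset.abs_sum_le_sum_abs _ _).trans ?_
    refine (Finset.sum_le_sum (g := fun _ => C * h ^ 3 * D) fun kl hkl => ?_).trans ?_
    · rw [abs_mul]
      have h4 : kl.1 + kl.2 ≤ 4 := (Finset.mem_filter.1 hkl).2
      exact mul_le_mul (hS.row kl hkl) (hD _ _ (by omega) p hp) (abs_nonneg _) (by positivity)
    · rw [Finset.sum_const, show matchIdx.card = 15 by decide]; simp
  simp only [mul_sub, Finset.sum_sub_distrib] at e1 e2 e3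
  have e1' : ((2 : ℕ) : ℝ) * (3 : ℕ) * (5 / h ^ 2 * (D * (2 * h) ^ 5)) = 960 * D * h ^ 3 := by
    field_simp; push_cast; ring
  have e2' : ((3 : ℕ) : ℝ) * (3 : ℕ) * (C * ((E + 189 * (c * D)) * h ^ 3)) =
      9 * C * (E + 189 * c * D) * h ^ 3 := by push_cast; ring
  have e3' : 3 * (C / h * ((1 + |σ|) * D * h ^ 4)) = 3 * C * (1 + |σ|) * D * h ^ 3 := by
    field_simp
  rw [e1'] at e1
  rw [e2'] at e2
  rw [e3'] at e3
  have total : 960 * D * h ^ 3 + 9 * C * (E + 189 * c * D) * h ^ 3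
      + 3 * C * (1 + |σ|) * D * h ^ 3 + 15 * (C * h ^ 3 * D) ≤
      (960 + 9 * C * (1 + 189 * c) + 3 * C * (1 + |σ|) + 15 * C) * (D + E) * h ^ 3 := by
    have : 0 ≤ (960 * E + 9 * C * (D + 189 * c * E) + 3 * C * (1 + |σ|) * E + 15 * C * E)
        * h ^ 3 := by positivity
    linarith only [this]
  refine le_trans ?_ total
  rw [abs_le] at e1 e2 e3 e4 ⊢
  constructor
  · linarith only [e1.1, e2.2, e3.2, e4.1]
  · linarith only [e1.2, e2.1, e3.1, e4.2]

/-! ### The local coordinates of a side, and the truncation errors -/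

/-- An integer vector, as a vector of the plane. -/
def toPlane (v : ℤ × ℤ) : ℝ × ℝ := (v.1, v.2)

/-- The derivatives of `W 0 0` along the inner normal and the tangent of a side, when `W k l` are
those along the coordinate axes. -/
def Side.jet (s : Side) (W : ℕ → ℕ → ℝ × ℝ → ℝ) : ℕ → ℕ → ℝ × ℝ → ℝ :=
  match s with
  | .left => W
  | .right => fun k l p => (-1) ^ k * W k l p
  | .bottom => fun k l => W l k
  | .top => fun k l p => (-1) ^ k * W l k p

theorem IsJet.neg_fst {R : Set (ℝ × ℝ)} {ν τ : ℝ × ℝ} {n : ℕ} {W : ℕ → ℕ → ℝ × ℝ → ℝ}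
    (hW : IsJet R ν τ n W) : IsJet R (-ν) τ n fun k l p => (-1) ^ k * W k l p := by
  intro k l hkl p hp
  obtain ⟨L, hL, h1, h2⟩ := hW k l hkl p hp
  refine ⟨(-1 : ℝ) ^ k • L, ?_, ?_, ?_⟩
  · exact hL.const_mul ((-1) ^ k)
  · simp [h1, pow_succ]
  · simp [h2]

theorem IsJet.swap {R : Set (ℝ × ℝ)} {ν τ : ℝ × ℝ} {n : ℕ} {W : ℕ → ℕ → ℝ × ℝ → ℝ}
    (hW : IsJet R ν τ n W) : IsJet R τ ν n fun k l => W l k := by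
  intro k l hkl p hp
  obtain ⟨L, hL, h1, h2⟩ := hW l k (by omega) p hp
  exact ⟨L, hL, h2, h1⟩

theorem IsJet.sideJet {R : Set (ℝ × ℝ)} {n : ℕ} {W : ℕ → ℕ → ℝ × ℝ → ℝ}
    (hW : IsJet R (1, 0) (0, 1) n W) (s : Side) :
    IsJet R (toPlane s.inward) (toPlane s.tangent) n (s.jet W) := by
  cases s with
  | left => simpa [toPlane, Side.inward, Side.tangent, Side.jet] using hW
  | right => simpa [toPlane, Side.inward, Side.tangent, Side.jet] using hW.neg_fst
  | bottom => simpa [toPlane, Side.inward, Side.tangent, Side.jet] using hW.swap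
  | top => simpa [toPlane, Side.inward, Side.tangent, Side.jet] using hW.swap.neg_fst

theorem abs_sideJet_le {n : ℕ} {W : ℕ → ℕ → ℝ × ℝ → ℝ} {D : ℝ} {R : Set (ℝ × ℝ)}
    (hD : ∀ k l, k + l ≤ n → ∀ z ∈ R, |W k l z| ≤ D) (s : Side) :
    ∀ k l, k + l ≤ n → ∀ z ∈ R, |s.jet W k l z| ≤ D := by
  intro k l hkl z hz
  cases s <;> simp only [Side.jet, abs_mul, abs_pow, abs_neg, abs_one, one_pow, one_mul]
  · exact hD k l hkl z hz
  · exact hD k l hkl z hz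
  · exact hD l k (by omega) z hz
  · exact hD l k (by omega) z hz

theorem sideJet_zero_zero (s : Side) (W : ℕ → ℕ → ℝ × ℝ → ℝ) : s.jet W 0 0 = W 0 0 := by
  cases s <;> simp [Side.jet]

/-- The differential operator keeps its form in the coordinates of a side. -/
theorem sourceJet_sideJet (a b K : ℝ) (s : Side) (W : ℕ → ℕ → ℝ × ℝ → ℝ) (p : ℝ × ℝ) :
    sourceJet (a * s.inward.1 + b * s.inward.2) (a * s.tangent.1 + b * s.tangent.2) K
      (s.jet W) 0 0 p = sourceJet a b K W 0 0 p := by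
  cases s <;> simp [sourceJet, Side.jet, Side.inward, Side.tangent] <;> ring

theorem sourceJet_pderiv (a b K : ℝ) (R : Set (ℝ × ℝ)) (u : ℝ × ℝ → ℝ) (p : ℝ × ℝ) :
    sourceJet a b K (fun k l => pderiv R k l u) 0 0 p = diffAdv a b K R u p := by
  simp [sourceJet, diffAdv, pderiv_zero_zero]

theorem fluxJet_pderiv (σ : ℝ) (s : Side) (R : Set (ℝ × ℝ)) (u : ℝ × ℝ → ℝ) (p : ℝ × ℝ) :
    fluxJet σ (s.jet fun k l => pderiv R k l u) 0 0 p = normalDeriv R s u p + σ * u p := by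
  cases s <;> simp [fluxJet, normalDeriv, Side.jet, Side.inward, pderiv_zero_zero]

theorem node_add (xl yl h : ℝ) (p v : ℤ × ℤ) :
    node xl yl h (p + v) = node xl yl h p + h • toPlane v := by
  ext <;> simp [node, toPlane] <;> ring

theorem node_mem_rect {xl xr yl yr h : ℝ} {M N : ℕ} (hh : 0 < h) (hM : M * h = xr - xl)
    (hN : N * h = yr - yl) {p : ℤ × ℤ} (hp : p ∈ gridPts M N) :
    node xl yl h p ∈ rect xl xr yl yr := by
  obtain ⟨⟨h1, h2⟩, h3, h4⟩ := hp
  have h1' : (0 : ℝ) ≤ p.1 := by exact_mod_cast h1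
  have h2' : (p.1 : ℝ) ≤ M := by exact_mod_cast h2
  have h3' : (0 : ℝ) ≤ p.2 := by exact_mod_cast h3
  have h4' : (p.2 : ℝ) ≤ N := by exact_mod_cast h4
  refine ⟨⟨?_, ?_⟩, ?_, ?_⟩ <;> simp only [node]
  · nlinarith
  · nlinarith
  · nlinarith
  · nlinarith

theorem Side.pts_subset_gridPts (s : Side) (M N : ℕ) : s.pts M N ⊆ gridPts M N := by
  rintro ⟨x, y⟩ hp
  cases s <;> simp only [Side.pts, gridPts, mem_prod, mem_singleton_iff, mem_Icc] at hp ⊢ <;> omega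

theorem Side.innerPts_subset_pts (s : Side) (M N : ℕ) : s.innerPts M N ⊆ s.pts M N := by
  rintro ⟨x, y⟩ hp
  cases s <;> simp only [Side.pts, Side.innerPts, mem_prod, mem_singleton_iff, mem_Icc, mem_Ioo]
    at hp ⊢ <;> omega

theorem interiorPts_subset_gridPts (M N : ℕ) : interiorPts M N ⊆ gridPts M N :=
  prod_mono Ioo_subset_Icc_self Ioo_subset_Icc_self

theorem node_mem_segment {xl xr yl yr h : ℝ} {M N : ℕ} (hh : 0 < h) (hM : M * h = xr - xl)
    (hN : N * h = yr - yl) {s : Side} {p : ℤ × ℤ} (hp : p ∈ s.pts M N) :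
    node xl yl h p ∈ s.segment xl xr yl yr := by
  have := node_mem_rect hh hM hN (s.pts_subset_gridPts M N hp)
  obtain ⟨x, y⟩ := p
  cases s <;> simp only [Side.pts, Side.segment, rect, node, mem_prod, mem_singleton_iff]
    at hp this ⊢
  · exact ⟨by simp [hp.1], this.2⟩
  · exact ⟨by simp [hp.1, hM], this.2⟩
  · exact ⟨this.1, by simp [hp.2]⟩
  · exact ⟨this.1, by simp [hp.2, hN]⟩

theorem add_off_mem_gridPts {M N : ℕ} {p : ℤ × ℤ} (hp : p ∈ interiorPts M N) (i j : Fin 3) :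
    p + (off i, off j) ∈ gridPts M N := by
  obtain ⟨x, y⟩ := p
  simp only [interiorPts, gridPts, mem_prod, mem_Ioo, mem_Icc, Prod.mk_add_mk, off] at hp ⊢
  omega

theorem add_tangent_mem_pts {M N : ℕ} {s : Side} {p : ℤ × ℤ} (hp : p ∈ s.innerPts M N)
    (j : Fin 3) : p + off j • s.tangent ∈ s.pts M N := by
  obtain ⟨x, y⟩ := p
  cases s <;> simp only [Side.innerPts, Side.pts, Side.tangent, mem_prod, mem_Ioo, mem_Icc,
    mem_singleton_iff, Prod.smul_mk, Prod.mk_add_mk, off, smul_eq_mul] at hp ⊢ <;> omega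

theorem add_inward_mem_gridPts {M N : ℕ} (hM : 2 ≤ M) (hN : 2 ≤ N) {s : Side} {p : ℤ × ℤ}
    (hp : p ∈ s.innerPts M N) {n : ℕ} (hn : n ≤ 2) (j : Fin 3) :
    p + (n : ℤ) • s.inward + off j • s.tangent ∈ gridPts M N := by
  obtain ⟨x, y⟩ := p
  cases s <;> simp only [Side.innerPts, gridPts, Side.inward, Side.tangent, mem_prod, mem_Ioo,
    mem_Icc, mem_singleton_iff, Prod.smul_mk, Prod.mk_add_mk, off, smul_eq_mul] at hp ⊢ <;> omega

section Truncation

variable {xl xr yl yr a b K σ h C D E : ℝ} {S : Set Side} {f u₁ g u : ℝ × ℝ → ℝ} {M N : ℕ}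
  {F : ℤ × ℤ → ℝ}

theorem abs_interiorDefect_le (hx : xl < xr) (hy : yl < yr)
    (hu : IsBVPSolution xl xr yl yr a b K σ S f u₁ g u) (hh : 0 < h) (hM : M * h = xr - xl)
    (hN : N * h = yr - yl) (hS : InteriorStencilBounds a b K h C) (hC : 0 ≤ C) (hCh : C * h ≤ 1)
    (hF : ∀ p ∈ gridPts M N, F p = f (node xl yl h p))
    (hD : DerivBound (rect xl xr yl yr) 3 6 u D) {p : ℤ × ℤ} (hp : p ∈ interiorPts M N) :
    |interiorDefect a b K h F (fun q => u (node xl yl h q)) p|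
      ≤ (2880 + 54 * C + 148 * C * (2 + |a| + |b| + |K|)) * D * h ^ 4 := by
  have hW := isJet_pderiv (uniqueDiffOn_rect hx hy) (rect_subset_closure_interior hx hy)
    (N := 6) hu.smooth
  have key := abs_interior_truncation_le hS hh hC hCh (convex_rect xl xr yl yr) hW (D := D)
    (fun k l h1 h2 z hz => hD k l h1 h2 z hz)
    (node_mem_rect hh hM hN (interiorPts_subset_gridPts M N hp))
    (q := fun i j => node xl yl h (p + (off i, off j)))
    (fun i j => node_mem_rect hh hM hN (add_off_mem_gridPts hp i j))
    (fun i j => by rw [node_add]; ext <;> simp [toPlane, pos₃, mul_comm])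
  refine le_of_eq_of_le (congrArg abs ?_) key
  unfold interiorDefect
  congr 1
  refine Finset.sum_congr rfl fun i _ => Finset.sum_congr rfl fun j _ => ?_
  have hm := add_off_mem_gridPts hp i j
  rw [hF _ hm, ← hu.pde _ (node_mem_rect hh hM hN hm), sourceJet_pderiv]
  rfl

theorem abs_fluxDefect_le (hx : xl < xr) (hy : yl < yr)
    (hu : IsBVPSolution xl xr yl yr a b K σ S f u₁ g u) (hh : 0 < h) (hM : M * h = xr - xl)
    (hN : N * h = yr - yl) (hM2 : 2 ≤ M) (hN2 : 2 ≤ N) {s : Side} (hs : s ∈ S)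
    (hS : FluxStencilBounds (a * s.inward.1 + b * s.inward.2)
      (a * s.tangent.1 + b * s.tangent.2) K σ h C) (hC : 0 ≤ C) (hCh : C * h ≤ 1)
    (hF : IsSourceExtension xl yl h M N S f E F)
    (hD : DerivBound (rect xl xr yl yr) 0 5 u D) {p : ℤ × ℤ} (hp : p ∈ s.innerPts M N) :
    |fluxDefect a b K σ h s F (fun q => g (node xl yl h q)) (fun q => u (node xl yl h q)) p|
      ≤ (960 + 9 * C * (1 + 189 * (2 + |a| + |b| + |K|)) + 3 * C * (1 + |σ|) + 15 * C)
        * (D + E) * h ^ 3 := by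
  have hW := isJet_pderiv (uniqueDiffOn_rect hx hy) (rect_subset_closure_interior hx hy)
    (N := 6) hu.smooth
  set W : ℕ → ℕ → ℝ × ℝ → ℝ := fun k l => pderiv (rect xl xr yl yr) k l u with hWd
  have hmem : ∀ n : ℕ, n ≤ 2 → ∀ j : Fin 3, p + (n : ℤ) • s.inward + off j • s.tangent ∈ gridPts M N :=
    fun n hn j => add_inward_mem_gridPts hM2 hN2 hp hn j
  have hFf : ∀ n : ℕ, n ≤ 2 → ∀ j : Fin 3, F (p + (n : ℤ) • s.inward + off j • s.tangent) =
      sourceJet (a * s.inward.1 + b * s.inward.2) (a * s.tangent.1 + b * s.tangent.2) K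
        (s.jet W) 0 0 (node xl yl h (p + (n : ℤ) • s.inward + off j • s.tangent)) := by
    intro n hn j
    rw [hF.grid _ (hmem n hn j), ← hu.pde _ (node_mem_rect hh hM hN (hmem n hn j)),
      sourceJet_sideJet, sourceJet_pderiv]
  have key := abs_flux_truncation_le hS hh hC hCh (convex_rect xl xr yl yr)
    ((hW.mono (by norm_num : 5 ≤ 6)).sideJet s) (D := D) (E := E)
    (abs_sideJet_le (fun k l h2 z hz => hD k l (Nat.zero_le _) h2 z hz) s) hF.nonneg
    (node_mem_rect hh hM hN (s.pts_subset_gridPts M N (s.innerPts_subset_pts M N hp)))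
    (q := fun n j => node xl yl h (p + (n : ℤ) • s.inward + off j • s.tangent))
    (fun n hn j => node_mem_rect hh hM hN (hmem n hn j))
    (fun n j => by
      rw [node_add, node_add]; ext <;> simp [toPlane, pos₃] <;> ring)
    (F := fun i j => F (p + off i • s.inward + off j • s.tangent))
    (fun j => hFf 0 (by norm_num) j)
    (fun j => hFf 1 (by norm_num) j)
    (fun j => by
      have hg := hF.ghost s hs _ (add_tangent_mem_pts hp j)
      rw [← hFf 2 le_rfl j]
      have e0 : p + off 0 • s.inward + off j • s.tangent
          = p + off j • s.tangent - s.inward := by simp [off]; abel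
      have e1 : p + off 1 • s.inward + off j • s.tangent = p + off j • s.tangent := by simp [off]
      have e2 : p + off 2 • s.inward + off j • s.tangent
          = p + off j • s.tangent + s.inward := by simp [off]; abel
      have e3 : p + ((2 : ℕ) : ℤ) • s.inward + off j • s.tangent
          = p + off j • s.tangent + (2 : ℤ) • s.inward := by push_cast; abel
      simp only [e0, e1, e2, e3]
      exact hg)
  have hca : |a * s.inward.1 + b * s.inward.2| + |a * s.tangent.1 + b * s.tangent.2|
      = |a| + |b| := by
    cases s <;> simp [Side.inward, Side.tangent, add_comm]
  rw [add_assoc 2 |_| |_|, hca, ← add_assoc 2] at key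
  refine le_of_eq_of_le (congrArg abs ?_) key
  unfold fluxDefect
  congr 1
  · congr 1
    · simp only [sideJet_zero_zero, hWd, pderiv_zero_zero]; rfl
  · refine Finset.sum_congr rfl fun j _ => ?_
    have hm := add_tangent_mem_pts hp j
    have e0 : p + ((0 : ℕ) : ℤ) • s.inward + off j • s.tangent = p + off j • s.tangent := by simp
    rw [e0, fluxJet_pderiv, hu.flux s hs _ (node_mem_segment hh hM hN hm)]
    rfl

end Truncation

/-! ### A barrier -/

/-- The derivatives of `P (x) + Q (y)` form a jet. -/
theorem isJet_add_separated {P Q : ℕ → ℝ → ℝ} (hP : ∀ k x, HasDerivAt (P k) (P (k + 1) x) x)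
    (hQ : ∀ k x, HasDerivAt (Q k) (Q (k + 1) x) x) (R : Set (ℝ × ℝ)) (n : ℕ) :
    IsJet R (1, 0) (0, 1) n
      fun k l z => (if l = 0 then P k z.1 else 0) + (if k = 0 then Q l z.2 else 0) := by
  intro k l _ p _
  have h1 : HasFDerivWithinAt (fun z : ℝ × ℝ => P k z.1)
      (P (k + 1) p.1 • ContinuousLinearMap.fst ℝ ℝ ℝ) R p :=
    ((hP k p.1).comp_hasFDerivAt p (f := Prod.fst) hasFDerivAt_fst).hasFDerivWithinAt
  have h2 : HasFDerivWithinAt (fun z : ℝ × ℝ => Q l z.2)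
      (Q (l + 1) p.2 • ContinuousLinearMap.snd ℝ ℝ ℝ) R p :=
    ((hQ l p.2).comp_hasFDerivAt p (f := Prod.snd) hasFDerivAt_snd).hasFDerivWithinAt
  refine ⟨(if l = 0 then P (k + 1) p.1 • ContinuousLinearMap.fst ℝ ℝ ℝ else 0)
    + (if k = 0 then Q (l + 1) p.2 • ContinuousLinearMap.snd ℝ ℝ ℝ else 0), ?_, ?_, ?_⟩
  · refine HasFDerivWithinAt.fun_add ?_ ?_
    · split_ifs
      · exact h1
      · exact hasFDerivWithinAt_const _ _ _
    · split_ifs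
      · exact h2
      · exact hasFDerivWithinAt_const _ _ _
  · split_ifs <;> simp_all
  · split_ifs <;> simp_all

/-- The one-dimensional ingredients of the barrier: a parabola with slopes `∓1` at the ends of the
first interval, and a multiple of an exponential, concave enough on the second one to outweigh
all other terms of the operator. -/
theorem exists_barrier_parts {xl xr : ℝ} (hx : xl < xr) (yl yr a b : ℝ) :
    ∃ P Q : ℕ → ℝ → ℝ, (∀ k x, HasDerivAt (P k) (P (k + 1) x) x) ∧
      (∀ k x, HasDerivAt (Q k) (Q (k + 1) x) x) ∧ P 1 xl = -1 ∧ P 1 xr = 1 ∧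
      (∀ x, ∀ y ∈ Icc yl yr, 1 ≤ P 0 x + Q 0 y) ∧
      ∀ x ∈ Icc xl xr, ∀ y ∈ Icc yl yr,
        P 2 x + Q 2 y + a * P 1 x + b * Q 1 y ≤ -2 := by
  set w := xr - xl with hw
  have hw0 : 0 < w := sub_pos.2 hx
  -- `c` outweighs `P'' + a P'` by two, and `m (m + b) ≥ 1` keeps `Q'' + b Q'` below `-c`
  set m := |b| + 1 with hm
  set c := 2 / w + |a| + 2 with hc
  have hc0 : 0 < c := by positivity
  have hm1 : 1 ≤ m := by rw [hm]; linarith [abs_nonneg b]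
  let P : ℕ → ℝ → ℝ := fun k x => match k with
    | 0 => (x - (xl + xr) / 2) ^ 2 / w
    | 1 => 2 * (x - (xl + xr) / 2) / w
    | 2 => 2 / w
    | _ => 0
  let Q : ℕ → ℝ → ℝ := fun k y =>
    (if k = 0 then 1 + c * Real.exp (m * (yr - yl)) else 0) - c * m ^ k * Real.exp (m * (y - yl))
  refine ⟨P, Q, ?_, ?_, ?_, ?_, ?_, ?_⟩
  · intro k x
    have h0 : HasDerivAt (fun x => x - (xl + xr) / 2) 1 x := (hasDerivAt_id x).sub_const _
    match k with
    | 0 => exact ((h0.pow 2).div_const w).congr_deriv (by simp [P])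
    | 1 => exact ((h0.const_mul 2).div_const w).congr_deriv (by simp [P])
    | 2 => exact hasDerivAt_const _ _
    | k + 3 => exact hasDerivAt_const _ _
  · intro k y
    have h0 : HasDerivAt (fun y => m * (y - yl)) m y := by
      simpa using ((hasDerivAt_id y).sub_const yl).const_mul m
    refine ((h0.exp.const_mul (c * m ^ k)).const_sub _).congr_deriv ?_
    simp [Q, pow_succ]; ring
  · simp only [P]; rw [div_eq_iff hw0.ne', hw]; ring
  · simp only [P]; rw [div_eq_iff hw0.ne', hw]; ring
  · intro x y hy
    have h1 : Real.exp (m * (y - yl)) ≤ Real.exp (m * (yr - yl)) :=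
      Real.exp_le_exp.2 (mul_le_mul_of_nonneg_left (by linarith [hy.2]) (by linarith))
    have h2 := mul_le_mul_of_nonneg_left h1 hc0.le
    have h3 : 0 ≤ (x - (xl + xr) / 2) ^ 2 / w := by positivity
    simp only [P, Q, if_true, pow_zero, mul_one]
    linarith
  · intro x hx y hy
    have he : 1 ≤ Real.exp (m * (y - yl)) :=
      Real.one_le_exp (mul_nonneg (by linarith) (by linarith [hy.1]))
    have hs : |2 * (x - (xl + xr) / 2) / w| ≤ 1 := by
      rw [abs_div, abs_of_pos hw0, div_le_one hw0, abs_le]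
      constructor <;> linarith [hx.1, hx.2]
    have ha : a * (2 * (x - (xl + xr) / 2) / w) ≤ |a| := by
      refine (le_abs_self _).trans ?_
      rw [abs_mul]; exact mul_le_of_le_one_right (abs_nonneg a) hs
    have hb : 1 ≤ m ^ 2 + b * m := by
      have : 0 ≤ m * (m + b - 1) :=
        mul_nonneg (by linarith) (by rw [hm]; linarith [neg_abs_le b])
      nlinarith
    have h4 : c ≤ c * ((m ^ 2 + b * m) * Real.exp (m * (y - yl))) :=
      le_mul_of_one_le_right hc0.le (one_le_mul_of_one_le_of_one_le hb he)
    simp [P, Q]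
    linarith

/-- `W` is the jet of a function that is positive on the rectangle, on which the differential
operator is at most `-2`, and which decreases from the sides in `S` inwards at rate at least one;
`B` bounds it and its derivatives. -/
structure IsBarrier (xl xr yl yr a b K : ℝ) (S : Set Side) (B : ℝ)
    (W : ℕ → ℕ → ℝ × ℝ → ℝ) : Prop where
  jet : IsJet (rect xl xr yl yr) (1, 0) (0, 1) 3 W
  bound : ∀ k l, k + l ≤ 3 → ∀ z ∈ rect xl xr yl yr, |W k l z| ≤ B
  one_le : ∀ z ∈ rect xl xr yl yr, 1 ≤ W 0 0 z
  source : ∀ z ∈ rect xl xr yl yr, sourceJet a b K W 0 0 z ≤ -2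
  flux : ∀ s ∈ S, ∀ z ∈ s.segment xl xr yl yr, s.jet W 1 0 z ≤ -1

theorem IsJet.exists_bound {R : Set (ℝ × ℝ)} (hR : IsCompact R) {ν τ : ℝ × ℝ} {n : ℕ}
    {W : ℕ → ℕ → ℝ × ℝ → ℝ} (hW : IsJet R ν τ (n + 1) W) :
    ∃ B, ∀ k l, k + l ≤ n → ∀ z ∈ R, |W k l z| ≤ B := by
  have h1 : ∀ k l, ∃ B, 0 ≤ B ∧ (k + l ≤ n → ∀ z ∈ R, |W k l z| ≤ B) := by
    intro k l
    by_cases hkl : k + l ≤ n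
    · have hc : ContinuousOn (W k l) R := fun p hp =>
        let ⟨_, hL, _⟩ := hW k l (by omega) p hp
        hL.continuousWithinAt
      obtain ⟨B, hB⟩ := hR.exists_bound_of_continuousOn hc
      exact ⟨max B 0, le_max_right _ _, fun _ z hz => (hB z hz).trans (le_max_left _ _)⟩
    · exact ⟨0, le_rfl, fun h => absurd h hkl⟩
  choose B hB0 hB using h1
  refine ⟨∑ k ∈ Finset.range (n + 1), ∑ l ∈ Finset.range (n + 1), B k l,
    fun k l hkl z hz => (hB k l hkl z hz).trans ?_⟩
  refine le_trans ?_ (Finset.single_le_sum (f := fun k => ∑ l ∈ Finset.range (n + 1), B k l)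
    (fun k _ => Finset.sum_nonneg fun l _ => hB0 k l) (Finset.mem_range.2 (by omega : k < n + 1)))
  exact Finset.single_le_sum (f := fun l => B k l) (fun l _ => hB0 k l)
    (Finset.mem_range.2 (by omega : l < n + 1))

theorem exists_isBarrier {xl xr yl yr : ℝ} (hx : xl < xr) (hy : yl < yr) (a b : ℝ) {K : ℝ}
    (hK : K ≤ 0) {S : Set Side}
    (hS : S ⊆ {Side.left, Side.right} ∨ S ⊆ {Side.bottom, Side.top}) :
    ∃ B W, IsBarrier xl xr yl yr a b K S B W := by
  have main : ∀ P Q : ℕ → ℝ → ℝ, (∀ k x, HasDerivAt (P k) (P (k + 1) x) x) →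
      (∀ k x, HasDerivAt (Q k) (Q (k + 1) x) x) →
      (∀ x ∈ Icc xl xr, ∀ y ∈ Icc yl yr, 1 ≤ P 0 x + Q 0 y) →
      (∀ x ∈ Icc xl xr, ∀ y ∈ Icc yl yr, P 2 x + Q 2 y + a * P 1 x + b * Q 1 y ≤ -2) →
      (∀ s ∈ S, ∀ z ∈ s.segment xl xr yl yr,
        s.inward.1 * P 1 z.1 + s.inward.2 * Q 1 z.2 ≤ -1) →
      ∃ B W, IsBarrier xl xr yl yr a b K S B W := by
    intro P Q hP hQ h1 h2 h3
    have hJ := isJet_add_separated hP hQ (rect xl xr yl yr) 4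
    obtain ⟨B, hB⟩ := hJ.exists_bound (isCompact_Icc.prod isCompact_Icc)
    refine ⟨B, _, hJ.mono (by norm_num), hB, ?_, ?_, ?_⟩
    · intro z hz
      simpa using h1 z.1 hz.1 z.2 hz.2
    · intro z hz
      have e1 := h1 z.1 hz.1 z.2 hz.2
      have e2 := h2 z.1 hz.1 z.2 hz.2
      have e3 : K * (P 0 z.1 + Q 0 z.2) ≤ 0 := mul_nonpos_of_nonpos_of_nonneg hK (by linarith)
      simp [sourceJet]
      linarith
    · intro s hs z hz
      refine le_of_eq_of_le ?_ (h3 s hs z hz)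
      cases s <;> simp [Side.jet, Side.inward]
  rcases hS with hS | hS
  · obtain ⟨P, Q, hP, hQ, hl, hr, h1, h2⟩ := exists_barrier_parts hx yl yr a b
    refine main P Q hP hQ (fun x _ y hy => h1 x y hy) h2 fun s hs z hz => ?_
    rcases hS hs with rfl | rfl
    · have : z.1 = xl := hz.1
      simp [Side.inward, this, hl]
    · have : z.1 = xr := hz.1
      simp [Side.inward, this, hr]
  · obtain ⟨P, Q, hP, hQ, hl, hr, h1, h2⟩ := exists_barrier_parts hy xl xr b a
    refine main Q P hQ hP (fun x hx y _ => by linarith [h1 y x hx])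
      (fun x hx y hy => by linarith [h2 y hy x hx]) fun s hs z hz => ?_
    rcases hS hs with rfl | rfl
    · have : z.2 = yl := hz.2
      simp [Side.inward, this, hl]
    · have : z.2 = yr := hz.2
      simp [Side.inward, this, hr]

/-! ### The stencils applied to the barrier -/

theorem sum_mul_taylorSum_three {m n : ℕ} (ξ : Fin m → ℝ) (η : Fin n → ℝ)
    (c : Fin m → Fin n → ℝ) (W : ℕ → ℕ → ℝ × ℝ → ℝ) (p : ℝ × ℝ) (h : ℝ) :
    ∑ i, ∑ j, c i j * taylorSum 3 W p (ξ i * h) (η j * h) =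
      moment ξ η c 0 0 * W 0 0 p + h * moment ξ η c 1 0 * W 1 0 p
        + h * moment ξ η c 0 1 * W 0 1 p + h ^ 2 * moment ξ η c 2 0 * (W 2 0 p / 2)
        + h ^ 2 * moment ξ η c 1 1 * W 1 1 p + h ^ 2 * moment ξ η c 0 2 * (W 0 2 p / 2) := by
  simp only [moment, Finset.sum_mul, Finset.mul_sum, ← Finset.sum_add_distrib]
  refine Finset.sum_congr rfl fun i _ => Finset.sum_congr rfl fun j _ => ?_
  simp [taylorSum, Finset.sum_range_succ, jetStep]
  ring

theorem sum_mul_taylorSum_two {m n : ℕ} (ξ : Fin m → ℝ) (η : Fin n → ℝ)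
    (c : Fin m → Fin n → ℝ) (W : ℕ → ℕ → ℝ × ℝ → ℝ) (p : ℝ × ℝ) (h : ℝ) :
    ∑ i, ∑ j, c i j * taylorSum 2 W p (ξ i * h) (η j * h) =
      moment ξ η c 0 0 * W 0 0 p + h * moment ξ η c 1 0 * W 1 0 p
        + h * moment ξ η c 0 1 * W 0 1 p := by
  simp only [moment, Finset.sum_mul, Finset.mul_sum, ← Finset.sum_add_distrib]
  refine Finset.sum_congr rfl fun i _ => Finset.sum_congr rfl fun j _ => ?_
  simp [taylorSum, Finset.sum_range_succ, jetStep]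
  ring

theorem mul_le_add_mul_of_abs_sub_le {x y w ε B : ℝ} (hxy : |x - y| ≤ ε) (hw : |w| ≤ B) :
    x * w ≤ y * w + ε * B := by
  have h1 : (x - y) * w ≤ ε * B := by
    refine (le_abs_self _).trans ?_
    rw [abs_mul]
    exact mul_le_mul hxy hw (abs_nonneg _) ((abs_nonneg _).trans hxy)
  linarith

/-- For small `h` the interior stencil maps the barrier below `-1`: its second order Taylor
polynomial is mapped to an `O(h)` perturbation of the differential operator. -/
theorem sum_interiorAlpha_mul_le {a b K h C B : ℝ} (hS : InteriorStencilBounds a b K h C)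
    (hh : 0 < h) (hC : 0 ≤ C) (hCh : C * h ≤ 1) {R : Set (ℝ × ℝ)} (hR : Convex ℝ R)
    {ν τ : ℝ × ℝ} {W : ℕ → ℕ → ℝ × ℝ → ℝ} (hW : IsJet R ν τ 3 W)
    (hB : ∀ k l, k + l ≤ 3 → ∀ z ∈ R, |W k l z| ≤ B) (hsmall : (5 * C + 360) * B * h ≤ 1)
    {p : ℝ × ℝ} (hp : p ∈ R) (hsrc : sourceJet a b K W 0 0 p ≤ -2)
    {q : Fin 3 → Fin 3 → ℝ × ℝ} (hqR : ∀ i j, q i j ∈ R)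
    (hq : ∀ i j, q i j = p + ((pos₃ i * h) • ν + (pos₃ j * h) • τ)) :
    ∑ i, ∑ j, interiorAlpha a b K h i j * W 0 0 (q i j) ≤ -1 := by
  have hB0 : 0 ≤ B := (abs_nonneg _).trans (hB 0 0 (by norm_num) p hp)
  have hα5 : ∀ i j, |interiorAlpha a b K h i j| ≤ 5 / h ^ 2 := fun i j =>
    abs_le_div_sq_of_scaled hh hCh (abs_interiorLimit_le i j) (hS.abs_alpha i j)
  have e1 := abs_sum_sum_mul_le (Y := B * (2 * h) ^ 3) (by positivity) hα5
    (y := fun i j => W 0 0 (q i j) - taylorSum 3 W p (pos₃ i * h) (pos₃ j * h)) fun i j =>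
      (hW.abs_sub_taylor_le hR 3 hp (hqR i j) (hq i j) fun k l hkl => hB k l (by omega)).trans
        (mul_le_mul_of_nonneg_left
          (pow_le_pow_left₀ (by positivity) (abs_add_abs_pos₃_mul_le i j hh) 3) hB0)
  simp only [mul_sub, Finset.sum_sub_distrib] at e1
  have e1' : ((3 : ℕ) : ℝ) * (3 : ℕ) * (5 / h ^ 2 * (B * (2 * h) ^ 3)) = 360 * B * h := by
    field_simp; push_cast; ring
  rw [e1', sum_mul_taylorSum_three] at e1
  obtain ⟨l00, l10, l01, l20, l11, l02⟩ := hS.low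
  have half : ∀ {x : ℝ}, |x| ≤ B → |x / 2| ≤ B / 2 := fun {x} hx => by
    rw [abs_div, abs_of_pos (two_pos : (0 : ℝ) < 2)]; linarith
  have b00 := mul_le_add_mul_of_abs_sub_le l00 (hB 0 0 (by norm_num) p hp)
  have b10 := mul_le_add_mul_of_abs_sub_le l10 (hB 1 0 (by norm_num) p hp)
  have b01 := mul_le_add_mul_of_abs_sub_le l01 (hB 0 1 (by norm_num) p hp)
  have b20 := mul_le_add_mul_of_abs_sub_le l20 (half (hB 2 0 (by norm_num) p hp))
  have b11 := mul_le_add_mul_of_abs_sub_le (y := 0) (by rwa [sub_zero])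
    (hB 1 1 (by norm_num) p hp) (ε := C * h)
    (x := h ^ 2 * moment pos₃ pos₃ (interiorAlpha a b K h) 1 1)
  have b02 := mul_le_add_mul_of_abs_sub_le l02 (half (hB 0 2 (by norm_num) p hp))
  have e2 := (abs_le.1 e1).2
  simp only [sourceJet, zero_add] at hsrc
  have : 0 ≤ C * h * B := by positivity
  linarith only [e2, b00, b10, b01, b20, b11, b02, hsrc, hsmall, this]

/-- For small `h` the flux stencil maps the barrier below `-1 / h`: the leading term of its image is
the normal derivative times `2 / h`, all others are bounded above. -/
theorem sum_fluxAlpha_mul_le {a b K σ h C B : ℝ} (hS : FluxStencilBounds a b K σ h C)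
    (hh : 0 < h) (hC : 0 ≤ C) (hCh : C * h ≤ 1) {R : Set (ℝ × ℝ)} (hR : Convex ℝ R)
    {ν τ : ℝ × ℝ} {W : ℕ → ℕ → ℝ × ℝ → ℝ} (hW : IsJet R ν τ 2 W)
    (hB : ∀ k l, k + l ≤ 2 → ∀ z ∈ R, |W k l z| ≤ B) (hsmall : (3 * C + 120) * B * h ≤ 1)
    {p : ℝ × ℝ} (hp : p ∈ R) (hpos : 0 ≤ W 0 0 p) (hν : W 1 0 p ≤ -1)
    {q : Fin 2 → Fin 3 → ℝ × ℝ} (hqR : ∀ i j, q i j ∈ R)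
    (hq : ∀ i j, q i j = p + ((pos₂ i * h) • ν + (pos₃ j * h) • τ)) :
    ∑ i, ∑ j, fluxAlpha a b K σ h i j * W 0 0 (q i j) ≤ -(1 / h) := by
  have hB0 : 0 ≤ B := (abs_nonneg _).trans (hB 0 0 (by norm_num) p hp)
  have hα5 : ∀ i j, |fluxAlpha a b K σ h i j| ≤ 5 / h ^ 2 := fun i j =>
    abs_le_div_sq_of_scaled hh hCh (abs_fluxLimit_le i j) (hS.abs_alpha i j)
  have e1 := abs_sum_sum_mul_le (Y := B * (2 * h) ^ 2) (by positivity) hα5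
    (y := fun i j => W 0 0 (q i j) - taylorSum 2 W p (pos₂ i * h) (pos₃ j * h)) fun i j => by
      refine (hW.abs_sub_taylor_le hR 2 hp (hqR i j) (hq i j)
        fun k l hkl => hB k l (by omega)).trans
        (mul_le_mul_of_nonneg_left (pow_le_pow_left₀ (by positivity) ?_ 2) hB0)
      rw [abs_mul, abs_mul, abs_of_pos hh]
      nlinarith [abs_pos₂_le i, abs_pos₃_le j]
  simp only [mul_sub, Finset.sum_sub_distrib] at e1
  have e1' : ((2 : ℕ) : ℝ) * (3 : ℕ) * (5 / h ^ 2 * (B * (2 * h) ^ 2)) = 120 * B := by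
    field_simp; push_cast; ring
  rw [e1', sum_mul_taylorSum_two] at e1
  obtain ⟨l00, l10, l01⟩ := hS.low
  have b00 : moment pos₂ pos₃ (fluxAlpha a b K σ h) 0 0 * W 0 0 p ≤ C * B :=
    (mul_le_mul_of_nonneg_right l00 hpos).trans
      (mul_le_mul_of_nonneg_left ((le_abs_self _).trans (hB 0 0 (by norm_num) p hp)) hC)
  have b10 := mul_le_add_mul_of_abs_sub_le l10 (hB 1 0 (by norm_num) p hp)
  have b01 := mul_le_add_mul_of_abs_sub_le (y := 0) (by rwa [sub_zero])
    (hB 0 1 (by norm_num) p hp) (ε := C * h)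
    (x := h ^ 2 * moment pos₂ pos₃ (fluxAlpha a b K σ h) 0 1)
  have e2 := mul_le_mul_of_nonneg_left (abs_le.1 e1).2 hh.le
  have b00' := mul_le_mul_of_nonneg_left b00 hh.le
  rw [← neg_div, le_div_iff₀ hh]
  linarith only [e2, b00', b10, b01, hν, hsmall]

theorem interiorAlpha_nonneg {a b K h C : ℝ} (hS : InteriorStencilBounds a b K h C)
    (hh : 0 < h) (hCh : 6 * (C * h) ≤ 1) {i j : Fin 3} (hij : ¬(i = 1 ∧ j = 1)) :
    0 ≤ interiorAlpha a b K h i j := by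
  have h1 : 1 / 6 ≤ interiorLimit i j := by
    fin_cases i <;> fin_cases j <;> simp_all [interiorLimit, Matrix.cons_val] <;> norm_num
  have h2 := (abs_le.1 (hS.abs_alpha i j)).1
  exact nonneg_of_mul_nonneg_right (by linarith) (by positivity : 0 < h ^ 2)

theorem fluxAlpha_nonneg {a b K σ h C : ℝ} (hS : FluxStencilBounds a b K σ h C)
    (hh : 0 < h) (hCh : 6 * (C * h) ≤ 1) {i : Fin 2} {j : Fin 3} (hij : ¬(i = 0 ∧ j = 1)) :
    0 ≤ fluxAlpha a b K σ h i j := by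
  have h1 : 1 / 6 ≤ fluxLimit i j := by
    fin_cases i <;> fin_cases j <;> simp_all [fluxLimit, Matrix.cons_val] <;> norm_num
  have h2 := (abs_le.1 (hS.abs_alpha i j)).1
  exact nonneg_of_mul_nonneg_right (by linarith) (by positivity : 0 < h ^ 2)

/-! ### The discrete maximum principle -/

/-- A linear operator on grid functions with a positive supersolution `φ` obeys a maximum
principle on a finite set `G`, if it is of nonnegative type at the points of `Ω` (a function that
attains a nonnegative maximum zero at `p` has a nonpositive image there). At a maximum of the
quotient by `φ` the two properties clash. -/
theorem le_mul_of_supersolution {ι : Type*} {G Ω : Set ι} (hG : G.Finite)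
    {L : (ι → ℝ) →ₗ[ℝ] (ι → ℝ)}
    (hL : ∀ p ∈ Ω, ∀ w : ι → ℝ, (∀ q ∈ G, w q ≤ 0) → w p = 0 → L w p ≤ 0)
    {φ θ : ι → ℝ} (hφ : ∀ p ∈ G, 0 < φ p) (hθ : ∀ p ∈ Ω, 0 < θ p)
    (hLφ : ∀ p ∈ Ω, L φ p ≤ -θ p) {T : ℝ} (hT : 0 ≤ T) {V : ι → ℝ}
    (hV : ∀ p ∈ Ω, -(T * θ p) ≤ L V p) (hV0 : ∀ p ∈ G, p ∉ Ω → V p ≤ 0) :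
    ∀ p ∈ G, V p ≤ T * φ p := by
  intro p₀ hp₀
  obtain ⟨p, hp, hmax⟩ := hG.exists_maximalFor (fun q => (V q - T * φ q) / φ q) G ⟨p₀, hp₀⟩
  replace hmax : ∀ q ∈ G, (V q - T * φ q) / φ q ≤ (V p - T * φ p) / φ p := fun q hq => by
    rcases le_total ((V p - T * φ p) / φ p) ((V q - T * φ q) / φ q) with h | h
    · exact hmax hq h
    · exact h
  -- if the maximal quotient `ρ` were positive, `V - (T + ρ) φ` would attain its maximum zero at `p`,
  -- while its image there is positive
  set ρ := (V p - T * φ p) / φ p with hρ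
  have hρp : V p - T * φ p = ρ * φ p := by rw [hρ, div_mul_cancel₀ _ (hφ p hp).ne']
  have hle : ∀ q ∈ G, V q - T * φ q ≤ ρ * φ q := fun q hq => (div_le_iff₀ (hφ q hq)).1 (hmax q hq)
  suffices hρ0 : ρ ≤ 0 by
    have := hle p₀ hp₀
    have := mul_nonpos_of_nonpos_of_nonneg hρ0 (hφ p₀ hp₀).le
    linarith
  by_contra! hρ0
  have hpΩ : p ∈ Ω := by
    by_contra hpΩ
    have h1 := hV0 p hp hpΩ
    have h2 := mul_nonneg hT (hφ p hp).le
    have h3 := mul_pos hρ0 (hφ p hp)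
    linarith
  have h1 := hL p hpΩ (V - T • φ - ρ • φ) (fun q hq => by simpa using hle q hq)
    (by simp [hρp])
  simp only [map_sub, map_smul, Pi.sub_apply, Pi.smul_apply, smul_eq_mul] at h1
  have h2 := hV p hpΩ
  have h3 := mul_le_mul_of_nonneg_left (hLφ p hpΩ) (by linarith : 0 ≤ T + ρ)
  have h4 := mul_pos hρ0 (hθ p hpΩ)
  linarith

theorem abs_le_mul_of_supersolution {ι : Type*} {G Ω : Set ι} (hG : G.Finite)
    {L : (ι → ℝ) →ₗ[ℝ] (ι → ℝ)}
    (hL : ∀ p ∈ Ω, ∀ w : ι → ℝ, (∀ q ∈ G, w q ≤ 0) → w p = 0 → L w p ≤ 0)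
    {φ θ : ι → ℝ} (hφ : ∀ p ∈ G, 0 < φ p) (hθ : ∀ p ∈ Ω, 0 < θ p)
    (hLφ : ∀ p ∈ Ω, L φ p ≤ -θ p) {T : ℝ} (hT : 0 ≤ T) {V : ι → ℝ}
    (hV : ∀ p ∈ Ω, |L V p| ≤ T * θ p) (hV0 : ∀ p ∈ G, p ∉ Ω → V p = 0) :
    ∀ p ∈ G, |V p| ≤ T * φ p := by
  intro p hp
  refine abs_le.2 ⟨?_, ?_⟩
  · have := le_mul_of_supersolution hG hL hφ hθ hLφ hT (V := -V)
      (fun q hq => by simpa using (abs_le.1 (hV q hq)).2)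
      (fun q hq hq' => by simp [hV0 q hq hq']) p hp
    rw [Pi.neg_apply] at this
    linarith
  · exact le_mul_of_supersolution hG hL hφ hθ hLφ hT (fun q hq => (abs_le.1 (hV q hq)).1)
      (fun q hq hq' => (hV0 q hq hq').le) p hp

/-- The maximum principle makes the operator injective, hence bijective, on functions on `G`. -/
theorem exists_eqOn_of_supersolution {ι : Type*} {G Ω : Set ι} (hG : G.Finite)
    (hΩ : Ω ⊆ G) {L : (ι → ℝ) →ₗ[ℝ] (ι → ℝ)}
    (hL : ∀ p ∈ Ω, ∀ w : ι → ℝ, (∀ q ∈ G, w q ≤ 0) → w p = 0 → L w p ≤ 0)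
    (hL' : ∀ p ∈ G, p ∉ Ω → ∀ w, L w p = w p)
    {φ θ : ι → ℝ} (hφ : ∀ p ∈ G, 0 < φ p) (hθ : ∀ p ∈ Ω, 0 < θ p)
    (hLφ : ∀ p ∈ Ω, L φ p ≤ -θ p) (r : ι → ℝ) : ∃ U : ι → ℝ, EqOn (L U) r G := by
  have := hG.to_subtype
  let ext : (G → ℝ) →ₗ[ℝ] (ι → ℝ) := Function.ExtendByZero.linearMap ℝ (Subtype.val : G → ι)
  have hext : ∀ v (p : G), ext v p = v p := fun v p =>
    Subtype.val_injective.extend_apply v 0 p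
  let A : (G → ℝ) →ₗ[ℝ] (G → ℝ) := (LinearMap.funLeft ℝ ℝ (Subtype.val : G → ι)) ∘ₗ L ∘ₗ ext
  have hA : ∀ v (p : G), A v p = L (ext v) p := fun v p => rfl
  have hinj : Function.Injective A := by
    rw [← LinearMap.ker_eq_bot, LinearMap.ker_eq_bot']
    intro v hv
    have h0 : ∀ p ∈ G, L (ext v) p = 0 := fun p hp => by
      rw [← hA v ⟨p, hp⟩, hv]; rfl
    ext p
    have := abs_le_mul_of_supersolution hG hL hφ hθ hLφ le_rfl (V := ext v)
      (fun q hq => by rw [h0 q (hΩ hq)]; simp)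
      (fun q hq hq' => by rw [← hL' q hq hq' (ext v), h0 q hq]) p p.2
    rw [zero_mul, hext] at this
    exact abs_nonpos_iff.1 this
  obtain ⟨v, hv⟩ := LinearMap.injective_iff_surjective.1 hinj fun p => r p
  exact ⟨ext v, fun p hp => by rw [← hA v ⟨p, hp⟩, hv]⟩

/-! ### Stability of the scheme -/

/-- The interior stencil at `p`, as a linear form on grid functions. -/
noncomputable def interiorOp (a b K h : ℝ) (p : ℤ × ℤ) : (ℤ × ℤ → ℝ) →ₗ[ℝ] ℝ :=
  ∑ i : Fin 3, ∑ j : Fin 3, interiorAlpha a b K h i j • LinearMap.proj (p + (off i, off j))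

/-- The flux stencil of the side `s` at `p`, as a linear form on grid functions. -/
noncomputable def fluxOp (a b K σ h : ℝ) (s : Side) (p : ℤ × ℤ) : (ℤ × ℤ → ℝ) →ₗ[ℝ] ℝ :=
  ∑ i : Fin 2, ∑ j : Fin 3, sideStencil a b K σ h s (.inl (i, j)) •
    LinearMap.proj (p + ((i : ℕ) : ℤ) • s.inward + off j • s.tangent)

theorem interiorOp_apply (a b K h : ℝ) (p : ℤ × ℤ) (V : ℤ × ℤ → ℝ) :
    interiorOp a b K h p V =
      ∑ i : Fin 3, ∑ j : Fin 3, interiorAlpha a b K h i j * V (p + (off i, off j)) := by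
  simp [interiorOp]

theorem fluxOp_apply (a b K σ h : ℝ) (s : Side) (p : ℤ × ℤ) (V : ℤ × ℤ → ℝ) :
    fluxOp a b K σ h s p V =
      ∑ i : Fin 2, ∑ j : Fin 3, sideStencil a b K σ h s (.inl (i, j)) *
        V (p + ((i : ℕ) : ℤ) • s.inward + off j • s.tangent) := by
  simp [fluxOp]

theorem interiorDefect_eq (a b K h : ℝ) (F V : ℤ × ℤ → ℝ) (p : ℤ × ℤ) :
    interiorDefect a b K h F V p = interiorOp a b K h p V + interiorDefect a b K h F 0 p := by
  simp [interiorDefect, interiorOp_apply, interiorAlpha, sub_eq_add_neg]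

theorem fluxDefect_eq (a b K σ h : ℝ) (s : Side) (F G V : ℤ × ℤ → ℝ) (p : ℤ × ℤ) :
    fluxDefect a b K σ h s F G V p =
      fluxOp a b K σ h s p V + fluxDefect a b K σ h s F G 0 p := by
  simp [fluxDefect, fluxOp_apply]; ring

open Classical in
/-- The left side of the scheme: the stencils at the interior and flux boundary points, and the
value itself at all other points. -/
noncomputable def hocOp (a b K σ h : ℝ) (M N : ℕ) (S : Set Side) :
    (ℤ × ℤ → ℝ) →ₗ[ℝ] (ℤ × ℤ → ℝ) :=
  LinearMap.pi fun p =>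
    if p ∈ interiorPts M N then interiorOp a b K h p
    else if hs : ∃ s ∈ S, p ∈ s.innerPts M N then fluxOp a b K σ h hs.choose p
    else LinearMap.proj p

/-- The grid points at which the scheme has a stencil equation. -/
def stencilPts (M N : ℕ) (S : Set Side) : Set (ℤ × ℤ) :=
  interiorPts M N ∪ {p | ∃ s ∈ S, p ∈ s.innerPts M N}

theorem stencilPts_subset_gridPts (M N : ℕ) (S : Set Side) : stencilPts M N S ⊆ gridPts M N := by
  rintro p (hp | ⟨s, _, hp⟩)
  · exact interiorPts_subset_gridPts M N hp
  · exact s.pts_subset_gridPts M N (s.innerPts_subset_pts M N hp)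

theorem Side.notMem_interiorPts {M N : ℕ} {s : Side} {p : ℤ × ℤ} (hp : p ∈ s.pts M N) :
    p ∉ interiorPts M N := by
  obtain ⟨x, y⟩ := p
  cases s <;> simp only [Side.pts, interiorPts, mem_prod, mem_singleton_iff, mem_Icc, mem_Ioo]
    at hp ⊢ <;> omega

theorem Side.eq_of_mem_innerPts {M N : ℕ} (hM : 1 ≤ M) (hN : 1 ≤ N) {s s' : Side} {p : ℤ × ℤ}
    (hp : p ∈ s.innerPts M N) (hp' : p ∈ s'.pts M N) : s = s' := by
  obtain ⟨x, y⟩ := p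
  cases s <;> cases s' <;> simp only [Side.pts, Side.innerPts, mem_prod, mem_singleton_iff,
    mem_Icc, mem_Ioo] at hp hp' ⊢ <;> omega

/-- The remaining grid points lie on Dirichlet sides. In particular so do the corners, because
the flux sides are contained in a pair of opposite sides. -/
theorem exists_mem_pts_of_notMem_stencilPts {M N : ℕ} {S : Set Side}
    (hS : S ⊆ {Side.left, Side.right} ∨ S ⊆ {Side.bottom, Side.top}) {p : ℤ × ℤ}
    (hp : p ∈ gridPts M N) (hp' : p ∉ stencilPts M N S) : ∃ s ∉ S, p ∈ s.pts M N := by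
  by_contra! hc
  have hin : ∀ s : Side, p ∉ s.innerPts M N := fun s hs =>
    hc s (fun hsS => hp' (Or.inr ⟨s, hsS, hs⟩)) (s.innerPts_subset_pts M N hs)
  have hint : p ∉ interiorPts M N := fun h => hp' (Or.inl h)
  have hi1 := hin .left
  have hi2 := hin .right
  have hi3 := hin .bottom
  have hi4 := hin .top
  rcases hS with hS | hS
  · have h1 := hc .bottom fun h => by simpa using hS h
    have h2 := hc .top fun h => by simpa using hS h
    obtain ⟨x, y⟩ := p
    simp only [Side.pts, Side.innerPts, interiorPts, gridPts, mem_prod, mem_singleton_iff,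
      mem_Icc, mem_Ioo] at *
    omega
  · have h1 := hc .left fun h => by simpa using hS h
    have h2 := hc .right fun h => by simpa using hS h
    obtain ⟨x, y⟩ := p
    simp only [Side.pts, Side.innerPts, interiorPts, gridPts, mem_prod, mem_singleton_iff,
      mem_Icc, mem_Ioo] at *
    omega

theorem notMem_stencilPts {M N : ℕ} (hM : 1 ≤ M) (hN : 1 ≤ N) {S : Set Side} {s : Side}
    (hs : s ∉ S) {p : ℤ × ℤ} (hp : p ∈ s.pts M N) : p ∉ stencilPts M N S := by
  rintro (h | ⟨s', hs', h⟩)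
  · exact s.notMem_interiorPts hp h
  · exact hs (Side.eq_of_mem_innerPts hM hN h hp ▸ hs')

theorem hocOp_interior {a b K σ h : ℝ} {M N : ℕ} {S : Set Side} {p : ℤ × ℤ}
    (hp : p ∈ interiorPts M N) (V : ℤ × ℤ → ℝ) :
    hocOp a b K σ h M N S V p = interiorOp a b K h p V := by
  simp [hocOp, hp]

theorem hocOp_flux {a b K σ h : ℝ} {M N : ℕ} (hM : 1 ≤ M) (hN : 1 ≤ N) {S : Set Side} {s : Side}
    (hs : s ∈ S) {p : ℤ × ℤ} (hp : p ∈ s.innerPts M N) (V : ℤ × ℤ → ℝ) :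
    hocOp a b K σ h M N S V p = fluxOp a b K σ h s p V := by
  have h1 := s.notMem_interiorPts (s.innerPts_subset_pts M N hp)
  have h2 : ∃ s ∈ S, p ∈ s.innerPts M N := ⟨s, hs, hp⟩
  have h3 : h2.choose = s := Side.eq_of_mem_innerPts hM hN h2.choose_spec.2
    (s.innerPts_subset_pts M N hp)
  simp only [hocOp, LinearMap.pi_apply, if_neg h1, dif_pos h2, h3]

theorem hocOp_of_notMem {a b K σ h : ℝ} {M N : ℕ} {S : Set Side} {p : ℤ × ℤ}
    (hp : p ∉ stencilPts M N S) (V : ℤ × ℤ → ℝ) : hocOp a b K σ h M N S V p = V p := by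
  have h1 : p ∉ interiorPts M N := fun h => hp (Or.inl h)
  have h2 : ¬∃ s ∈ S, p ∈ s.innerPts M N := fun h => hp (Or.inr h)
  simp only [hocOp, LinearMap.pi_apply, if_neg h1, dif_neg h2, LinearMap.proj_apply]

/-- The mesh is fine enough for the stencils to be close to their limits, with constants `CI` and
`CF`, and for the barrier `W` with bound `B` to be a discrete supersolution. -/
structure IsFineMesh (xl xr yl yr a b K σ : ℝ) (S : Set Side) (CI CF B : ℝ)
    (W : ℕ → ℕ → ℝ × ℝ → ℝ) (h : ℝ) (M N : ℕ) : Prop where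
  pos : 0 < h
  width : M * h = xr - xl
  height : N * h = yr - yl
  two_le_M : 2 ≤ M
  two_le_N : 2 ≤ N
  sides : S ⊆ {Side.left, Side.right} ∨ S ⊆ {Side.bottom, Side.top}
  interior : InteriorStencilBounds a b K h CI
  flux : ∀ s : Side, FluxStencilBounds (a * s.inward.1 + b * s.inward.2)
    (a * s.tangent.1 + b * s.tangent.2) K σ h CF
  nonneg_CI : 0 ≤ CI
  nonneg_CF : 0 ≤ CF
  small_CI : 6 * (CI * h) ≤ 1
  small_CF : 6 * (CF * h) ≤ 1
  barrier : IsBarrier xl xr yl yr a b K S B W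
  small_interior : (5 * CI + 360) * B * h ≤ 1
  small_flux : (3 * CF + 120) * B * h ≤ 1

namespace IsFineMesh

variable {xl xr yl yr a b K σ CI CF B h : ℝ} {S : Set Side} {W : ℕ → ℕ → ℝ × ℝ → ℝ} {M N : ℕ}

theorem hocOp_nonpos (H : IsFineMesh xl xr yl yr a b K σ S CI CF B W h M N) :
    ∀ p ∈ stencilPts M N S, ∀ w : ℤ × ℤ → ℝ, (∀ q ∈ gridPts M N, w q ≤ 0) → w p = 0 →
      hocOp a b K σ h M N S w p ≤ 0 := by
  rintro p (hp | ⟨s, hs, hp⟩) w hw h0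
  · rw [hocOp_interior hp, interiorOp_apply]
    refine Finset.sum_nonpos fun i _ => Finset.sum_nonpos fun j _ => ?_
    by_cases hij : i = 1 ∧ j = 1
    · obtain ⟨rfl, rfl⟩ := hij
      have : p + (off 1, off 1) = p := by simp [off]
      rw [this, h0, mul_zero]
    · exact mul_nonpos_of_nonneg_of_nonpos
        (interiorAlpha_nonneg H.interior H.pos H.small_CI hij) (hw _ (add_off_mem_gridPts hp i j))
  · have hM := H.two_le_M
    have hN := H.two_le_N
    rw [hocOp_flux (by omega) (by omega) hs hp, fluxOp_apply]
    refine Finset.sum_nonpos fun i _ => Finset.sum_nonpos fun j _ => ?_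
    by_cases hij : i = 0 ∧ j = 1
    · obtain ⟨rfl, rfl⟩ := hij
      have : p + (((0 : Fin 2) : ℕ) : ℤ) • s.inward + off 1 • s.tangent = p := by simp [off]
      rw [this, h0, mul_zero]
    · exact mul_nonpos_of_nonneg_of_nonpos (fluxAlpha_nonneg (H.flux s) H.pos H.small_CF hij)
        (hw _ (add_inward_mem_gridPts hM hN hp (by omega) j))

open Classical in
theorem hocOp_barrier_le (H : IsFineMesh xl xr yl yr a b K σ S CI CF B W h M N) :
    ∀ p ∈ stencilPts M N S, hocOp a b K σ h M N S (fun q => W 0 0 (node xl yl h q)) p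
      ≤ -(if p ∈ interiorPts M N then 1 else 1 / h) := by
  have hnode : ∀ {p}, p ∈ gridPts M N → node xl yl h p ∈ rect xl xr yl yr :=
    fun hp => node_mem_rect H.pos H.width H.height hp
  rintro p (hp | ⟨s, hs, hp⟩)
  · rw [hocOp_interior hp, interiorOp_apply, if_pos hp]
    have hp' := hnode (interiorPts_subset_gridPts M N hp)
    exact sum_interiorAlpha_mul_le H.interior H.pos H.nonneg_CI
      (by have := H.small_CI; have := mul_nonneg H.nonneg_CI H.pos.le; linarith)
      (convex_rect xl xr yl yr) H.barrier.jet H.barrier.bound H.small_interior hp'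
      (H.barrier.source _ hp') (fun i j => hnode (add_off_mem_gridPts hp i j))
      (fun i j => by rw [node_add]; ext <;> simp [toPlane, pos₃, mul_comm])
  · have hM := H.two_le_M
    have hN := H.two_le_N
    have hps := s.innerPts_subset_pts M N hp
    have hp' := hnode (s.pts_subset_gridPts M N hps)
    rw [hocOp_flux (by omega) (by omega) hs hp, fluxOp_apply,
      if_neg (s.notMem_interiorPts hps)]
    have key := sum_fluxAlpha_mul_le (H.flux s) H.pos H.nonneg_CF
      (by have := H.small_CF; have := mul_nonneg H.nonneg_CF H.pos.le; linarith)
      (convex_rect xl xr yl yr) ((H.barrier.jet.mono (by norm_num : 2 ≤ 3)).sideJet s)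
      (abs_sideJet_le (fun k l hkl => H.barrier.bound k l (by omega)) s) H.small_flux hp'
      (by rw [sideJet_zero_zero]; linarith [H.barrier.one_le _ hp'])
      (H.barrier.flux s hs _ (node_mem_segment H.pos H.width H.height hps))
      (q := fun i j => node xl yl h (p + ((i : ℕ) : ℤ) • s.inward + off j • s.tangent))
      (fun i j => hnode (add_inward_mem_gridPts hM hN hp (by omega) j))
      (fun i j => by rw [node_add, node_add]; ext <;> simp [toPlane, pos₃, pos₂] <;> ring)
    rw [sideJet_zero_zero] at key
    exact key

/-- Stability: residuals of size `T` inside and of size `T / h` on the flux sides. -/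
theorem abs_le (H : IsFineMesh xl xr yl yr a b K σ S CI CF B W h M N) {V : ℤ × ℤ → ℝ} {T : ℝ}
    (hT : 0 ≤ T) (hI : ∀ p ∈ interiorPts M N, |interiorOp a b K h p V| ≤ T)
    (hF : ∀ s ∈ S, ∀ p ∈ s.innerPts M N, |fluxOp a b K σ h s p V| ≤ T * (1 / h))
    (hD : ∀ s ∉ S, ∀ p ∈ s.pts M N, V p = 0) : ∀ p ∈ gridPts M N, |V p| ≤ T * B := by
  classical
  have hM := H.two_le_M
  have hN := H.two_le_N
  have hnode : ∀ {p}, p ∈ gridPts M N → node xl yl h p ∈ rect xl xr yl yr :=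
    fun hp => node_mem_rect H.pos H.width H.height hp
  intro p hp
  refine (abs_le_mul_of_supersolution ((finite_Icc _ _).prod (finite_Icc _ _)) H.hocOp_nonpos
    (fun q hq => by linarith [H.barrier.one_le _ (hnode hq)]) (fun q _ => ?_) H.hocOp_barrier_le
    hT ?_ ?_ p hp).trans
    (mul_le_mul_of_nonneg_left
      ((le_abs_self _).trans (H.barrier.bound 0 0 (by norm_num) _ (hnode hp))) hT)
  · have := H.pos
    split_ifs <;> positivity
  · rintro q (hq | ⟨s, hs, hq⟩)
    · rw [hocOp_interior hq, if_pos hq, mul_one]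
      exact hI q hq
    · rw [hocOp_flux (by omega) (by omega) hs hq,
        if_neg (s.notMem_interiorPts (s.innerPts_subset_pts M N hq))]
      exact hF s hs q hq
  · intro q hq hq'
    obtain ⟨s, hs, hqs⟩ := exists_mem_pts_of_notMem_stencilPts H.sides hq hq'
    exact hD s hs q hqs

theorem exists_isHOCSolution (H : IsFineMesh xl xr yl yr a b K σ S CI CF B W h M N)
    (F : ℤ × ℤ → ℝ) (u₁ g : ℝ × ℝ → ℝ) :
    ∃ U, IsHOCSolution xl yl a b K σ h M N S F u₁ g U := by
  classical
  have hM := H.two_le_M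
  have hN := H.two_le_N
  have hnode : ∀ {p}, p ∈ gridPts M N → node xl yl h p ∈ rect xl xr yl yr :=
    fun hp => node_mem_rect H.pos H.width H.height hp
  -- the right side of the scheme; the defect of the zero function is its negative
  let r : ℤ × ℤ → ℝ := fun p =>
    if p ∈ interiorPts M N then -interiorDefect a b K h F 0 p
    else if hs : ∃ s ∈ S, p ∈ s.innerPts M N then
      -fluxDefect a b K σ h hs.choose F (fun q => g (node xl yl h q)) 0 p
    else u₁ (node xl yl h p)
  obtain ⟨U, hU⟩ := exists_eqOn_of_supersolution ((finite_Icc _ _).prod (finite_Icc _ _))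
    (stencilPts_subset_gridPts M N S) H.hocOp_nonpos (fun p _ hp w => hocOp_of_notMem hp w)
    (fun q hq => by linarith [H.barrier.one_le _ (hnode hq)])
    (fun q _ => by have := H.pos; split_ifs <;> positivity) H.hocOp_barrier_le r
  refine ⟨U, ?_, ?_, ?_⟩
  · intro p hp
    have h1 := hU (interiorPts_subset_gridPts M N hp)
    rw [hocOp_interior hp] at h1
    rw [interiorDefect_eq, h1]
    simp only [r, if_pos hp]
    ring
  · intro s hs p hp
    have hps := s.innerPts_subset_pts M N hp
    have h1 := hU (s.pts_subset_gridPts M N hps)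
    rw [hocOp_flux (by omega) (by omega) hs hp] at h1
    have h2 : ∃ s ∈ S, p ∈ s.innerPts M N := ⟨s, hs, hp⟩
    have h3 : h2.choose = s :=
      Side.eq_of_mem_innerPts (by omega) (by omega) h2.choose_spec.2 hps
    rw [fluxDefect_eq, h1]
    simp only [r, if_neg (s.notMem_interiorPts hps), dif_pos h2, h3]
    ring
  · intro s hs p hp
    have hn := notMem_stencilPts (by omega) (by omega) hs hp
    have h1 := hU (s.pts_subset_gridPts M N hp)
    rw [hocOp_of_notMem hn] at h1
    rw [h1]
    have h2 : ¬∃ s ∈ S, p ∈ s.innerPts M N := fun h => hn (Or.inr h)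
    simp only [r, if_neg (s.notMem_interiorPts hp), dif_neg h2]

/-- The error of a solution is controlled by the truncation errors of a grid function `v` with
the same Dirichlet values. -/
theorem abs_sub_le (H : IsFineMesh xl xr yl yr a b K σ S CI CF B W h M N) {F : ℤ × ℤ → ℝ}
    {u₁ g : ℝ × ℝ → ℝ} {U v : ℤ × ℤ → ℝ} (hU : IsHOCSolution xl yl a b K σ h M N S F u₁ g U)
    {T : ℝ} (hT : 0 ≤ T) (hI : ∀ p ∈ interiorPts M N, |interiorDefect a b K h F v p| ≤ T)
    (hF : ∀ s ∈ S, ∀ p ∈ s.innerPts M N,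
      |fluxDefect a b K σ h s F (fun q => g (node xl yl h q)) v p| ≤ T * (1 / h))
    (hD : ∀ s ∉ S, ∀ p ∈ s.pts M N, v p = u₁ (node xl yl h p)) :
    ∀ p ∈ gridPts M N, |v p - U p| ≤ T * B := by
  refine H.abs_le (V := v - U) hT (fun p hp => ?_) (fun s hs p hp => ?_) fun s hs p hp => ?_
  · have h1 := hU.interior p hp
    have h2 := hI p hp
    rw [interiorDefect_eq] at h1 h2
    rwa [map_sub, eq_neg_of_add_eq_zero_left h1, sub_neg_eq_add]
  · have h1 := hU.flux s hs p hp
    have h2 := hF s hs p hp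
    rw [fluxDefect_eq] at h1 h2
    rwa [map_sub, eq_neg_of_add_eq_zero_left h1, sub_neg_eq_add]
  · rw [Pi.sub_apply, hD s hs p hp, hU.dirichlet s hs p hp, sub_self]

end IsFineMesh

/-! ### Convergence -/

theorem exists_isFineMesh {xl xr yl yr : ℝ} (hx : xl < xr) (hy : yl < yr) (a b : ℝ) {K σ : ℝ}
    (hK : K ≤ 0) (hσ : 0 ≤ σ) {S : Set Side}
    (hS : S ⊆ {Side.left, Side.right} ∨ S ⊆ {Side.bottom, Side.top}) :
    ∃ h₀ CI CF B W, 0 < h₀ ∧ 0 ≤ CI ∧ 0 ≤ CF ∧ 0 ≤ B ∧ ∀ (h : ℝ) (M N : ℕ), 0 < h → h ≤ h₀ →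
      M * h = xr - xl → N * h = yr - yl →
      IsFineMesh xl xr yl yr a b K σ S CI CF B W h M N := by
  obtain ⟨B, W, hW⟩ := exists_isBarrier hx hy a b hK hS
  have hB : 1 ≤ B := by
    have hmem : (xl, yl) ∈ rect xl xr yl yr := ⟨left_mem_Icc.2 hx.le, left_mem_Icc.2 hy.le⟩
    exact (hW.one_le _ hmem).trans ((le_abs_self _).trans (hW.bound 0 0 (by norm_num) _ hmem))
  -- one bound for the coefficients of the equation in the coordinates of all four sides
  set C₀ := 1 + |a| + |b| + |K| + |σ| with hC₀
  have ha0 := abs_nonneg a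
  have hb0 := abs_nonneg b
  have hK0 := abs_nonneg K
  have hσ0 := abs_nonneg σ
  have hC1 : 1 ≤ C₀ := by linarith
  -- `Z h ≤ 1` implies all smallness conditions, as `1 ≤ B`
  set Z := (36000 * C₀ + 360) * B with hZ
  have hZ0 : 0 < Z := by positivity
  refine ⟨min (min ((xr - xl) / 2) ((yr - yl) / 2)) (1 / Z), 240 * C₀, 6000 * C₀, B, W,
    lt_min (lt_min (by linarith) (by linarith)) (by positivity), by positivity, by positivity,
    by positivity, ?_⟩
  intro h M N hh hh0 hM hN
  have h1 : h ≤ (xr - xl) / 2 := hh0.trans ((min_le_left _ _).trans (min_le_left _ _))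
  have h2 : h ≤ (yr - yl) / 2 := hh0.trans ((min_le_left _ _).trans (min_le_right _ _))
  have h3 : Z * h ≤ 1 := by
    have := hh0.trans (min_le_right _ _)
    rwa [le_div_iff₀ hZ0, mul_comm] at this
  have hBh : h ≤ B * h := le_mul_of_one_le_left hh.le hB
  have hCh : C₀ * h ≤ C₀ * (B * h) := mul_le_mul_of_nonneg_left hBh (by linarith)
  have hCh0 : 0 ≤ C₀ * h := by positivity
  have hBh0 : 0 ≤ B * h := by positivity
  have h4 : 36000 * (C₀ * (B * h)) + 360 * (B * h) ≤ 1 := by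
    rw [hZ] at h3; linarith only [h3]
  refine ⟨hh, hM, hN, ?_, ?_, hS, ?_, fun s => ?_, by positivity, by positivity, ?_, ?_, hW,
    ?_, ?_⟩
  · have : (2 : ℝ) * h ≤ M * h := by linarith
    exact_mod_cast le_of_mul_le_mul_right this hh
  · have : (2 : ℝ) * h ≤ N * h := by linarith
    exact_mod_cast le_of_mul_le_mul_right this hh
  · exact interiorStencilBounds a b hK hC1 (by linarith) (by linarith) (by linarith) hh
      (by linarith)
  · have hab : |a * s.inward.1 + b * s.inward.2| ≤ C₀ ∧
        |a * s.tangent.1 + b * s.tangent.2| ≤ C₀ := by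
      cases s <;> simp [Side.inward, Side.tangent] <;> constructor <;> linarith
    exact fluxStencilBounds hK hσ hC1 hab.1 hab.2 (by linarith) (by linarith) hh (by linarith)
  · linarith
  · linarith
  · linarith
  · linarith

theorem mainTheorem3 (xl xr yl yr : ℝ) (hx : xl < xr) (hy : yl < yr)
    (a b K σ : ℝ) (hK : K ≤ 0) (hσ : 0 ≤ σ)
    (S : Set Side) (hS : S ⊆ {Side.left, Side.right} ∨ S ⊆ {Side.bottom, Side.top}) :
    ∃ h₀ C₁ C₂ C : ℝ, 0 < h₀ ∧
      ∀ (h : ℝ) (M N : ℕ), 0 < h → h ≤ h₀ → M * h = xr - xl → N * h = yr - yl →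
      ∀ (f u₁ g u : ℝ × ℝ → ℝ), IsBVPSolution xl xr yl yr a b K σ S f u₁ g u →
      ∀ (E : ℝ) (F : ℤ × ℤ → ℝ), IsSourceExtension xl yl h M N S f E F →
        (∀ D : ℝ, DerivBound (rect xl xr yl yr) 3 6 u D → ∀ p ∈ interiorPts M N,
          |interiorDefect a b K h F (fun q => u (node xl yl h q)) p| ≤ C₁ * D * h ^ 4) ∧
        (∀ D : ℝ, DerivBound (rect xl xr yl yr) 0 5 u D → ∀ s ∈ S, ∀ p ∈ s.innerPts M N,
          |fluxDefect a b K σ h s F (fun q => g (node xl yl h q))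
            (fun q => u (node xl yl h q)) p| ≤ C₂ * (D + E) * h ^ 3) ∧
        (∃ U : ℤ × ℤ → ℝ, IsHOCSolution xl yl a b K σ h M N S F u₁ g U) ∧
        (∀ U V : ℤ × ℤ → ℝ, IsHOCSolution xl yl a b K σ h M N S F u₁ g U →
          IsHOCSolution xl yl a b K σ h M N S F u₁ g V → EqOn U V (gridPts M N)) ∧
        (∀ D : ℝ, DerivBound (rect xl xr yl yr) 0 6 u D → ∀ U : ℤ × ℤ → ℝ,
          IsHOCSolution xl yl a b K σ h M N S F u₁ g U →
          ∀ p ∈ gridPts M N, |u (node xl yl h p) - U p| ≤ C * (D + E) * h ^ 4) := by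
  obtain ⟨h₀, CI, CF, B, W, hh₀, hCI, hCF, hB, H⟩ := exists_isFineMesh hx hy a b hK hσ hS
  set C₁ := 2880 + 54 * CI + 148 * CI * (2 + |a| + |b| + |K|) with hC₁
  set C₂ := 960 + 9 * CF * (1 + 189 * (2 + |a| + |b| + |K|)) + 3 * CF * (1 + |σ|) + 15 * CF
    with hC₂
  have hC₁0 : 0 ≤ C₁ := by positivity
  have hC₂0 : 0 ≤ C₂ := by positivity
  refine ⟨h₀, C₁, C₂, (C₁ + C₂) * B, hh₀, ?_⟩
  intro h M N hh hh0 hM hN f u₁ g u hu E F hF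
  have Hm := H h M N hh hh0 hM hN
  have small : ∀ {c : ℝ}, 0 ≤ c → 6 * (c * h) ≤ 1 → c * h ≤ 1 := fun hc h1 => by
    have := mul_nonneg hc hh.le
    linarith
  have hI : ∀ D : ℝ, DerivBound (rect xl xr yl yr) 3 6 u D → ∀ p ∈ interiorPts M N,
      |interiorDefect a b K h F (fun q => u (node xl yl h q)) p| ≤ C₁ * D * h ^ 4 :=
    fun D hD p hp => abs_interiorDefect_le hx hy hu hh hM hN Hm.interior hCI
      (small hCI Hm.small_CI) hF.grid hD hp
  have hFl : ∀ D : ℝ, DerivBound (rect xl xr yl yr) 0 5 u D → ∀ s ∈ S, ∀ p ∈ s.innerPts M N,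
      |fluxDefect a b K σ h s F (fun q => g (node xl yl h q))
        (fun q => u (node xl yl h q)) p| ≤ C₂ * (D + E) * h ^ 3 :=
    fun D hD s hs p hp => abs_fluxDefect_le hx hy hu hh hM hN Hm.two_le_M Hm.two_le_N hs
      (Hm.flux s) hCF (small hCF Hm.small_CF) hF hD hp
  refine ⟨hI, hFl, Hm.exists_isHOCSolution F u₁ g, ?_, ?_⟩
  -- a second solution is a grid function without truncation errors
  · intro U V hU hV p hp
    have h1 := Hm.abs_sub_le hV (v := U) le_rfl (fun q hq => by rw [hU.interior q hq, abs_zero])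
      (fun s hs q hq => by rw [hU.flux s hs q hq, abs_zero, zero_mul]) hU.dirichlet p hp
    rw [zero_mul] at h1
    exact sub_eq_zero.1 (abs_nonpos_iff.1 h1)
  · intro D hD U hU p hp
    have hE := hF.nonneg
    have hD0 : 0 ≤ D := (abs_nonneg _).trans
      (hD 0 0 le_rfl (Nat.zero_le _) _ (node_mem_rect hh hM hN hp))
    have h1 := Hm.abs_sub_le hU (v := fun q => u (node xl yl h q))
      (T := (C₁ + C₂) * (D + E) * h ^ 4) (by positivity)
      (fun q hq => (hI D (fun k l _ h6 => hD k l (Nat.zero_le _) h6) q hq).trans ?_)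
      (fun s hs q hq => (hFl D (fun k l _ h5 => hD k l (Nat.zero_le _) (by omega)) s hs q hq).trans
        ?_)
      (fun s hs q hq => hu.dirichlet s hs _ (node_mem_segment hh hM hN hq)) p hp
    · calc _ ≤ _ := h1
        _ = (C₁ + C₂) * B * (D + E) * h ^ 4 := by ring
    · refine mul_le_mul_of_nonneg_right ?_ (by positivity)
      exact mul_le_mul (by linarith) (by linarith) hD0 (by positivity)
    -- on the flux sides the maximum principle admits one power of `h` less
    · have e : (C₁ + C₂) * (D + E) * h ^ 4 * (1 / h) = (C₁ + C₂) * (D + E) * h ^ 3 := by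
        field_simp
      rw [e]
      have : 0 ≤ D + E := by linarith
      refine mul_le_mul_of_nonneg_right (mul_le_mul_of_nonneg_right (by linarith) this)
        (by positivity)
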